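/- Let $T>0$, $\Lambda\in\mathbb{R}$ and $d_1,\dots,d_4>0$. There is a constant $C\ge 0$, depending only on $T$, $\Lambda$ and $d_1,\dots,d_4$, such that the following holds. Let $N\in\mathbb{N}_0$, let $\Omega\subset\mathbb{R}^N$ be a bounded domain with boundary of class $C^1$, and put $\Omega_T=(0,T)\times\Omega$. Let $k,l\in L_{1,loc}([0,\infty))$, where $k$ is nonnegative and nonincreasing on $(0,\infty)$, $(k*l)(t)=\int_0^t k(t-\tau)l(\tau)\,d\tau=1$ for almost every $t>0$, and $\|l\|_{L_1((0,T))}=\Lambda$. Let $a_1,\dots,a_4$ be positive integers, let $\nu_f=\nu_b>0$, and put $$r(c_1,c_2,c_3,c_4)=-\nu_f\,c_1^{a_1}c_2^{a_2}+\nu_b\,c_3^{a_3}c_4^{a_4},\qquad \sigma_1=\sigma_2=1,\quad \sigma_3=\sigma_4=-1 .$$ Let $c_i^0\in L_\infty(\Omega)$ with $c_i^0>0$ a.e. in $\Omega$, $i=1,\dots,4$. Suppose that $c=(c_1,\dots,c_4)$ is a sufficiently smooth solution of the subdiffusion-reaction system $$\partial_t\big(k*[c_i-c_i^0]\big)-d_i\Delta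 c_i=\sigma_i\,a_i\,r(c_1,c_2,c_3,c_4)\quad\text{in }\Omega_T,\qquad \partial_\nu c_i=0\quad\text{on }(0,T)\times\partial\Omega,\qquad i=1,\dots,4,$$ with $c_i(t,\cdot)\to c_i^0$ in $L_2(\Omega)$ as $t\to0+$, and that $c_i>0$ in $\Omega_T$ for all $i$. Here *sufficiently smooth* means: $c_i$ is bounded on $(0,T]\times\overline\Omega$; $c_i(t,\cdot)\in C^2(\Omega)\cap C^1(\overline\Omega)$ for every $t\in(0,T]$; $c_i$ and $\nabla c_i$ are continuous on $(0,T]\times\overline\Omega$; and $\nabla c_i\in L_2(\Omega_T)$, $\Delta c_i\in L_1(\Omega_T)$. The differential equation is understood in the classical sense: for almost every $x\in\Omega$, the function $t\mapsto (k*[c_i(\cdot,x)-c_i^0(x)])(t)$ is differentiable at every $t\in(0,T)$ and the equation holds there. Then, with $\phi(s)=s\log s-s+1$, the entropy variables $z_i=\phi(c_i)$ and $z_i^0=\phi(c_i^0)$ satisfy $$\sum_{i=1}^4\|z_i\|_{L_2(\Omega_T)}\le C\sum_{i=1}^4\|z_i^0\|_{L_2(\Omega)} .$$ -/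

import Mathlib

open MeasureTheory Filter Topology
open scoped NNReal ENNReal

/-- Convolution on the positive half-line: `(k * v)(t) = ∫₀ᵗ k(t - τ) v(τ) dτ`. -/
noncomputable def timeConv (k v : ℝ → ℝ) (t : ℝ) : ℝ :=
  ∫ τ in (0 : ℝ)..t, k (t - τ) * v τ

/-- `(k, l) ∈ PC`: the kernel `k` is locally integrable on `[0, ∞)`, nonnegative and nonincreasing
on `(0, ∞)`, and `l` is a locally integrable kernel on `[0, ∞)` with `k * l = 1` on `(0, ∞)`
(as `L¹` functions, that is, almost everywhere). -/
structure IsPCPair (k l : ℝ → ℝ) : Prop where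
  locallyIntegrable_left : LocallyIntegrableOn k (Set.Ici 0)
  nonneg : ∀ t, 0 < t → 0 ≤ k t
  antitone : AntitoneOn k (Set.Ioi 0)
  locallyIntegrable_right : LocallyIntegrableOn l (Set.Ici 0)
  conv_eq_one : ∀ᵐ t ∂(volume.restrict (Set.Ioi (0 : ℝ))), timeConv k l t = 1

section Domain

variable {N : ℕ}

/-- `ρ` is a `C¹` defining function of `Ω` near the boundary point `p`: `ρ p = 0`, `∇ρ(p) ≠ 0`, and
near `p` the set `Ω` is `{ρ < 0}`. -/
structure IsLocalDefiningFunction (Ω : Set (EuclideanSpace ℝ (Fin N)))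
    (p : EuclideanSpace ℝ (Fin N)) (ρ : EuclideanSpace ℝ (Fin N) → ℝ) : Prop where
  contDiffAt : ContDiffAt ℝ 1 ρ p
  eq_zero : ρ p = 0
  gradient_ne_zero : gradient ρ p ≠ 0
  mem_iff : ∀ᶠ x in 𝓝 p, x ∈ Ω ↔ ρ x < 0

/-- A bounded domain with boundary of class `C¹`. -/
structure IsBoundedC1Domain (Ω : Set (EuclideanSpace ℝ (Fin N))) : Prop where
  isOpen : IsOpen Ω
  isConnected : IsConnected Ω
  isBounded : Bornology.IsBounded Ω
  boundary : ∀ p ∈ frontier Ω, ∃ ρ, IsLocalDefiningFunction Ω p ρ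

/-- `n` is the outer unit normal of `Ω` at the boundary point `p`. -/
def IsOuterUnitNormal (Ω : Set (EuclideanSpace ℝ (Fin N)))
    (p n : EuclideanSpace ℝ (Fin N)) : Prop :=
  ∃ ρ, IsLocalDefiningFunction Ω p ρ ∧ n = ‖gradient ρ p‖⁻¹ • gradient ρ p

/-- The space-time spaceTimeCylinder `Ω_T = (0, T) × Ω`. -/
def spaceTimeCylinder (T : ℝ) (Ω : Set (EuclideanSpace ℝ (Fin N))) :
    Set (ℝ × EuclideanSpace ℝ (Fin N)) :=
  Set.Ioo 0 T ×ˢ Ω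

/-- The regularity class for the concentrations. The function `c` is bounded on `(0, T] × Ω̄`;
`c` and its spatial derivative are continuous on `(0, T] × Ω̄`; each `c(t, ·)` is of class
`C²(Ω) ∩ C¹(Ω̄)`; and `∇c ∈ L₂(Ω_T)`, `Δc ∈ L₁(Ω_T)`. No time derivative of `c` is required, and
nothing is required at `t = 0`, where solutions of subdiffusion equations are not smooth. -/
structure IsSufficientlySmooth (T : ℝ) (Ω : Set (EuclideanSpace ℝ (Fin N)))
    (c : ℝ → EuclideanSpace ℝ (Fin N) → ℝ) : Prop where
  bounded : ∃ M : ℝ, ∀ t ∈ Set.Ioc 0 T, ∀ x ∈ closure Ω, |c t x| ≤ M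
  continuousOn : ContinuousOn (fun p : ℝ × EuclideanSpace ℝ (Fin N) => c p.1 p.2)
    (Set.Ioc 0 T ×ˢ closure Ω)
  contDiffOn_closure : ∀ t ∈ Set.Ioc 0 T, ContDiffOn ℝ 1 (c t) (closure Ω)
  continuousOn_deriv : ContinuousOn
    (fun p : ℝ × EuclideanSpace ℝ (Fin N) => fderivWithin ℝ (c p.1) (closure Ω) p.2)
    (Set.Ioc 0 T ×ˢ closure Ω)
  contDiffOn : ∀ t ∈ Set.Ioc 0 T, ContDiffOn ℝ 2 (c t) Ω
  memLp_deriv : MemLp (fun p : ℝ × EuclideanSpace ℝ (Fin N) => fderiv ℝ (c p.1) p.2) 2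
    (volume.restrict (spaceTimeCylinder T Ω))
  integrable_laplacian : IntegrableOn
    (fun p : ℝ × EuclideanSpace ℝ (Fin N) => Laplacian.laplacian (c p.1) p.2)
    (spaceTimeCylinder T Ω)

/-- Homogeneous Neumann condition `∂_ν c = 0` on `(0, T) × ∂Ω`. -/
def HomogeneousNeumann (T : ℝ) (Ω : Set (EuclideanSpace ℝ (Fin N)))
    (c : ℝ → EuclideanSpace ℝ (Fin N) → ℝ) : Prop :=
  ∀ t ∈ Set.Ioo 0 T, ∀ p ∈ frontier Ω, ∀ n, IsOuterUnitNormal Ω p n →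
    fderivWithin ℝ (c t) (closure Ω) p n = 0

/-- The initial condition `c|_{t=0} = c₀` in `Ω`, in the sense of `L₂(Ω)`. -/
def HasInitialValue (Ω : Set (EuclideanSpace ℝ (Fin N)))
    (c : ℝ → EuclideanSpace ℝ (Fin N) → ℝ) (c₀ : EuclideanSpace ℝ (Fin N) → ℝ) : Prop :=
  Tendsto (fun t => eLpNorm (fun x => c t x - c₀ x) 2 (volume.restrict Ω)) (𝓝[>] 0) (𝓝 0)

end Domain

/-- The mass action reaction rate `r = -ν_f c₁^{a₁} c₂^{a₂} + ν_b c₃^{a₃} c₄^{a₄}`. -/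
def reactionRate (νf νb : ℝ) (a : Fin 4 → ℕ) (c : Fin 4 → ℝ) : ℝ :=
  -νf * (c 0 ^ a 0 * c 1 ^ a 1) + νb * (c 2 ^ a 2 * c 3 ^ a 3)

/-- The sign in front of the reaction term: `+1` for the species 1, 2 and `-1` for 3, 4. -/
def reactionSign : Fin 4 → ℝ := ![1, 1, -1, -1]

/-- `c = (c₁, …, c₄)` is a sufficiently smooth solution of the subdiffusion-reaction system
`∂_t (k * [c_i - c_i⁰]) - d_i Δ c_i = ± a_i r(c₁, …, c₄)` in `(0, T) × Ω` with homogeneous Neumann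
boundary conditions and initial data `c_i⁰`. As `c_i⁰` is given only almost everywhere, so is the
equation in `x`. -/
structure IsSmoothSolution {N : ℕ} (T : ℝ) (Ω : Set (EuclideanSpace ℝ (Fin N))) (k : ℝ → ℝ)
    (d : Fin 4 → ℝ) (νf νb : ℝ) (a : Fin 4 → ℕ)
    (c₀ : Fin 4 → EuclideanSpace ℝ (Fin N) → ℝ)
    (c : Fin 4 → ℝ → EuclideanSpace ℝ (Fin N) → ℝ) : Prop where
  smooth : ∀ i, IsSufficientlySmooth T Ω (c i)
  equation : ∀ i, ∀ᵐ x ∂(volume.restrict Ω), ∀ t ∈ Set.Ioo 0 T,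
    HasDerivAt (timeConv k (fun τ => c i τ x - c₀ i x))
      (d i * Laplacian.laplacian (c i t) x
        + reactionSign i * a i * reactionRate νf νb a (fun j => c j t x)) t
  neumann : ∀ i, HomogeneousNeumann T Ω (c i)
  initial : ∀ i, HasInitialValue Ω (c i) (c₀ i)

/-- The entropy function `φ(s) = s log s - s + 1`. -/
noncomputable def entropyFun (s : ℝ) : ℝ := s * Real.log s - s + 1

/-!
The proof is a duality estimate that treats the four entropies together. Put `w = ∑ dᵢ φ(cᵢ)` and
`Z = ∑ φ(cᵢ)`, with initial value `Z₀`. The core is the inequality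

  `∫∫ w (Z - Z₀) ≤ 0` over the space-time cylinder.

As `w` is comparable to `Z`, with the smallest and the largest diffusion coefficient as constants,
Young's inequality (`sq_sum_le_of_weights`) turns it into `‖Z‖² ≤ (d_max / d_min)² T ‖Z₀‖²`, and the
claim follows because all entropies are nonnegative.

*Time.* Write `fᵢ = dᵢ Δcᵢ + σᵢ aᵢ r`. Convolving the equation `∂ₜ(k * (cᵢ - cᵢ⁰)) = fᵢ` with `l`
would give `cᵢ - cᵢ⁰ = l * fᵢ`. For a convex `φ` one has
`φ(cᵢ) - φ(cᵢ⁰) ≤ l * (φ'(cᵢ) fᵢ)` (`IsConjugatePair.comp_sub_le_conv`). For absolutely continuous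
functions this comes from the inequality `k * φ(u)' ≤ φ'(u) (k * u')`, which holds because `k` is
nonnegative and nonincreasing, and from `l ≥ 0`, which is itself a consequence of the same
inequality (`IsConjugatePair.right_nonneg`). The solution need not be differentiable in time;
backward averages reduce to the regular case. With `φ(s) = s² / 2` the inequality shows that `l` is
of positive type (`IsConjugatePair.integral_prod_nonneg`).

*Space.* Multiply the inequality for `φ(s) = s log s - s + 1` by `w ≥ 0`, sum over `i` and
integrate: `∫∫ w (Z - Z₀) ≤ ∫∫ l(t - τ) ∫ w(t) ∑ log cᵢ(τ) fᵢ(τ) dx dτ dt`. At fixed times `t, τ`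
Green's formula bounds the diffusion part of the inner integral by `-∫ ∇w(t) · ∇w(τ)`, up to a term
with a favourable sign, and the double integral of this against `l(t - τ)` is nonpositive because
`l` is of positive type. The reaction part is nonpositive because `∑ log cᵢ σᵢ aᵢ r` equals
`-ν (A - B) (log A - log B)` with `A = c₁^a₁ c₂^a₂` and `B = c₃^a₃ c₄^a₄`
(`exists_reaction_dissipation_bound`). The abstract form of this step is
`IsConjugatePair.integral_mul_le`.

*Regularization.* The logarithm is unbounded on the range of the concentrations, so all of this is
done for `φ(s + ε)`, which costs an error of order `ε |log ε|` in the reaction part, and `ε → 0` at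
the end.

Green's formula on a bounded `C¹` domain is proved for functions with vanishing normal derivative
only. The field `F = g ∇u` is then tangential at the boundary, and no surface integral is needed: in
a boundary chart `{ρ < 0}` the field is cut off by `χ(ρ / δ)`, and the error
`δ⁻¹ χ'(ρ / δ) F · ∇ρ` lives in a layer of volume `O(δ)` where `F · ∇ρ` is small.
-/

/-! ### Convexity inequality for nonincreasing kernels -/

open Set in
/-- A nonnegative nonincreasing kernel is a superposition of indicators of intervals `(0, s)`, so
the positivity of the integrals of `p` over all intervals `(s, t)` passes to the integral against
the kernel. -/
theorem integral_antitone_mul_nonneg {κ p : ℝ → ℝ} {t : ℝ}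
    (hκ0 : ∀ s, 0 < s → 0 ≤ κ s) (hκ : AntitoneOn κ (Ioi 0))
    (hp : IntegrableOn p (Ioo 0 t))
    (hint : IntegrableOn (fun τ => κ (t - τ) * p τ) (Ioo 0 t))
    (h : ∀ s ∈ Icc 0 t, 0 ≤ ∫ τ in s..t, p τ) :
    0 ≤ ∫ τ in Ioo 0 t, κ (t - τ) * p τ := by
  set μ : Measure ℝ := volume.restrict (Ioo 0 t) with hμ
  have hmono : MonotoneOn (fun τ => κ (t - τ)) (Ioo 0 t) := by
    intro a ha b hb hab
    exact hκ (by simpa using hb.2) (by simpa using ha.2) (by linarith)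
  have hmeas : AEMeasurable (fun τ => κ (t - τ)) μ :=
    aemeasurable_restrict_of_monotoneOn measurableSet_Ioo hmono
  obtain ⟨g, hg, hgk⟩ := hmeas
  have hg0 : ∀ᵐ τ ∂μ, 0 ≤ g τ := by
    filter_upwards [hgk, ae_restrict_mem measurableSet_Ioo] with τ h1 h2
    rw [← h1]; exact hκ0 _ (by linarith [h2.2])
  have hgp : Integrable (fun τ => g τ * p τ) μ := by
    refine hint.congr ?_
    filter_upwards [hgk] with τ h1
    rw [h1]
  have e1 : ∫ τ in Ioo 0 t, κ (t - τ) * p τ = ∫ τ, g τ * p τ ∂μ := by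
    refine integral_congr_ae ?_
    filter_upwards [hgk] with τ h1
    rw [h1]
  set ν : Measure ℝ := volume.restrict (Ioi 0)
  have hslice : ∀ τ, 0 ≤ g τ → ν.real (Iio (g τ)) = g τ := by
    intro τ hτ
    simp only [ν, Measure.real, Measure.restrict_apply measurableSet_Iio]
    rw [Set.inter_comm, Ioi_inter_Iio]; simp [hτ]
  have hslice' : ∀ τ, ν (Iio (g τ)) ≠ ∞ := by
    intro τ
    simp only [ν, Measure.restrict_apply measurableSet_Iio]
    rw [Set.inter_comm, Ioi_inter_Iio]; simp
  let Φ : ℝ → ℝ → ℝ := fun τ y => (Iio (g τ)).indicator (fun _ => p τ) y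
  have e2 : ∀ᵐ τ ∂μ, ∫ y, Φ τ y ∂ν = g τ * p τ := by
    filter_upwards [hg0] with τ hτ
    simp only [Φ]
    rw [integral_indicator_const _ measurableSet_Iio, hslice τ hτ, smul_eq_mul]
  have hΦ : Integrable (Function.uncurry Φ) (μ.prod ν) := by
    have hS : MeasurableSet {z : ℝ × ℝ | z.2 < g z.1} :=
      measurableSet_lt measurable_snd (hg.comp measurable_fst)
    have : Function.uncurry Φ = {z : ℝ × ℝ | z.2 < g z.1}.indicator (fun z => p z.1) := by
      ext ⟨τ, y⟩
      simp [Φ, Function.uncurry, indicator]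
    have hm : AEStronglyMeasurable (Function.uncurry Φ) (μ.prod ν) := by
      rw [this]
      exact (hp.aestronglyMeasurable.comp_fst).indicator hS
    rw [integrable_prod_iff hm]
    refine ⟨Eventually.of_forall fun τ => ?_, ?_⟩
    · exact (integrable_indicator_iff measurableSet_Iio).2
        (integrableOn_const (C := p τ) (hslice' τ))
    · refine hgp.norm.congr ?_
      filter_upwards [hg0] with τ hτ
      have : ∀ y, ‖Function.uncurry Φ (τ, y)‖ = (Iio (g τ)).indicator (fun _ => ‖p τ‖) y := by
        intro y
        simp only [Function.uncurry, Φ, norm_indicator_eq_indicator_norm]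
      simp only [this]
      rw [integral_indicator_const _ measurableSet_Iio, hslice τ hτ, smul_eq_mul, norm_mul,
        Real.norm_of_nonneg hτ]
  rw [e1, ← integral_congr_ae e2, integral_integral_swap hΦ]
  refine integral_nonneg fun y => ?_
  -- The superlevel sets of `τ ↦ κ (t - τ)` in `(0, t)` are intervals with right end point `t`.
  have e3 : ∫ τ, Φ τ y ∂μ = ∫ τ in {τ | τ ∈ Ioo 0 t ∧ y < κ (t - τ)}, p τ := by
    have : ∀ τ, Φ τ y = {τ | y < g τ}.indicator p τ := fun τ => by
      simp [Φ, indicator]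
    simp only [this]
    have hS : MeasurableSet {τ | y < g τ} := measurableSet_lt measurable_const hg
    rw [integral_indicator hS, hμ, Measure.restrict_restrict hS]
    refine setIntegral_congr_set ?_
    have := (ae_restrict_iff' measurableSet_Ioo).1 hgk
    filter_upwards [this] with τ h1
    apply propext
    constructor
    · rintro ⟨ha, hb⟩
      exact ⟨hb, by rw [h1 hb]; exact ha⟩
    · rintro ⟨ha, hb⟩
      exact ⟨by rw [h1 ha] at hb; exact hb, ha⟩
  rw [Pi.zero_apply, e3]
  set S := {τ | τ ∈ Ioo 0 t ∧ y < κ (t - τ)} with hS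
  rcases S.eq_empty_or_nonempty with hE | hne
  · simp [hE]
  have hbdd : BddBelow S := ⟨0, fun τ hτ => hτ.1.1.le⟩
  obtain ⟨τ₀, hτ₀⟩ := hne
  have hs0 : 0 ≤ sInf S := le_csInf ⟨τ₀, hτ₀⟩ fun τ hτ => hτ.1.1.le
  have hst : sInf S ≤ t := (csInf_le hbdd hτ₀).trans hτ₀.1.2.le
  have key : S =ᵐ[volume] Ioc (sInf S) t := by
    have h1 : Ioo (sInf S) t ⊆ S := by
      intro τ hτ
      obtain ⟨σ, hσ, hστ⟩ := exists_lt_of_csInf_lt ⟨τ₀, hτ₀⟩ hτ.1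
      refine ⟨⟨hs0.trans_lt hτ.1, hτ.2⟩, hσ.2.trans_le (hmono hσ.1 ⟨hs0.trans_lt hτ.1, hτ.2⟩ hστ.le)⟩
    have h2 : S ⊆ Icc (sInf S) t := fun τ hτ => ⟨csInf_le hbdd hτ, hτ.1.2.le⟩
    have h3 : Ioo (sInf S) t =ᵐ[volume] Ioc (sInf S) t := Ioo_ae_eq_Ioc
    have h4 : Icc (sInf S) t =ᵐ[volume] Ioc (sInf S) t := Ioc_ae_eq_Icc.symm
    exact (h2.eventuallyLE.trans h4.le).antisymm (h3.symm.le.trans h1.eventuallyLE)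
  rw [setIntegral_congr_set key, ← intervalIntegral.integral_of_le hst]
  exact h _ ⟨hs0, hst⟩

open Set in
theorem AbsolutelyContinuousOnInterval.lipschitzOnWith_comp {f φ : ℝ → ℝ} {a b : ℝ} {K : ℝ≥0}
    {s : Set ℝ} (hf : AbsolutelyContinuousOnInterval f a b) (hφ : LipschitzOnWith K φ s)
    (hs : ∀ x ∈ uIcc a b, f x ∈ s) : AbsolutelyContinuousOnInterval (fun x => φ (f x)) a b := by
  have h0 : Tendsto (fun E : ℕ × (ℕ → ℝ × ℝ) =>
      K * ∑ i ∈ Finset.range E.1, dist (f (E.2 i).1) (f (E.2 i).2))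
      (totalLengthFilter ⊓ 𝓟 (disjWithin a b)) (𝓝 0) := by
    simpa using Tendsto.const_mul (K : ℝ) hf
  refine squeeze_zero' (Eventually.of_forall fun E => Finset.sum_nonneg fun i _ => dist_nonneg)
    ?_ h0
  have : ∀ᶠ E in (totalLengthFilter ⊓ 𝓟 (disjWithin a b)), E ∈ disjWithin a b :=
    eventually_inf_principal.2 (Eventually.of_forall fun _ h => h)
  filter_upwards [this] with E hE
  rw [Finset.mul_sum]
  refine Finset.sum_le_sum fun i hi => ?_
  exact hφ.dist_le_mul _ (hs _ (hE.1 i hi).1) _ (hs _ (hE.1 i hi).2)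

/-- `φ` is convex and continuously differentiable on `[m, M]`, with derivative `ψ`. Convexity is
expressed by the position of the graph above its tangents. -/
structure IsC1ConvexOn (m M : ℝ) (φ ψ : ℝ → ℝ) : Prop where
  hasDerivAt : ∀ s ∈ Set.Icc m M, HasDerivAt φ (ψ s) s
  continuousOn : ContinuousOn ψ (Set.Icc m M)
  tangent_le : ∀ a ∈ Set.Icc m M, ∀ b ∈ Set.Icc m M, φ a + ψ a * (b - a) ≤ φ b

open Set in
/-- The chain rule for an absolutely continuous inner function. -/
theorem IsC1ConvexOn.integral_comp_mul {m M : ℝ} {φ ψ : ℝ → ℝ} (hφ : IsC1ConvexOn m M φ ψ)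
    {q u : ℝ → ℝ} (hq : Integrable q) {u₀ : ℝ} (hu : ∀ t, u t = u₀ + ∫ τ in (0 : ℝ)..t, q τ)
    {s t : ℝ} (huI : ∀ τ ∈ uIcc s t, u τ ∈ Icc m M) :
    ∫ τ in s..t, ψ (u τ) * q τ = φ (u t) - φ (u s) := by
  obtain ⟨K, hK⟩ : ∃ K, ∀ x ∈ Icc m M, ‖ψ x‖ ≤ K :=
    isCompact_Icc.exists_bound_of_continuousOn hφ.continuousOn
  have hlip : LipschitzOnWith K.toNNReal φ (Icc m M) :=
    (convex_Icc m M).lipschitzOnWith_of_nnnorm_hasDerivWithin_le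
      (fun x hx => (hφ.hasDerivAt x hx).hasDerivWithinAt) fun x hx => by
        rw [← NNReal.coe_le_coe, coe_nnnorm]
        exact (hK x hx).trans (Real.le_coe_toNNReal K)
  have hu' : ∀ τ, u τ = u s + ∫ x in s..τ, q x := fun τ => by
    rw [hu, hu s, add_assoc, intervalIntegral.integral_add_adjacent_intervals
      hq.intervalIntegrable hq.intervalIntegrable]
  have hac : AbsolutelyContinuousOnInterval u s t := by
    have h1 : AbsolutelyContinuousOnInterval (fun x => ∫ v in s..x, q v) s t :=
      hq.intervalIntegrable.absolutelyContinuousOnInterval_intervalIntegral left_mem_uIcc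
    have h2 : AbsolutelyContinuousOnInterval (fun _ : ℝ => u s) s t := by
      simp [AbsolutelyContinuousOnInterval, tendsto_const_nhds]
    have e : u = (fun _ => u s) + fun x => ∫ v in s..x, q v := funext hu'
    rw [e]
    exact h2.add h1
  rw [← (hac.lipschitzOnWith_comp hlip huI).integral_deriv_eq_sub]
  refine intervalIntegral.integral_congr_ae ?_
  filter_upwards [LocallyIntegrable.ae_hasDerivAt_integral hq.locallyIntegrable] with τ hτ hτI
  have h1 : HasDerivAt u (q τ) τ := by
    have := (hτ 0).const_add u₀
    rwa [← funext hu] at this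
  exact ((hφ.hasDerivAt _ (huI τ (uIoc_subset_uIcc hτI))).comp τ h1).deriv.symm

/-! ### Causal convolutions and conjugate kernels -/

/-- Convolution on the line, `∫ a(t - τ) b(τ) dτ`. -/
noncomputable def lineConv (a b : ℝ → ℝ) (t : ℝ) : ℝ := ∫ τ, a (t - τ) * b τ

open scoped Convolution in
theorem lineConv_eq_convolution (a b : ℝ → ℝ) :
    lineConv a b = a ⋆[ContinuousLinearMap.mul ℝ ℝ, volume] b := by
  ext t
  rw [convolution_mul_swap]; rfl

open scoped Convolution in
theorem lineConv_comm (a b : ℝ → ℝ) : lineConv a b = lineConv b a := by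
  ext t
  rw [lineConv_eq_convolution, convolution_mul]
  simp only [lineConv, mul_comm]

theorem integrable_lineConv {a b : ℝ → ℝ} (ha : Integrable a) (hb : Integrable b) :
    Integrable (lineConv a b) := by
  rw [lineConv_eq_convolution]
  exact ha.integrable_convolution _ hb

theorem integrable_prod_lineConv {a b : ℝ → ℝ} (ha : Integrable a) (hb : Integrable b) :
    Integrable (fun p : ℝ × ℝ => a (p.1 - p.2) * b p.2) (volume.prod volume) := by
  have := hb.convolution_integrand (ContinuousLinearMap.mul ℝ ℝ) ha
  simpa [mul_comm] using this

theorem ae_integrable_lineConv {a b : ℝ → ℝ} (ha : Integrable a) (hb : Integrable b) :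
    ∀ᵐ t, Integrable (fun τ => a (t - τ) * b τ) :=
  (integrable_prod_lineConv ha hb).prod_right_ae

theorem integral_lineConv {a b : ℝ → ℝ} (ha : Integrable a) (hb : Integrable b) :
    ∫ t, lineConv a b t = (∫ t, a t) * ∫ t, b t := by
  have := integral_convolution (ContinuousLinearMap.mul ℝ ℝ) ha hb
  rw [lineConv_eq_convolution, this]; rfl

theorem integral_norm_lineConv_le {a b : ℝ → ℝ} (ha : Integrable a) (hb : Integrable b) :
    ∫ t, ‖lineConv a b t‖ ≤ (∫ t, ‖a t‖) * ∫ t, ‖b t‖ := by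
  rw [← integral_lineConv ha.norm hb.norm]
  refine integral_mono (integrable_lineConv ha hb).norm (integrable_lineConv ha.norm hb.norm) ?_
  intro t
  refine (norm_integral_le_integral_norm _).trans (le_of_eq ?_)
  simp [lineConv]

open scoped Convolution in
theorem lineConv_assoc {a b c : ℝ → ℝ} (ha : Integrable a) (hb : Integrable b)
    (hc : Integrable c) :
    ∀ᵐ t, lineConv (lineConv a b) c t = lineConv a (lineConv b c) t := by
  have h1 : Integrable ((fun x => ‖b x‖) ⋆[ContinuousLinearMap.mul ℝ ℝ, volume] fun x => ‖c x‖) :=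
    hb.norm.integrable_convolution _ hc.norm
  filter_upwards [ha.norm.ae_convolution_exists (ContinuousLinearMap.mul ℝ ℝ) h1] with t ht
  simp only [lineConv_eq_convolution]
  exact convolution_assoc _ _ _ _ (fun x y z => by simp [mul_assoc]) ha.1 hb.1 hc.1
    (ha.ae_convolution_exists _ hb) (hb.norm.ae_convolution_exists _ hc.norm) ht

theorem lineConv_sub {a b c : ℝ → ℝ} (ha : Integrable a) (hb : Integrable b)
    (hc : Integrable c) :
    ∀ᵐ t, lineConv a (fun τ => b τ - c τ) t = lineConv a b t - lineConv a c t := by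
  filter_upwards [ae_integrable_lineConv ha hb, ae_integrable_lineConv ha hc] with t h1 h2
  simp only [lineConv, mul_sub]
  exact integral_sub h1 h2

theorem lineConv_translate (a b : ℝ → ℝ) (h t : ℝ) :
    lineConv a (fun τ => b (τ - h)) t = lineConv a b (t - h) := by
  rw [lineConv, lineConv, ← integral_sub_right_eq_self (fun τ => a (t - h - τ) * b τ) h]
  simp only [sub_sub_sub_cancel_right]

/-- A causal convolution at time `t ≤ T` sees its second factor only on `(-∞, T)`. -/
theorem lineConv_congr {a b c : ℝ → ℝ} {T t : ℝ} (ha : ∀ s, s ≤ 0 → a s = 0)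
    (hbc : ∀ᵐ τ, τ < T → b τ = c τ) (ht : t ≤ T) : lineConv a b t = lineConv a c t := by
  refine integral_congr_ae ?_
  filter_upwards [hbc] with τ hτ
  rcases lt_or_ge τ T with h | h
  · rw [hτ h]
  · rw [ha _ (by linarith), zero_mul, zero_mul]

theorem lineConv_mono {a b c : ℝ → ℝ} {T : ℝ} (ha : Integrable a) (hb : Integrable b)
    (hc : Integrable c) (ha0 : ∀ s, s ≤ 0 → a s = 0) (hapos : ∀ᵐ s, s < T → 0 ≤ a s)
    (hb0 : ∀ τ, τ ≤ 0 → b τ = 0) (hc0 : ∀ τ, τ ≤ 0 → c τ = 0)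
    (hbc : ∀ᵐ τ, τ ∈ Set.Ioo 0 T → b τ ≤ c τ) :
    ∀ᵐ t, t < T → lineConv a b t ≤ lineConv a c t := by
  filter_upwards [ae_integrable_lineConv ha hb, ae_integrable_lineConv ha hc] with t h1 h2 ht
  refine integral_mono_ae h1 h2 ?_
  filter_upwards [hbc, (quasiMeasurePreserving_sub_left_of_right_invariant volume t).ae hapos]
    with τ hτ hτ'
  rcases le_or_gt τ 0 with h | h
  · simp [hb0 τ h, hc0 τ h]
  rcases lt_or_ge τ t with h' | h'
  · exact mul_le_mul_of_nonneg_left (hτ ⟨h, h'.trans ht⟩) (hτ' (by linarith))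
  · simp [ha0 (t - τ) (by linarith)]

theorem lineConv_nonneg {a b : ℝ → ℝ} {T t : ℝ} (ht : t < T)
    (ha0 : ∀ s, s ≤ 0 → a s = 0) (hapos : ∀ᵐ s, s < T → 0 ≤ a s)
    (hb0 : ∀ τ, τ ≤ 0 → b τ = 0) (hb : ∀ᵐ τ, τ ∈ Set.Ioo 0 T → 0 ≤ b τ) :
    0 ≤ lineConv a b t := by
  refine integral_nonneg_of_ae ?_
  filter_upwards [hb, (quasiMeasurePreserving_sub_left_of_right_invariant volume t).ae hapos]
    with τ hτ hτ'
  rcases le_or_gt τ 0 with h | h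
  · simp [hb0 τ h]
  rcases lt_or_ge τ t with h' | h'
  · exact mul_nonneg (hτ' (by linarith)) (hτ ⟨h, h'.trans ht⟩)
  · simp [ha0 (t - τ) (by linarith)]

theorem lineConv_eq_zero {a b : ℝ → ℝ} {t : ℝ} (ht : t ≤ 0) (ha0 : ∀ s, s ≤ 0 → a s = 0)
    (hb0 : ∀ τ, τ ≤ 0 → b τ = 0) : lineConv a b t = 0 := by
  rw [lineConv, ← integral_zero ℝ ℝ]
  congr 1; ext τ
  rcases le_or_gt τ 0 with h | h
  · simp [hb0 τ h]
  · simp [ha0 (t - τ) (by linarith)]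

/-- For causal factors, the convolution on the line is an integral over `(0, t)`. -/
theorem lineConv_eq_setIntegral {a b : ℝ → ℝ} (t : ℝ) (ha0 : ∀ s, s ≤ 0 → a s = 0)
    (hb0 : ∀ τ, τ ≤ 0 → b τ = 0) : lineConv a b t = ∫ τ in Set.Ioo 0 t, a (t - τ) * b τ := by
  rw [lineConv, ← integral_indicator measurableSet_Ioo]
  congr 1; ext τ
  by_cases h : τ ∈ Set.Ioo 0 t
  · simp [h]
  · rw [Set.indicator_of_notMem h]
    rcases le_or_gt τ 0 with h' | h'
    · simp [hb0 τ h']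
    · simp [ha0 (t - τ) (by by_contra hh; exact h ⟨h', by linarith⟩)]

/-- A pair of kernels on the line, vanishing on `(-∞, 0]`, that are conjugate on `(0, T)`:
truncations to `(0, T)` of the kernels of a pair of class `PC` are of this form. -/
structure IsConjugatePair (T : ℝ) (κ ℓ : ℝ → ℝ) : Prop where
  integrable_left : Integrable κ
  integrable_right : Integrable ℓ
  left_causal : ∀ t, t ≤ 0 → κ t = 0
  right_causal : ∀ t, t ≤ 0 → ℓ t = 0
  nonneg : ∀ t, 0 ≤ κ t
  antitone : AntitoneOn κ (Set.Ioi 0)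
  conv_eq_one : ∀ᵐ t, t ∈ Set.Ioo 0 T → lineConv κ ℓ t = 1

namespace IsConjugatePair

variable {T : ℝ} {κ ℓ : ℝ → ℝ}

/-- Since `κ * ℓ = 1`, convolving with `ℓ` and then with `κ` is integration from `0`. The identity
holds on `(0, T)` only, because `κ * ℓ` is unspecified beyond `T`. -/
theorem conv_conv (H : IsConjugatePair T κ ℓ) {p : ℝ → ℝ} (hp : Integrable p)
    (hp0 : ∀ τ, τ ≤ 0 → p τ = 0) :
    ∀ᵐ t, t ∈ Set.Ioo 0 T → lineConv κ (lineConv ℓ p) t = ∫ τ in (0 : ℝ)..t, p τ := by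
  filter_upwards [lineConv_assoc H.integrable_left H.integrable_right hp] with t h1 ht
  rw [← h1, lineConv_eq_setIntegral t
    (fun s hs => lineConv_eq_zero hs H.left_causal H.right_causal) hp0,
    intervalIntegral.integral_of_le ht.1.le, integral_Ioc_eq_integral_Ioo]
  refine integral_congr_ae ?_
  filter_upwards [ae_restrict_mem measurableSet_Ioo, ae_restrict_of_ae
    ((quasiMeasurePreserving_sub_left_of_right_invariant volume t).ae H.conv_eq_one)] with τ h2 h3
  rw [h3 ⟨by linarith [h2.2], by linarith [h2.1, ht.2]⟩, one_mul]

theorem conv_conv' (H : IsConjugatePair T κ ℓ) {p : ℝ → ℝ} (hp : Integrable p)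
    (hp0 : ∀ τ, τ ≤ 0 → p τ = 0) :
    ∀ᵐ t, t ∈ Set.Ioo 0 T → lineConv ℓ (lineConv κ p) t = ∫ τ in (0 : ℝ)..t, p τ := by
  filter_upwards [H.conv_conv hp hp0, lineConv_assoc H.integrable_left H.integrable_right hp,
    lineConv_assoc H.integrable_right H.integrable_left hp] with t h1 h2 h3 ht
  rw [← h1 ht, ← h2, ← h3, lineConv_comm κ ℓ]

/-- The convexity inequality `κ * φ(u)' ≤ φ'(u) (κ * u')` for absolutely continuous `u`. The
difference of the two sides at time `t` is `∫ κ(t - τ) p(τ) dτ` with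
`p(τ) = (φ'(u(t)) - φ'(u(τ))) u'(τ)`, and the integral of `p` over `(s, t)` is
`φ(u(s)) - φ(u(t)) - φ'(u(t)) (u(s) - u(t)) ≥ 0`, so that `integral_antitone_mul_nonneg` applies. -/
theorem conv_comp_mul_le (H : IsConjugatePair T κ ℓ) {m M : ℝ} {φ ψ : ℝ → ℝ}
    (hφ : IsC1ConvexOn m M φ ψ) {q u : ℝ → ℝ} (hq : Integrable q) (hq0 : ∀ τ, τ ≤ 0 → q τ = 0)
    {u₀ : ℝ} (hu : ∀ t, u t = u₀ + ∫ τ in (0 : ℝ)..t, q τ) (huI : ∀ t, u t ∈ Set.Icc m M) :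
    ∀ᵐ t, 0 < t → lineConv κ (fun τ => ψ (u τ) * q τ) t ≤ ψ (u t) * lineConv κ q t := by
  obtain ⟨K, hK⟩ : ∃ K, ∀ x ∈ Set.Icc m M, ‖ψ x‖ ≤ K :=
    isCompact_Icc.exists_bound_of_continuousOn hφ.continuousOn
  have huc : Continuous u := by
    rw [funext hu]
    exact continuous_const.add (intervalIntegral.continuous_primitive
      (fun _ _ => hq.intervalIntegrable) 0)
  have hψu : Continuous fun τ => ψ (u τ) := hφ.continuousOn.comp_continuous huc huI
  filter_upwards [ae_integrable_lineConv H.integrable_left hq] with t h1 ht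
  have h2 : Integrable fun τ => κ (t - τ) * (ψ (u τ) * q τ) := by
    have := h1.bdd_mul hψu.aestronglyMeasurable (Eventually.of_forall fun τ => hK _ (huI τ))
    refine this.congr (Eventually.of_forall fun τ => ?_)
    simp only; ring
  have h3 : Integrable fun τ => (ψ (u t) - ψ (u τ)) * q τ :=
    hq.bdd_mul (continuous_const.sub hψu).aestronglyMeasurable
      (Eventually.of_forall fun τ => (norm_sub_le _ _).trans
        (add_le_add (hK _ (huI t)) (hK _ (huI τ))))
  have h4 : Integrable fun τ => κ (t - τ) * ((ψ (u t) - ψ (u τ)) * q τ) := by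
    refine ((h1.const_mul (ψ (u t))).sub h2).congr (Eventually.of_forall fun τ => ?_)
    simp only [Pi.sub_apply]; ring
  have key : 0 ≤ ∫ τ in Set.Ioo 0 t, κ (t - τ) * ((ψ (u t) - ψ (u τ)) * q τ) := by
    refine integral_antitone_mul_nonneg (fun s _ => H.nonneg s) H.antitone
      h3.integrableOn h4.integrableOn ?_
    intro s _
    have e1 : ∫ τ in s..t, (ψ (u t) - ψ (u τ)) * q τ
        = ψ (u t) * (u t - u s) - (φ (u t) - φ (u s)) := by
      rw [← hφ.integral_comp_mul hq hu (fun τ _ => huI τ)]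
      have : u t - u s = ∫ τ in s..t, q τ := by
        rw [hu, hu s, add_sub_add_left_eq_sub, intervalIntegral.integral_interval_sub_left
          hq.intervalIntegrable hq.intervalIntegrable]
      rw [this, ← intervalIntegral.integral_const_mul, ← intervalIntegral.integral_sub
        (hq.intervalIntegrable.const_mul _)]
      · simp only [sub_mul]
      · exact (hq.bdd_mul hψu.aestronglyMeasurable
          (Eventually.of_forall fun τ => hK _ (huI τ))).intervalIntegrable
    rw [e1]
    have := hφ.tangent_le _ (huI t) _ (huI s)
    linarith [this, mul_sub (ψ (u t)) (u t) (u s), mul_sub (ψ (u t)) (u s) (u t)]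
  have e2 : ∫ τ, κ (t - τ) * ((ψ (u t) - ψ (u τ)) * q τ)
      = ψ (u t) * lineConv κ q t - lineConv κ (fun τ => ψ (u τ) * q τ) t := by
    rw [lineConv, lineConv, ← integral_const_mul, ← integral_sub (h1.const_mul _) h2]
    congr 1; ext τ; ring
  have e3 := lineConv_eq_setIntegral (a := κ) (b := fun τ => (ψ (u t) - ψ (u τ)) * q τ) t
    H.left_causal (fun τ hτ => by simp [hq0 τ hτ])
  rw [lineConv] at e3
  linarith [e2, e3, key]

end IsConjugatePair

/-! ### Backward averages and nonnegativity of the conjugate kernel -/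

theorem isC1ConvexOn_half_sq (M : ℝ) :
    IsC1ConvexOn (-M) M (fun s => s ^ 2 / 2) (fun s => s) where
  hasDerivAt s _ := by
    have := (hasDerivAt_pow 2 s).div_const 2
    simpa using this
  continuousOn := continuousOn_id
  tangent_le a _ b _ := by nlinarith [sq_nonneg (a - b)]

/-- The square of the negative part is convex and continuously differentiable; only its second
derivative jumps at zero. -/
theorem isC1ConvexOn_sq_min (M : ℝ) :
    IsC1ConvexOn (-M) M (fun s => min s 0 ^ 2) (fun s => 2 * min s 0) where
  hasDerivAt s _ := by
    rcases lt_trichotomy s 0 with h | rfl | h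
    · have := hasDerivAt_pow 2 s
      rw [min_eq_left h.le]
      refine HasDerivAt.congr_of_eventuallyEq (f := fun s => s ^ 2) (by simpa using this) ?_
      filter_upwards [Iio_mem_nhds h] with x hx
      rw [min_eq_left hx.le]
    · have h1 : (fun s : ℝ => min s 0 ^ 2) =O[𝓝 0] fun s => s ^ 2 := by
        refine Asymptotics.IsBigO.of_bound 1 (Eventually.of_forall fun s => ?_)
        rcases le_total s 0 with h | h
        · simp [min_eq_left h]
        · simp [min_eq_right h]; positivity
      rw [hasDerivAt_iff_isLittleO]
      simpa using h1.trans_isLittleO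
        (Asymptotics.isLittleO_pow_id (𝕜 := ℝ) one_lt_two)
    · rw [min_eq_right h.le, mul_zero]
      refine (hasDerivAt_const s (0 : ℝ)).congr_of_eventuallyEq ?_
      filter_upwards [Ioi_mem_nhds h] with x hx
      rw [min_eq_right (le_of_lt hx)]; simp
  continuousOn := by fun_prop
  tangent_le a _ b _ := by
    rcases le_total a 0 with h | h <;> rcases le_total b 0 with h' | h' <;>
      simp only [min_eq_left, min_eq_right, h, h'] <;> nlinarith [sq_nonneg (a - b)]

theorem abs_intervalIntegral_le {q : ℝ → ℝ} (hq : Integrable q) (a b : ℝ) :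
    |∫ τ in a..b, q τ| ≤ ∫ τ, ‖q τ‖ := by
  rw [← Real.norm_eq_abs]
  refine (intervalIntegral.norm_integral_le_integral_norm_uIoc (μ := volume)).trans ?_
  exact setIntegral_le_integral hq.norm (Eventually.of_forall fun _ => norm_nonneg _)

theorem integrable_Ioo_indicator_one (T : ℝ) :
    Integrable ((Set.Ioo 0 T).indicator (fun _ => (1 : ℝ))) :=
  (integrable_indicator_iff measurableSet_Ioo).2
    (integrableOn_const (C := (1 : ℝ)) (by simp))

theorem lineConv_indicator_one {p : ℝ → ℝ} (hp0 : ∀ τ, τ ≤ 0 → p τ = 0)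
    {T t : ℝ} (ht : t ∈ Set.Ioo 0 T) :
    lineConv ((Set.Ioo 0 T).indicator fun _ => 1) p t = ∫ τ in (0 : ℝ)..t, p τ := by
  rw [lineConv_eq_setIntegral t (fun s hs => Set.indicator_of_notMem (fun h => by
    linarith [h.1]) _) hp0, intervalIntegral.integral_of_le ht.1.le, integral_Ioc_eq_integral_Ioo]
  refine setIntegral_congr_fun measurableSet_Ioo fun τ hτ => ?_
  have : t - τ ∈ Set.Ioo 0 T := ⟨by linarith [hτ.2], by linarith [hτ.1, ht.2]⟩
  rw [Set.indicator_of_mem this, one_mul]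

theorem tendsto_one_div_nhdsLT (t : ℝ) :
    Tendsto (fun n : ℕ => t - 1 / ((n : ℝ) + 1)) atTop (𝓝[≠] t) := by
  refine tendsto_nhdsWithin_iff.2 ⟨?_, Eventually.of_forall fun n => ?_⟩
  · simpa using tendsto_const_nhds.sub (tendsto_one_div_add_atTop_nhds_zero_nat (𝕜 := ℝ))
  · have : (0 : ℝ) < 1 / ((n : ℝ) + 1) := by positivity
    simp only [Set.mem_compl_iff, Set.mem_singleton_iff]
    linarith

/-- Lebesgue's differentiation theorem for backward averages. -/
theorem ae_tendsto_average {f : ℝ → ℝ} (hf : Integrable f) :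
    ∀ᵐ t, Tendsto (fun n : ℕ => (∫ τ in (t - 1 / ((n : ℝ) + 1))..t, f τ) / (1 / ((n : ℝ) + 1)))
      atTop (𝓝 (f t)) := by
  filter_upwards [LocallyIntegrable.ae_hasDerivAt_integral hf.locallyIntegrable] with t ht
  have h1 := (hasDerivAt_iff_tendsto_slope.1 (ht t)).comp (tendsto_one_div_nhdsLT t)
  refine h1.congr fun n => ?_
  simp only [Function.comp, slope_def_field, intervalIntegral.integral_same, sub_zero]
  rw [intervalIntegral.integral_symm, sub_sub_cancel_left, div_neg, neg_div, neg_neg]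

/-- Backward averaging is convolution with the normalized indicator of `(0, h)`. -/
theorem average_eq_lineConv (f : ℝ → ℝ) {h : ℝ} (hh : 0 < h) (t : ℝ) :
    (∫ τ in (t - h)..t, f τ) / h
      = lineConv ((Set.Ioo 0 h).indicator fun _ => 1 / h) f t := by
  rw [intervalIntegral.integral_of_le (by linarith), integral_Ioc_eq_integral_Ioo, lineConv,
    ← integral_indicator measurableSet_Ioo, ← integral_div]
  congr 1; ext τ
  by_cases h1 : τ ∈ Set.Ioo (t - h) t
  · have h2 : t - τ ∈ Set.Ioo 0 h := ⟨by linarith [h1.2], by linarith [h1.1]⟩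
    rw [Set.indicator_of_mem h1, Set.indicator_of_mem h2]
    ring
  · rw [Set.indicator_of_notMem h1, Set.indicator_of_notMem]
    · simp
    · exact fun h2 => h1 ⟨by linarith [h2.2], by linarith [h2.1]⟩

theorem integrable_average {f : ℝ → ℝ} (hf : Integrable f) {h : ℝ} (hh : 0 < h) :
    Integrable (fun t => (∫ τ in (t - h)..t, f τ) / h) := by
  simp only [average_eq_lineConv f hh]
  refine integrable_lineConv ?_ hf
  exact (integrable_indicator_iff measurableSet_Ioo).2
    (integrableOn_const (C := (1 / h : ℝ)) (by simp))

theorem integral_norm_average_le {f : ℝ → ℝ} (hf : Integrable f) {h : ℝ} (hh : 0 < h) :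
    ∫ t, ‖(∫ τ in (t - h)..t, f τ) / h‖ ≤ ∫ t, ‖f t‖ := by
  simp only [average_eq_lineConv f hh]
  refine (integral_norm_lineConv_le ((integrable_indicator_iff measurableSet_Ioo).2
    (integrableOn_const (C := (1 / h : ℝ)) (by simp))) hf).trans (le_of_eq ?_)
  have : ∫ t, ‖(Set.Ioo 0 h).indicator (fun _ => 1 / h) t‖ = 1 := by
    simp only [norm_indicator_eq_indicator_norm]
    rw [integral_indicator_const _ measurableSet_Ioo]
    simp [hh.le, abs_of_pos hh, hh.ne']
  rw [this, one_mul]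

/-- Backward averages of an integrable function converge in `L¹`, by density of continuous
functions of compact support. -/
theorem tendsto_integral_norm_average_sub {f : ℝ → ℝ} (hf : Integrable f) (T : ℝ) :
    Tendsto (fun n : ℕ => ∫ t in Set.Ioo 0 T,
      ‖(∫ τ in (t - 1 / ((n : ℝ) + 1))..t, f τ) / (1 / ((n : ℝ) + 1)) - f t‖) atTop (𝓝 0) := by
  rw [Metric.tendsto_atTop]
  intro ε hε
  obtain ⟨g, hgs, hfg, hgc, hgi⟩ := hf.exists_hasCompactSupport_integral_sub_le
    (show (0 : ℝ) < ε / 4 by positivity)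
  have huc := hgs.uniformContinuous_of_continuous hgc
  set η : ℝ := ε / (4 * (|T| + 1)) with hη
  have hη0 : 0 < η := by positivity
  obtain ⟨δ, hδ, hgδ⟩ := Metric.uniformContinuous_iff.1 huc η hη0
  obtain ⟨n₀, hn₀⟩ := exists_nat_one_div_lt hδ
  refine ⟨n₀, fun n hn => ?_⟩
  set h : ℝ := 1 / ((n : ℝ) + 1) with hh
  have hh0 : 0 < h := by positivity
  have hhδ : h < δ := lt_of_le_of_lt (one_div_le_one_div_of_le (by positivity)
    (by exact_mod_cast Nat.succ_le_succ hn)) hn₀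
  have b1 : ∀ t, ‖(∫ τ in (t - h)..t, g τ) / h - g t‖ ≤ η := by
    intro t
    have e : (∫ τ in (t - h)..t, g τ) / h - g t = (∫ τ in (t - h)..t, (g τ - g t)) / h := by
      rw [intervalIntegral.integral_sub hgi.intervalIntegrable (by simp)]
      simp; field_simp
    rw [e, norm_div, Real.norm_of_nonneg hh0.le, div_le_iff₀ hh0]
    have := intervalIntegral.norm_integral_le_of_norm_le_const (a := t - h) (b := t) (C := η)
      (f := fun τ => g τ - g t) ?_
    · simpa [abs_of_pos hh0] using this
    · intro τ hτ
      rw [Set.uIoc_of_le (by linarith)] at hτ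
      rw [← dist_eq_norm]
      refine (hgδ ?_).le
      rw [Real.dist_eq, abs_lt]; constructor <;> linarith [hτ.1, hτ.2]
  have i1 := integrable_average (hf.sub hgi) hh0
  have i2 := integrable_average hf hh0
  have i3 := integrable_average hgi hh0
  have hle : ∀ t, ‖(∫ τ in (t - h)..t, f τ) / h - f t‖
      ≤ ‖(∫ τ in (t - h)..t, (f - g) τ) / h‖ + η + ‖f t - g t‖ := by
    intro t
    have e : (∫ τ in (t - h)..t, f τ) / h - f t = (∫ τ in (t - h)..t, (f - g) τ) / h
        + ((∫ τ in (t - h)..t, g τ) / h - g t) - (f t - g t) := by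
      simp only [Pi.sub_apply]
      rw [intervalIntegral.integral_sub hf.intervalIntegrable hgi.intervalIntegrable]
      ring
    rw [e]
    refine (norm_sub_le _ _).trans (add_le_add_left ((norm_add_le _ _).trans
      (add_le_add_right (b1 t) _)) _)
  have hηi : IntegrableOn (fun _ : ℝ => η) (Set.Ioo 0 T) := integrableOn_const (by simp)
  have hint : ∫ t in Set.Ioo 0 T, ‖(∫ τ in (t - h)..t, f τ) / h - f t‖ ≤
      ∫ t in Set.Ioo 0 T, (‖(∫ τ in (t - h)..t, (f - g) τ) / h‖ + η + ‖f t - g t‖) :=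
    integral_mono (i2.sub hf).norm.integrableOn
      ((i1.norm.integrableOn.add hηi).add (hf.sub hgi).norm.integrableOn) hle
  have e1 : ∫ t in Set.Ioo 0 T, (‖(∫ τ in (t - h)..t, (f - g) τ) / h‖ + η + ‖f t - g t‖)
      = (∫ t in Set.Ioo 0 T, ‖(∫ τ in (t - h)..t, (f - g) τ) / h‖)
        + (∫ _ in Set.Ioo 0 T, η) + ∫ t in Set.Ioo 0 T, ‖f t - g t‖ := by
    have a1 := integral_add (i1.norm.integrableOn.add hηi)
      ((hf.sub hgi).norm.integrableOn (s := Set.Ioo 0 T))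
    have a2 := integral_add (i1.norm.integrableOn (s := Set.Ioo 0 T)) hηi
    rw [← a2]
    exact a1
  have b2 : ∫ t in Set.Ioo 0 T, ‖f t - g t‖ ≤ ε / 4 :=
    (setIntegral_le_integral (hf.sub hgi).norm
      (Eventually.of_forall fun _ => norm_nonneg _)).trans hfg
  have b3 : ∫ t in Set.Ioo 0 T, ‖(∫ τ in (t - h)..t, (f - g) τ) / h‖ ≤ ε / 4 :=
    (setIntegral_le_integral i1.norm (Eventually.of_forall fun _ => norm_nonneg _)).trans
      ((integral_norm_average_le (hf.sub hgi) hh0).trans hfg)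
  have b4 : ∫ _ in Set.Ioo 0 T, η ≤ ε / 4 := by
    simp only [integral_const, MeasurableSet.univ, measureReal_restrict_apply, Set.univ_inter,
      Real.volume_real_Ioo, sub_zero, smul_eq_mul]
    have : max T 0 ≤ |T| + 1 := max_le (by linarith [le_abs_self T]) (by positivity)
    calc max T 0 * η ≤ (|T| + 1) * η := by gcongr
      _ = ε / 4 := by rw [hη]; field_simp
  rw [Real.dist_eq, sub_zero, abs_of_nonneg (integral_nonneg fun _ => norm_nonneg _)]
  linarith

namespace IsConjugatePair

variable {T : ℝ} {κ ℓ : ℝ → ℝ}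

/-- The conjugate of a nonnegative nonincreasing kernel is nonnegative. The convexity inequality
for the square of the negative part, applied to `u = ∫ₜ₋ₕᵗ ℓ`, which solves
`κ * u' = 1_{(0, h)}`, shows that the primitive of `ℓ` is nondecreasing. -/
theorem right_nonneg (H : IsConjugatePair T κ ℓ) : ∀ᵐ t, t < T → 0 ≤ ℓ t := by
  have main : ∀ h : ℝ, 0 < h → ∀ᵐ t, t ∈ Set.Ioo 0 T → 0 ≤ ∫ τ in (t - h)..t, ℓ τ := by
    intro h hh
    set q : ℝ → ℝ := fun τ => ℓ τ - ℓ (τ - h) with hq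
    have hqi : Integrable q := H.integrable_right.sub (H.integrable_right.comp_sub_right h)
    have hq0 : ∀ τ, τ ≤ 0 → q τ = 0 := fun τ hτ => by
      simp [hq, H.right_causal τ hτ, H.right_causal (τ - h) (by linarith)]
    set u : ℝ → ℝ := fun t => ∫ τ in (0 : ℝ)..t, q τ with hu
    have hu2 : ∀ t, u t = ∫ τ in (t - h)..t, ℓ τ := by
      intro t
      have hi : ∀ a b, IntervalIntegrable ℓ volume a b :=
        fun a b => H.integrable_right.intervalIntegrable
      have hz : ∫ τ in (0 - h)..0, ℓ τ = 0 := by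
        rw [intervalIntegral.integral_zero_ae]
        refine Eventually.of_forall fun τ hτ => H.right_causal τ ?_
        rw [Set.uIoc_of_le (by linarith)] at hτ
        exact hτ.2
      simp only [hu, hq]
      rw [intervalIntegral.integral_sub (hi _ _)
        (H.integrable_right.comp_sub_right h).intervalIntegrable,
        intervalIntegral.integral_comp_sub_right,
        ← intervalIntegral.integral_interval_sub_left (hi 0 t) (hi 0 (t - h)),
        ← intervalIntegral.integral_interval_sub_left (a := 0) (hi 0 (t - h)) (hi 0 (0 - h)),
        intervalIntegral.integral_symm (0 - h) 0, hz]
      ring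
    set M := ∫ τ, ‖q τ‖
    have huI : ∀ t, u t ∈ Set.Icc (-M) M := fun t =>
      abs_le.1 (abs_intervalIntegral_le hqi 0 t)
    have huc : Continuous u := intervalIntegral.continuous_primitive
      (fun _ _ => hqi.intervalIntegrable) 0
    have hφ := isC1ConvexOn_sq_min M
    set p : ℝ → ℝ := fun τ => 2 * min (u τ) 0 * q τ with hp
    have hpi : Integrable p := by
      refine hqi.bdd_mul (c := 2 * M) (by fun_prop) (Eventually.of_forall fun t => ?_)
      rw [norm_mul, Real.norm_two, Real.norm_eq_abs]
      have := huI t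
      have hM : 0 ≤ M := integral_nonneg fun _ => norm_nonneg _
      have : |min (u t) 0| ≤ M := abs_le.2 ⟨le_min this.1 (by linarith), (min_le_right _ _).trans hM⟩
      linarith
    have hp0 : ∀ τ, τ ≤ 0 → p τ = 0 := fun τ hτ => by simp [hp, hq0 τ hτ]
    have hP : ∀ t, ∫ τ in (0 : ℝ)..t, p τ = min (u t) 0 ^ 2 := by
      intro t
      have := hφ.integral_comp_mul hqi (u := u) (u₀ := 0) (fun t => by simp [hu]) (s := 0) (t := t)
        (fun τ _ => huI τ)
      rw [this]; simp [hu]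
    have hκq : ∀ᵐ t, t ∈ Set.Ioo 0 T → 0 ≤ lineConv κ q t := by
      have h2 : ∀ᵐ t, t - h ∈ Set.Ioo 0 T → lineConv κ ℓ (t - h) = 1 :=
        (measurePreserving_sub_right volume h).quasiMeasurePreserving.ae H.conv_eq_one
      filter_upwards [H.conv_eq_one, h2, lineConv_sub H.integrable_left H.integrable_right
        (H.integrable_right.comp_sub_right h)] with t h1 h2 h3 ht
      rw [h3, lineConv_translate, h1 ht]
      rcases le_or_gt (t - h) 0 with h4 | h4
      · rw [lineConv_eq_zero h4 H.left_causal H.right_causal]; norm_num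
      · rw [h2 ⟨h4, by linarith [ht.2]⟩]; norm_num
    have hκp : ∀ᵐ t, t ∈ Set.Ioo 0 T → lineConv κ p t ≤ 0 := by
      filter_upwards [hκq, H.conv_comp_mul_le hφ hqi hq0 (u := u) (u₀ := 0)
        (fun t => by simp [hu]) huI] with t h1 h2 ht
      refine (h2 ht.1).trans (mul_nonpos_of_nonpos_of_nonneg ?_ (h1 ht))
      linarith [min_le_right (u t) 0]
    set e : ℝ → ℝ := (Set.Ioo 0 T).indicator fun _ => 1 with he
    have hei : Integrable e := integrable_Ioo_indicator_one T
    have he0 : ∀ τ, τ ≤ 0 → e τ = 0 := fun τ hτ =>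
      Set.indicator_of_notMem (fun h => by linarith [h.1]) _
    have hep : ∀ τ, τ < T → lineConv e p τ = min (u τ) 0 ^ 2 := by
      intro t ht
      rcases le_or_gt t 0 with h | h
      · rw [lineConv_eq_zero h he0 hp0, ← hP, intervalIntegral.integral_zero_ae]
        refine Eventually.of_forall fun τ hτ => hp0 τ ?_
        rw [Set.uIoc_of_ge h] at hτ
        exact hτ.2
      · rw [lineConv_indicator_one hp0 ⟨h, ht⟩, hP]
    -- Integrating `κ * φ(u)' ≤ 0` gives `κ * φ(u) ≤ 0`, whence `φ(u) = 0`.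
    have hzero : ∀ᵐ t, t < T → lineConv κ (lineConv e p) t = 0 := by
      have h3 := lineConv_mono (T := T) hei (integrable_lineConv H.integrable_left hpi)
        (integrable_zero ℝ ℝ volume) he0 (Eventually.of_forall fun s _ =>
          Set.indicator_nonneg (fun _ _ => zero_le_one) s)
        (fun τ hτ => lineConv_eq_zero hτ H.left_causal hp0) (fun _ _ => rfl) hκp
      filter_upwards [h3, lineConv_assoc H.integrable_left hei hpi,
        lineConv_assoc hei H.integrable_left hpi] with t h3 h4 h5 ht
      refine le_antisymm ?_ (lineConv_nonneg ht H.left_causal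
        (Eventually.of_forall fun s _ => H.nonneg s)
        (fun τ hτ => lineConv_eq_zero hτ he0 hp0) (Eventually.of_forall fun τ hτ => ?_))
      · rw [← h4, lineConv_comm κ e, h5]
        refine (h3 ht).trans (le_of_eq ?_)
        simp [lineConv]
      · rw [hep τ hτ.2]; positivity
    have hint : ∀ᵐ t, t ∈ Set.Ioo 0 T → ∫ τ in (0 : ℝ)..t, lineConv e p τ = 0 := by
      filter_upwards [H.conv_conv' (integrable_lineConv hei hpi)
        (fun τ hτ => lineConv_eq_zero hτ he0 hp0)] with t h1 ht
      rw [← h1 ht, lineConv_congr (c := fun _ => 0) H.right_causal hzero ht.2.le]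
      simp [lineConv]
    have hderiv := LocallyIntegrable.ae_hasDerivAt_integral
      (integrable_lineConv hei hpi).locallyIntegrable
    -- The a.e. identity is upgraded to all times by continuity.
    have hall : ∀ t ∈ Set.Ioo 0 T, ∫ τ in (0 : ℝ)..t, lineConv e p τ = 0 := by
      have hc : Continuous fun t => ∫ τ in (0 : ℝ)..t, lineConv e p τ :=
        intervalIntegral.continuous_primitive
          (fun _ _ => (integrable_lineConv hei hpi).intervalIntegrable) 0
      have := Measure.eqOn_open_of_ae_eq (μ := volume)
        ((ae_restrict_iff' measurableSet_Ioo).2 hint) isOpen_Ioo hc.continuousOn continuousOn_const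
      exact this
    filter_upwards [hderiv] with t h1 ht
    have h2 : lineConv e p t = 0 := by
      refine (h1 0).unique ((hasDerivAt_const t (0 : ℝ)).congr_of_eventuallyEq ?_)
      filter_upwards [isOpen_Ioo.mem_nhds ht] with s hs using hall s hs
    rw [hep t ht.2] at h2
    have : min (u t) 0 = 0 := by simpa using h2
    rw [← hu2]
    exact min_eq_right_iff.1 this
  have h1 : ∀ᵐ t, ∀ n : ℕ, t ∈ Set.Ioo 0 T → 0 ≤ ∫ τ in (t - 1 / ((n : ℝ) + 1))..t, ℓ τ :=
    ae_all_iff.2 fun n => main _ (by positivity)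
  filter_upwards [h1, ae_tendsto_average H.integrable_right] with t h1 h2 ht
  rcases le_or_gt t 0 with h | h
  · rw [H.right_causal t h]
  · exact ge_of_tendsto' h2 fun n => div_nonneg (h1 n ⟨h, ht⟩) (by positivity)

end IsConjugatePair

/-! ### Integrated convexity inequality and positivity of the conjugate kernel -/

/-- Convolution with an integrable function preserves `L¹` limits; a subsequence converges almost
everywhere. -/
theorem exists_subseq_ae_tendsto_lineConv {a : ℝ → ℝ} (ha : Integrable a) {G : ℕ → ℝ → ℝ}
    {g : ℝ → ℝ} (hG : ∀ n, Integrable (G n)) (hg : Integrable g)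
    (h : Tendsto (fun n => ∫ t, ‖G n t - g t‖) atTop (𝓝 0)) :
    ∃ ns : ℕ → ℕ, StrictMono ns ∧
      ∀ᵐ t, Tendsto (fun n => lineConv a (G (ns n)) t) atTop (𝓝 (lineConv a g t)) := by
  have h1 : Tendsto (fun n => ∫ t, ‖lineConv a (G n) t - lineConv a g t‖) atTop (𝓝 0) := by
    have h2 := h.const_mul (∫ t, ‖a t‖)
    rw [mul_zero] at h2
    refine squeeze_zero (fun n => integral_nonneg fun _ => norm_nonneg _) (fun n => ?_) h2
    refine le_trans (le_of_eq ?_) (integral_norm_lineConv_le ha ((hG n).sub hg))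
    refine integral_congr_ae ?_
    filter_upwards [lineConv_sub ha (hG n) hg] with t ht
    rw [← ht]
  have h3 : TendstoInMeasure volume (fun n => lineConv a (G n)) atTop (lineConv a g) := by
    refine tendstoInMeasure_of_tendsto_eLpNorm one_ne_zero
      (fun n => (integrable_lineConv ha (hG n)).aestronglyMeasurable)
      (integrable_lineConv ha hg).aestronglyMeasurable ?_
    have h4 : ∀ n, eLpNorm (lineConv a (G n) - lineConv a g) 1 volume
        = ENNReal.ofReal (∫ t, ‖lineConv a (G n) t - lineConv a g t‖) := fun n => by
      rw [eLpNorm_one_eq_lintegral_enorm, ← ofReal_integral_norm_eq_lintegral_enorm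
        ((integrable_lineConv ha (hG n)).sub (integrable_lineConv ha hg))]
      rfl
    simp only [h4]
    simpa using ENNReal.tendsto_ofReal h1
  obtain ⟨ns, hns, h5⟩ := h3.exists_seq_tendsto_ae
  exact ⟨ns, hns, h5⟩

theorem integral_average_mem_Icc {w : ℝ → ℝ} (hw : Integrable w) {m M c h t : ℝ} (hh : 0 < h)
    (hwI : ∀ τ, c + w τ ∈ Set.Icc m M) :
    c + (∫ τ in (t - h)..t, w τ) / h ∈ Set.Icc m M := by
  have h1 : ∫ _ in (t - h)..t, (m - c) = h * (m - c) := by simp [mul_sub]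
  have h2 : ∫ _ in (t - h)..t, (M - c) = h * (M - c) := by simp [mul_sub]
  have h3 := intervalIntegral.integral_mono (a := t - h) (b := t) (μ := volume)
    (f := fun _ => m - c) (g := w) (by linarith) (by simp)
    hw.intervalIntegrable (fun τ => by linarith [(hwI τ).1])
  have h4 := intervalIntegral.integral_mono (a := t - h) (b := t) (μ := volume)
    (f := w) (g := fun _ => M - c) (by linarith) hw.intervalIntegrable
    (by simp) (fun τ => by linarith [(hwI τ).2])
  rw [h1] at h3
  rw [h2] at h4
  constructor
  · have : m - c ≤ (∫ τ in (t - h)..t, w τ) / h := by rw [le_div_iff₀ hh]; linarith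
    linarith
  · have : (∫ τ in (t - h)..t, w τ) / h ≤ M - c := by rw [div_le_iff₀ hh]; linarith
    linarith

/-- The backward average of `w` is the primitive of the backward difference quotient; this uses that
`w` vanishes for negative times. -/
theorem integral_diff_quotient {w : ℝ → ℝ} (hw : Integrable w) (hw0 : ∀ τ, τ ≤ 0 → w τ = 0)
    {h : ℝ} (hh : 0 < h) (t : ℝ) :
    ∫ τ in (0 : ℝ)..t, (w τ - w (τ - h)) / h = (∫ τ in (t - h)..t, w τ) / h := by
  have hi : ∀ a b, IntervalIntegrable w volume a b := fun a b => hw.intervalIntegrable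
  have hz : ∫ τ in (0 - h)..0, w τ = 0 := by
    rw [intervalIntegral.integral_zero_ae]
    refine Eventually.of_forall fun τ hτ => hw0 τ ?_
    rw [Set.uIoc_of_le (by linarith)] at hτ
    exact hτ.2
  rw [intervalIntegral.integral_div, intervalIntegral.integral_sub (hi _ _)
    (hw.comp_sub_right h).intervalIntegrable,
    intervalIntegral.integral_comp_sub_right,
    ← intervalIntegral.integral_interval_sub_left (hi 0 t) (hi 0 (t - h)),
    ← intervalIntegral.integral_interval_sub_left (a := 0) (hi 0 (t - h)) (hi 0 (0 - h)),
    intervalIntegral.integral_symm (0 - h) 0, hz]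
  ring

namespace IsConjugatePair

variable {T : ℝ} {κ ℓ : ℝ → ℝ}

/-- The convexity inequality in integrated form: if `κ * (u - u₀) = 1 * f`, that is,
`u = u₀ + ℓ * f`, then `φ(u) - φ(u₀) ≤ ℓ * (φ'(u) f)`. It is obtained from
`conv_comp_mul_le` for the backward averages of `u`, for which `κ * u'` is the backward average
of `f`; no regularity in time is needed. -/
theorem comp_sub_le_conv (H : IsConjugatePair T κ ℓ) {m M : ℝ} {φ ψ : ℝ → ℝ}
    (hφ : IsC1ConvexOn m M φ ψ) {u₀ : ℝ} {w f : ℝ → ℝ} (hw : Integrable w)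
    (hw0 : ∀ τ, τ ≤ 0 → w τ = 0) (hwI : ∀ τ, u₀ + w τ ∈ Set.Icc m M)
    (hf : Integrable f) (hf0 : ∀ τ, τ ≤ 0 → f τ = 0)
    (hwf : ∀ᵐ t, t ∈ Set.Ioo 0 T → lineConv κ w t = ∫ τ in (0 : ℝ)..t, f τ) :
    ∀ᵐ t, t ∈ Set.Ioo 0 T →
      φ (u₀ + w t) - φ u₀ ≤ lineConv ℓ (fun τ => ψ (u₀ + w τ) * f τ) t := by
  obtain ⟨K, hK⟩ : ∃ K, ∀ x ∈ Set.Icc m M, ‖ψ x‖ ≤ K :=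
    isCompact_Icc.exists_bound_of_continuousOn hφ.continuousOn
  have hK0 : 0 ≤ K := (norm_nonneg _).trans (hK _ (hwI 0))
  set h : ℕ → ℝ := fun n => 1 / ((n : ℝ) + 1) with hh
  have hpos : ∀ n, 0 < h n := fun n => by positivity
  set u : ℕ → ℝ → ℝ := fun n t => u₀ + (∫ τ in (t - h n)..t, w τ) / h n with hu
  set fav : ℕ → ℝ → ℝ := fun n t => (∫ τ in (t - h n)..t, f τ) / h n with hfav
  have huI : ∀ n t, u n t ∈ Set.Icc m M := fun n t => integral_average_mem_Icc hw (hpos n) hwI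
  have huc : ∀ n, Continuous (u n) := by
    intro n
    have : Continuous fun t => ∫ τ in (0 : ℝ)..t, (w τ - w (τ - h n)) / h n :=
      intervalIntegral.continuous_primitive
        (fun _ _ => ((hw.sub (hw.comp_sub_right (h n))).div_const _).intervalIntegrable) 0
    simp only [integral_diff_quotient hw hw0 (hpos n)] at this
    exact continuous_const.add this
  have hψu : ∀ n, Continuous fun t => ψ (u n t) := fun n =>
    hφ.continuousOn.comp_continuous (huc n) (huI n)
  have hut : ∀ᵐ t, Tendsto (fun n => u n t) atTop (𝓝 (u₀ + w t)) := by
    filter_upwards [ae_tendsto_average hw] with t ht using ht.const_add u₀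
  have hψt : ∀ᵐ t, Tendsto (fun n => ψ (u n t)) atTop (𝓝 (ψ (u₀ + w t))) := by
    filter_upwards [hut] with t ht
    exact (hφ.continuousOn _ (hwI t)).tendsto.comp
      (tendsto_nhdsWithin_iff.2 ⟨ht, Eventually.of_forall fun n => huI n t⟩)
  have hψm : AEStronglyMeasurable (fun t => ψ (u₀ + w t)) :=
    aestronglyMeasurable_of_tendsto_ae atTop (fun n => (hψu n).aestronglyMeasurable) hψt
  set G : ℕ → ℝ → ℝ := fun n => (Set.Ioo 0 T).indicator fun t => ψ (u n t) * fav n t with hG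
  set g : ℝ → ℝ := (Set.Ioo 0 T).indicator fun t => ψ (u₀ + w t) * f t with hg
  have hfavi : ∀ n, Integrable (fav n) := fun n => integrable_average hf (hpos n)
  have hGi' : ∀ n, Integrable fun t => ψ (u n t) * fav n t := fun n =>
    (hfavi n).bdd_mul (hψu n).aestronglyMeasurable (Eventually.of_forall fun t => hK _ (huI n t))
  have hGi : ∀ n, Integrable (G n) := fun n => (hGi' n).indicator measurableSet_Ioo
  have hgi' : Integrable fun t => ψ (u₀ + w t) * f t :=
    hf.bdd_mul hψm (Eventually.of_forall fun t => hK _ (hwI t))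
  have hgi : Integrable g := hgi'.indicator measurableSet_Ioo
  have hlim : Tendsto (fun n => ∫ t, ‖G n t - g t‖) atTop (𝓝 0) := by
    have l1 := (tendsto_integral_norm_average_sub hf T).const_mul K
    have l2 : Tendsto (fun n => ∫ t, ‖ψ (u n t) - ψ (u₀ + w t)‖ * ‖f t‖) atTop (𝓝 0) := by
      have : Tendsto (fun n => ∫ t, ‖ψ (u n t) - ψ (u₀ + w t)‖ * ‖f t‖) atTop
          (𝓝 (∫ _ : ℝ, (0 : ℝ))) := by
        refine tendsto_integral_of_dominated_convergence (fun t => (2 * K) * ‖f t‖)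
          (fun n => ((hψu n).aestronglyMeasurable.sub hψm).norm.mul hf.1.norm)
          (hf.norm.const_mul _) (fun n => Eventually.of_forall fun t => ?_) ?_
        · rw [norm_mul, norm_norm, norm_norm]
          gcongr
          refine (norm_sub_le _ _).trans ?_
          linarith [hK _ (huI n t), hK _ (hwI t)]
        · filter_upwards [hψt] with t ht
          have := ((ht.sub_const (ψ (u₀ + w t))).norm).mul_const ‖f t‖
          simpa using this
      simpa using this
    have l3 := l1.add l2
    rw [mul_zero, add_zero] at l3
    refine squeeze_zero (fun n => integral_nonneg fun _ => norm_nonneg _) (fun n => ?_) l3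
    have i1 : Integrable fun t => ‖fav n t - f t‖ := ((hfavi n).sub hf).norm
    have i2 : Integrable fun t => ‖ψ (u n t) - ψ (u₀ + w t)‖ * ‖f t‖ := by
      refine hf.norm.bdd_mul (c := 2 * K) ((hψu n).aestronglyMeasurable.sub hψm).norm
        (Eventually.of_forall fun t => ?_)
      rw [norm_norm]
      refine (norm_sub_le _ _).trans ?_
      linarith [hK _ (huI n t), hK _ (hwI t)]
    rw [← integral_const_mul, ← integral_indicator measurableSet_Ioo,
      ← integral_add ((i1.const_mul K).indicator measurableSet_Ioo) i2]
    refine integral_mono ((hGi n).sub hgi).norm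
      (((i1.const_mul K).indicator measurableSet_Ioo).add i2) fun t => ?_
    by_cases ht : t ∈ Set.Ioo 0 T
    · simp only [hG, hg, Set.indicator_of_mem ht]
      have e : ψ (u n t) * fav n t - ψ (u₀ + w t) * f t
          = ψ (u n t) * (fav n t - f t) + (ψ (u n t) - ψ (u₀ + w t)) * f t := by ring
      rw [e]
      refine (norm_add_le _ _).trans (add_le_add ?_ (norm_mul _ _).le)
      rw [norm_mul]
      exact mul_le_mul_of_nonneg_right (hK _ (huI n t)) (norm_nonneg _)
    · simp only [hG, hg, Set.indicator_of_notMem ht, sub_self, norm_zero, zero_add]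
      positivity
  obtain ⟨ns, hns, hns'⟩ := exists_subseq_ae_tendsto_lineConv H.integrable_right hGi hgi hlim
  have hstep : ∀ n, ∀ᵐ t, t ∈ Set.Ioo 0 T → φ (u n t) - φ u₀ ≤ lineConv ℓ (G n) t := by
    intro n
    set q : ℝ → ℝ := fun τ => (w τ - w (τ - h n)) / h n with hq
    have hqi : Integrable q := (hw.sub (hw.comp_sub_right (h n))).div_const _
    have hq0 : ∀ τ, τ ≤ 0 → q τ = 0 := fun τ hτ => by
      simp [hq, hw0 τ hτ, hw0 (τ - h n) (by linarith [hpos n])]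
    have huq : ∀ t, u n t = u₀ + ∫ τ in (0 : ℝ)..t, q τ := fun t => by
      simp only [hu, hq, integral_diff_quotient hw hw0 (hpos n)]
    have hκq : ∀ᵐ t, t ∈ Set.Ioo 0 T → lineConv κ q t = fav n t := by
      have h2 : ∀ᵐ t, t - h n ∈ Set.Ioo 0 T →
          lineConv κ w (t - h n) = ∫ τ in (0 : ℝ)..(t - h n), f τ :=
        (measurePreserving_sub_right volume (h n)).quasiMeasurePreserving.ae hwf
      filter_upwards [hwf, h2, lineConv_sub H.integrable_left hw (hw.comp_sub_right (h n))]
        with t h1 h2 h3 ht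
      have e1 : lineConv κ q t = lineConv κ (fun τ => w τ - w (τ - h n)) t / h n := by
        simp only [lineConv, hq, ← integral_div]
        congr 1; ext τ; ring
      have e2 : lineConv κ w (t - h n) = ∫ τ in (0 : ℝ)..(t - h n), f τ := by
        rcases le_or_gt (t - h n) 0 with h4 | h4
        · rw [lineConv_eq_zero h4 H.left_causal hw0, intervalIntegral.integral_zero_ae]
          refine Eventually.of_forall fun τ hτ => hf0 τ ?_
          rw [Set.uIoc_of_ge h4] at hτ
          exact hτ.2
        · exact h2 ⟨h4, by linarith [ht.2, hpos n]⟩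
      rw [e1, h3, lineConv_translate, h1 ht, e2, intervalIntegral.integral_interval_sub_left
        hf.intervalIntegrable hf.intervalIntegrable]
    set p : ℝ → ℝ := fun τ => ψ (u n τ) * q τ with hp
    have hpi : Integrable p := hqi.bdd_mul (hψu n).aestronglyMeasurable
      (Eventually.of_forall fun t => hK _ (huI n t))
    have hp0 : ∀ τ, τ ≤ 0 → p τ = 0 := fun τ hτ => by simp [hp, hq0 τ hτ]
    have hκp : ∀ᵐ t, t ∈ Set.Ioo 0 T → lineConv κ p t ≤ G n t := by
      filter_upwards [hκq, H.conv_comp_mul_le hφ hqi hq0 huq (huI n)] with t h1 h2 ht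
      rw [hG]
      simp only [Set.indicator_of_mem ht]
      rw [← h1 ht]
      exact h2 ht.1
    have hmono := lineConv_mono H.integrable_right (integrable_lineConv H.integrable_left hpi)
      (hGi n) H.right_causal H.right_nonneg
      (fun τ hτ => lineConv_eq_zero hτ H.left_causal hp0)
      (fun τ hτ => Set.indicator_of_notMem (fun h => by linarith [h.1]) _) hκp
    filter_upwards [hmono, H.conv_conv' hpi hp0] with t h1 h2 ht
    have h3 := h1 ht.2
    rw [h2 ht, hφ.integral_comp_mul hqi huq (fun τ _ => huI n τ)] at h3
    have : u n 0 = u₀ := by rw [huq]; simp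
    rwa [this] at h3
  filter_upwards [ae_all_iff.2 hstep, hns', hut] with t h1 h2 h3 ht
  have h4 : Tendsto (fun n => φ (u (ns n) t) - φ u₀) atTop (𝓝 (φ (u₀ + w t) - φ u₀)) :=
    (((hφ.hasDerivAt _ (hwI t)).continuousAt.tendsto.comp h3).comp hns.tendsto_atTop).sub_const _
  have h5 := le_of_tendsto_of_tendsto' h4 h2 fun n => h1 (ns n) ht
  have h6 : lineConv ℓ g t = lineConv ℓ (fun τ => ψ (u₀ + w τ) * f τ) t := by
    refine lineConv_congr H.right_causal (T := T) (Eventually.of_forall fun τ hτ => ?_) ht.2.le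
    rcases le_or_gt τ 0 with h | h
    · simp [hg, hf0 τ h]
    · simp only [hg, Set.indicator_of_mem (show τ ∈ Set.Ioo 0 T from ⟨h, hτ⟩)]
  rwa [h6] at h5

/-- The right kernel is of positive type on bounded functions: with `w = ℓ * g`, the integrated
convexity inequality for `s² / 2` reads `w² / 2 ≤ ℓ * (w g)`, and convolution with `κ` turns the
right-hand side into the primitive of `w g`. -/
theorem integral_mul_conv_nonneg_of_bounded (H : IsConjugatePair T κ ℓ) {g : ℝ → ℝ}
    (hg : Integrable g) (hg0 : ∀ τ, τ ∉ Set.Ioo 0 T → g τ = 0) {B : ℝ} (hB : ∀ τ, |g τ| ≤ B) :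
    0 ≤ ∫ t, g t * lineConv ℓ g t := by
  rcases le_or_gt T 0 with hT | hT
  · have : ∀ t, g t = 0 := fun t => hg0 t (by simp [hT])
    simp [this]
  have hB0 : 0 ≤ B := (abs_nonneg _).trans (hB 0)
  have hg0' : ∀ τ, τ ≤ 0 → g τ = 0 := fun τ hτ => hg0 τ fun h => by linarith [h.1]
  set M := B * ∫ t, ‖ℓ t‖ with hM
  have hM0 : 0 ≤ M := by positivity
  set w : ℝ → ℝ := (Set.Ioo 0 T).indicator (lineConv ℓ g) with hw
  have hwi : Integrable w := (integrable_lineConv H.integrable_right hg).indicator measurableSet_Ioo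
  have hw0 : ∀ τ, τ ≤ 0 → w τ = 0 := fun τ hτ =>
    Set.indicator_of_notMem (fun h => by linarith [h.1]) _
  have hwM : ∀ τ, |w τ| ≤ M := by
    intro t
    by_cases ht : t ∈ Set.Ioo 0 T
    · rw [hw, Set.indicator_of_mem ht, ← Real.norm_eq_abs]
      refine (norm_integral_le_integral_norm _).trans ?_
      have e : ∫ τ, ‖ℓ τ‖ = ∫ τ, ‖ℓ (t - τ)‖ :=
        (integral_sub_left_eq_self (fun τ => ‖ℓ τ‖) volume t).symm
      rw [hM, e, ← integral_const_mul]
      refine integral_mono_of_nonneg (Eventually.of_forall fun _ => norm_nonneg _)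
        ((H.integrable_right.comp_sub_left t).norm.const_mul B) (Eventually.of_forall fun τ => ?_)
      simp only [norm_mul]
      rw [mul_comm]
      exact mul_le_mul_of_nonneg_right (hB τ) (norm_nonneg _)
    · rw [hw, Set.indicator_of_notMem ht]; simpa using hM0
  have hwf : ∀ᵐ t, t ∈ Set.Ioo 0 T → lineConv κ w t = ∫ τ in (0 : ℝ)..t, g τ := by
    filter_upwards [H.conv_conv hg hg0'] with t h1 ht
    rw [← h1 ht]
    refine lineConv_congr H.left_causal (T := T) (Eventually.of_forall fun τ hτ => ?_) ht.2.le
    rcases le_or_gt τ 0 with h | h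
    · rw [hw0 τ h, lineConv_eq_zero h H.right_causal hg0']
    · rw [hw, Set.indicator_of_mem (show τ ∈ Set.Ioo 0 T from ⟨h, hτ⟩)]
  have hconv := H.comp_sub_le_conv (isC1ConvexOn_half_sq M) (u₀ := 0) hwi hw0
    (fun τ => by rw [zero_add]; exact abs_le.1 (hwM τ)) hg hg0' hwf
  simp only [zero_add] at hconv
  have hwg : Integrable fun τ => w τ * g τ :=
    hg.bdd_mul hwi.1 (Eventually.of_forall fun τ => hwM τ)
  have hwg0 : ∀ τ, τ ≤ 0 → w τ * g τ = 0 := fun τ hτ => by rw [hg0' τ hτ, mul_zero]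
  -- `κ * (ℓ * (w g)) = 1 * (w g)` is bounded below by `κ * (w² / 2) ≥ 0`.
  have hnn : ∀ᵐ t, t ∈ Set.Ioo 0 T → 0 ≤ ∫ τ in (0 : ℝ)..t, w τ * g τ := by
    filter_upwards [H.conv_conv hwg hwg0] with t h1 ht
    rw [← h1 ht]
    refine lineConv_nonneg ht.2 H.left_causal (Eventually.of_forall fun s _ => H.nonneg s)
      (fun τ hτ => lineConv_eq_zero hτ H.right_causal hwg0) ?_
    filter_upwards [hconv] with τ h2 hτ
    refine le_trans ?_ (h2 hτ)
    simp only [ne_eq, OfNat.ofNat_ne_zero, not_false_eq_true, zero_pow, zero_div, sub_zero]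
    positivity
  have hc : Continuous fun t => ∫ τ in (0 : ℝ)..t, w τ * g τ :=
    intervalIntegral.continuous_primitive (fun _ _ => hwg.intervalIntegrable) 0
  have hT0 : 0 ≤ ∫ τ in (0 : ℝ)..T, w τ * g τ := by
    -- The inequality holds almost everywhere on `(0, T)`, hence along a sequence tending to `T`.
    obtain ⟨s, hs, hs'⟩ : ∃ s : ℕ → ℝ, (∀ n, s n ∈ Set.Ioo 0 T ∧
        0 ≤ ∫ τ in (0 : ℝ)..(s n), w τ * g τ) ∧ Tendsto s atTop (𝓝 T) := by
      have h1 : ∀ n : ℕ, ∃ x ∈ Set.Ioo (T - T / (n + 1)) T,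
          0 ≤ ∫ τ in (0 : ℝ)..x, w τ * g τ := by
        intro n
        by_contra! hcon
        have hlt : T - T / ((n : ℝ) + 1) < T := by
          have : 0 < T / ((n : ℝ) + 1) := by positivity
          linarith
        have h0 : 0 ≤ T - T / ((n : ℝ) + 1) := by
          have : T / ((n : ℝ) + 1) ≤ T := div_le_self hT.le (by linarith [n.cast_nonneg (α := ℝ)])
          linarith
        have h2 : volume (Set.Ioo (T - T / ((n : ℝ) + 1)) T) = 0 := by
          refine measure_mono_null (fun x hx => ?_) (ae_iff.1 hnn)
          simp only [Set.mem_ofPred_eq, Classical.not_imp, not_le]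
          exact ⟨⟨h0.trans_lt hx.1, hx.2⟩, hcon x hx⟩
        rw [Real.volume_Ioo, ENNReal.ofReal_eq_zero] at h2
        linarith
      choose s hs hs2 using h1
      have h0 : ∀ n : ℕ, 0 ≤ T - T / ((n : ℝ) + 1) := fun n => by
        have : T / ((n : ℝ) + 1) ≤ T := div_le_self hT.le (by linarith [n.cast_nonneg (α := ℝ)])
        linarith
      refine ⟨s, fun n => ⟨⟨(h0 n).trans_lt (hs n).1, (hs n).2⟩, hs2 n⟩, ?_⟩
      have l1 : Tendsto (fun n : ℕ => T - T / ((n : ℝ) + 1)) atTop (𝓝 T) := by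
        have := (tendsto_one_div_add_atTop_nhds_zero_nat (𝕜 := ℝ)).const_mul T
        have := this.const_sub T
        simpa [div_eq_mul_inv] using this
      exact tendsto_of_tendsto_of_tendsto_of_le_of_le l1 tendsto_const_nhds
        (fun n => (hs n).1.le) (fun n => (hs n).2.le)
    exact ge_of_tendsto' ((hc.tendsto T).comp hs') fun n => (hs n).2
  convert hT0 using 1
  rw [intervalIntegral.integral_of_le hT.le, integral_Ioc_eq_integral_Ioo,
    ← integral_indicator measurableSet_Ioo]
  congr 1; ext t
  by_cases ht : t ∈ Set.Ioo 0 T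
  · rw [Set.indicator_of_mem ht, hw, Set.indicator_of_mem ht, mul_comm]
  · rw [Set.indicator_of_notMem ht, hg0 t ht, zero_mul]

/-- The right kernel is of positive type on all functions with integrable quadratic form. -/
theorem integral_prod_nonneg (H : IsConjugatePair T κ ℓ) {g : ℝ → ℝ}
    (hg : AEStronglyMeasurable g) (hg0 : ∀ τ, τ ∉ Set.Ioo 0 T → g τ = 0)
    (hint : Integrable (fun p : ℝ × ℝ => ℓ (p.1 - p.2) * (g p.1 * g p.2))
      (volume.prod volume)) :
    0 ≤ ∫ p : ℝ × ℝ, ℓ (p.1 - p.2) * (g p.1 * g p.2) ∂(volume.prod volume) := by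
  -- Truncation at height `n` reduces to bounded `g`.
  set G : ℕ → ℝ → ℝ := fun n t => if |g t| ≤ n then g t else 0 with hG
  have hGg : ∀ n t, |G n t| ≤ |g t| := fun n t => by
    simp only [hG]; split_ifs
    · exact le_rfl
    · simp
  have hGn : ∀ n t, |G n t| ≤ n := fun n t => by
    simp only [hG]; split_ifs with h
    · exact h
    · simp
  have hGm : ∀ n, AEStronglyMeasurable (G n) := fun n => by
    have : G n = (fun x : ℝ => if |x| ≤ n then x else 0) ∘ g := rfl
    rw [this]
    exact ((Measurable.ite (measurableSet_le (by fun_prop) measurable_const) measurable_id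
      measurable_const).comp_aemeasurable hg.aemeasurable).aestronglyMeasurable
  have hG0 : ∀ n τ, τ ∉ Set.Ioo 0 T → G n τ = 0 := fun n τ hτ => by
    simp [hG, hg0 τ hτ]
  have hGi : ∀ n, Integrable (G n) := fun n => by
    refine ((integrable_Ioo_indicator_one T).const_mul (n : ℝ)).mono' (hGm n)
      (Eventually.of_forall fun t => ?_)
    by_cases ht : t ∈ Set.Ioo 0 T
    · rw [Set.indicator_of_mem ht, mul_one]; exact hGn n t
    · simp [hG0 n t ht, ht]
  have hlim : Tendsto (fun n => ∫ p : ℝ × ℝ, ℓ (p.1 - p.2) * (G n p.1 * G n p.2)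
      ∂(volume.prod volume)) atTop
      (𝓝 (∫ p : ℝ × ℝ, ℓ (p.1 - p.2) * (g p.1 * g p.2) ∂(volume.prod volume))) := by
    refine tendsto_integral_of_dominated_convergence _ (fun n => ?_) hint.norm
      (fun n => Eventually.of_forall fun p => ?_) (Eventually.of_forall fun p => ?_)
    · have h1 := (integrable_prod_lineConv H.integrable_right (hGi n)).aestronglyMeasurable
      have h2 := h1.mul (hGm n).comp_fst
      refine h2.congr (Eventually.of_forall fun p => ?_)
      simp only [Pi.mul_apply]; ring
    · simp only [norm_mul, Real.norm_eq_abs]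
      exact mul_le_mul_of_nonneg_left (mul_le_mul (hGg n _) (hGg n _) (abs_nonneg _)
        (abs_nonneg _)) (abs_nonneg _)
    · have h1 : ∀ t, Tendsto (fun n => G n t) atTop (𝓝 (g t)) := fun t => by
        obtain ⟨N, hN⟩ := exists_nat_ge |g t|
        refine tendsto_const_nhds.congr' ?_
        filter_upwards [eventually_ge_atTop N] with n hn
        have : |g t| ≤ n := hN.trans (by exact_mod_cast hn)
        simp [hG, this]
      exact ((h1 _).mul (h1 _)).const_mul _
  refine ge_of_tendsto' hlim fun n => ?_
  have hi : Integrable (fun p : ℝ × ℝ => ℓ (p.1 - p.2) * (G n p.1 * G n p.2))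
      (volume.prod volume) := by
    refine ((integrable_prod_lineConv H.integrable_right (hGi n)).bdd_mul (hGm n).comp_fst
      (c := n) (Eventually.of_forall fun p => hGn n p.1)).congr (Eventually.of_forall fun p => ?_)
    simp only; ring
  rw [integral_prod _ hi]
  refine (H.integral_mul_conv_nonneg_of_bounded (hGi n) (hG0 n) (hGn n)).trans_eq ?_
  congr 1; ext t
  rw [lineConv, ← integral_const_mul]
  congr 1; ext τ; ring

end IsConjugatePair

/-! ### The divergence of fields with compact support -/

section Divergence

variable {N : ℕ}

open Metric Set in
/-- If `ρ` grows at rate at least `c` in the direction `e`, the layers `{-2δ ≤ ρ ≤ -δ}` have volume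
`O(δ)`: their translates by multiples of `(2δ / c) e` are disjoint. -/
theorem exists_volume_layer_le {ρ : EuclideanSpace ℝ (Fin N) → ℝ}
    {p e : EuclideanSpace ℝ (Fin N)} {r c : ℝ} (hr : 0 < r) (hc : 0 < c) (he : ‖e‖ ≤ 1)
    (hρ : ∀ x ∈ ball p r, DifferentiableAt ℝ ρ x)
    (hd : ∀ x ∈ ball p r, c ≤ fderiv ℝ ρ x e) :
    ∃ C, ∀ δ, 0 < δ →
      volume.real {x | x ∈ ball p r ∧ ρ x ∈ Icc (-(2 * δ)) (-δ)} ≤ C * δ := by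
  set V := volume.real (ball p (2 * r)) with hV
  refine ⟨V * 2 / (r * c), fun δ hδ => ?_⟩
  set L := {x | x ∈ ball p r ∧ ρ x ∈ Icc (-(2 * δ)) (-δ)} with hL
  have hρc : ContinuousOn ρ (ball p r) := fun x hx => (hρ x hx).continuousAt.continuousWithinAt
  have hLm : MeasurableSet L := by
    have : L = ball p r \ (ball p r ∩ ρ ⁻¹' (Icc (-(2 * δ)) (-δ))ᶜ) := by
      ext x; simp only [hL, mem_ofPred_eq, Set.mem_sdiff, mem_inter_iff, mem_preimage, mem_compl_iff]
      tauto
    rw [this]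
    exact measurableSet_ball.diff
      (hρc.isOpen_inter_preimage isOpen_ball isClosed_Icc.isOpen_compl).measurableSet
  set a : ℕ → ℝ := fun j => j * (2 * δ / c) with ha
  -- The largest number of steps for which the translates stay in the ball of radius `2 r`.
  set m := ⌊r * c / (2 * δ)⌋₊ with hm
  have hmono : ∀ x y : EuclideanSpace ℝ (Fin N), ∀ s : ℝ, x ∈ ball p r → y ∈ ball p r → 0 ≤ s →
      y - x = s • e → c * s ≤ ρ y - ρ x := by
    intro x y s hx hy hs hxy
    obtain ⟨z, hz, hz'⟩ := domain_mvt (f := ρ) (f' := fun z => fderiv ℝ ρ z) (s := ball p r)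
      (fun z hz => (hρ z hz).hasFDerivAt.hasFDerivWithinAt) (convex_ball p r) hx hy
    rw [hz', hxy, map_smul, smul_eq_mul, mul_comm]
    exact mul_le_mul_of_nonneg_left (hd z ((convex_ball p r).segment_subset hx hy hz)) hs
  have hdisj : (↑(Finset.range (m + 1)) : Set ℕ).PairwiseDisjoint
      (fun j => (fun x => x + a j • e) ⁻¹' L) := by
    have key : ∀ i j : ℕ, i < j →
        Disjoint ((fun x => x + a i • e) ⁻¹' L) ((fun x => x + a j • e) ⁻¹' L) := by
      intro i j hij
      rw [Set.disjoint_left]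
      intro x hi hj
      have h1 : (1 : ℝ) ≤ (j : ℝ) - i := by
        have : ((i + 1 : ℕ) : ℝ) ≤ j := by exact_mod_cast hij
        push_cast at this; linarith
      have h2 : a j - a i = ((j : ℝ) - i) * (2 * δ / c) := by simp only [ha]; ring
      have h3 : 2 * δ / c ≤ a j - a i := by
        rw [h2]; exact le_mul_of_one_le_left (by positivity) h1
      have h4 := hmono _ _ (a j - a i) hi.1 hj.1
        (le_trans (by positivity) h3) (by rw [sub_smul, add_sub_add_left_eq_sub])
      have h5 : 2 * δ ≤ c * (a j - a i) := by
        calc 2 * δ = c * (2 * δ / c) := by field_simp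
          _ ≤ _ := by gcongr
      linarith [hi.2.1, hj.2.2]
    intro i _ j _ hij
    rcases lt_or_gt_of_ne hij with h | h
    · exact key i j h
    · exact (key j i h).symm
  have hsub : (⋃ j ∈ Finset.range (m + 1), (fun x => x + a j • e) ⁻¹' L) ⊆ ball p (2 * r) := by
    simp only [iUnion_subset_iff, Finset.mem_range]
    intro j hj x hx
    have h1 : a j ≤ r := by
      have : (j : ℝ) ≤ r * c / (2 * δ) :=
        (Nat.cast_le.2 (Nat.lt_succ_iff.1 hj)).trans (Nat.floor_le (by positivity))
      calc a j ≤ r * c / (2 * δ) * (2 * δ / c) := by simp only [ha]; gcongr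
        _ = r := by field_simp
    have h2 : ‖a j • e‖ ≤ r := by
      rw [norm_smul, Real.norm_of_nonneg (by positivity)]
      calc a j * ‖e‖ ≤ r * 1 := mul_le_mul h1 he (norm_nonneg _) hr.le
        _ = r := mul_one r
    have h3 : dist (x + a j • e) p < r := hx.1
    rw [mem_ball]
    calc dist x p ≤ dist x (x + a j • e) + dist (x + a j • e) p := dist_triangle _ _ _
      _ < 2 * r := by rw [dist_self_add_right]; linarith
  have hmeas : ∀ j, MeasurableSet ((fun x => x + a j • e) ⁻¹' L) := fun j =>
    (measurable_add_const (a j • e)) hLm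
  have hle : ((m : ℝ) + 1) * volume.real L ≤ V := by
    have h1 := measureReal_mono hsub (μ := volume) (measure_ball_lt_top.ne)
    rw [measureReal_biUnion_finset hdisj (fun j _ => hmeas j)
      (fun j _ => ((measure_mono ((Set.subset_biUnion_of_mem
        (u := fun j => (fun x => x + a j • e) ⁻¹' L)
        (show j ∈ (↑(Finset.range (m + 1)) : Set ℕ) by assumption)).trans hsub)).trans_lt
          measure_ball_lt_top).ne)] at h1
    simp only [Measure.real, measure_preimage_add_right, Finset.sum_const, Finset.card_range,
      nsmul_eq_mul] at h1
    push_cast at h1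
    exact h1
  have hfl : r * c / (2 * δ) ≤ (m : ℝ) + 1 := (Nat.lt_floor_add_one _).le
  have : r * c / (2 * δ) * volume.real L ≤ V :=
    (mul_le_mul_of_nonneg_right hfl measureReal_nonneg).trans hle
  rw [div_mul_eq_mul_div, div_le_iff₀ (by positivity)] at this
  rw [div_mul_eq_mul_div, le_div_iff₀ (by positivity)]
  linarith

/-- The divergence of a vector field. -/
noncomputable def divergence (F : EuclideanSpace ℝ (Fin N) → EuclideanSpace ℝ (Fin N))
    (x : EuclideanSpace ℝ (Fin N)) : ℝ :=
  ∑ j, (fderiv ℝ F x (EuclideanSpace.single j 1)) j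

theorem sum_apply_single_mul (A : EuclideanSpace ℝ (Fin N) →L[ℝ] ℝ)
    (v : EuclideanSpace ℝ (Fin N)) : ∑ j, A (EuclideanSpace.single j 1) * v j = A v := by
  have h := (EuclideanSpace.basisFun (Fin N) ℝ).sum_repr v
  conv_rhs => rw [← h, map_sum]
  simp [mul_comm]

theorem divergence_smul {η : EuclideanSpace ℝ (Fin N) → ℝ}
    {F : EuclideanSpace ℝ (Fin N) → EuclideanSpace ℝ (Fin N)} {x : EuclideanSpace ℝ (Fin N)}
    (hη : DifferentiableAt ℝ η x) (hF : DifferentiableAt ℝ F x) :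
    divergence (fun y => η y • F y) x = η x * divergence F x + fderiv ℝ η x (F x) := by
  rw [divergence, fderiv_fun_smul hη hF, ← sum_apply_single_mul, divergence, Finset.mul_sum,
    ← Finset.sum_add_distrib]
  refine Finset.sum_congr rfl fun j _ => ?_
  simp

theorem divergence_congr {F G : EuclideanSpace ℝ (Fin N) → EuclideanSpace ℝ (Fin N)}
    {x : EuclideanSpace ℝ (Fin N)} (h : F =ᶠ[𝓝 x] G) : divergence F x = divergence G x := by
  rw [divergence, divergence, h.fderiv_eq]

theorem divergence_eq_zero_of_notMem_tsupport
    {F : EuclideanSpace ℝ (Fin N) → EuclideanSpace ℝ (Fin N)}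
    {x : EuclideanSpace ℝ (Fin N)} (h : x ∉ tsupport F) : divergence F x = 0 := by
  rw [divergence_congr (notMem_tsupport_iff_eventuallyEq.1 h)]
  simp [divergence]

theorem continuousOn_divergence {Ω : Set (EuclideanSpace ℝ (Fin N))} (hΩ : IsOpen Ω)
    {F : EuclideanSpace ℝ (Fin N) → EuclideanSpace ℝ (Fin N)} (hF : ContDiffOn ℝ 1 F Ω) :
    ContinuousOn (divergence F) Ω := by
  have := hF.continuousOn_fderiv_of_isOpen hΩ le_rfl
  unfold divergence
  refine continuousOn_finsetSum _ fun j _ => ?_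
  have h2 : ContinuousOn (fun x => fderiv ℝ F x (EuclideanSpace.single j 1)) Ω :=
    this.clm_apply continuousOn_const
  exact (EuclideanSpace.proj j : EuclideanSpace ℝ (Fin N) →L[ℝ] ℝ).continuous.comp_continuousOn h2

theorem integrable_divergence_of_hasCompactSupport
    {F : EuclideanSpace ℝ (Fin N) → EuclideanSpace ℝ (Fin N)} (hF : ContDiff ℝ 1 F)
    (hs : HasCompactSupport F) : Integrable (divergence F) := by
  refine Continuous.integrable_of_hasCompactSupport ?_ ?_
  · rw [← continuousOn_univ]
    exact continuousOn_divergence isOpen_univ hF.contDiffOn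
  · refine hs.mono' fun x hx => ?_
    by_contra h
    exact hx (divergence_eq_zero_of_notMem_tsupport h)

theorem integral_divergence_of_hasCompactSupport
    {F : EuclideanSpace ℝ (Fin N) → EuclideanSpace ℝ (Fin N)} (hF : ContDiff ℝ 1 F)
    (hs : HasCompactSupport F) : ∫ x, divergence F x = 0 := by
  have hcomp : ∀ j : Fin N, ∀ x, (fderiv ℝ F x (EuclideanSpace.single j 1)) j
      = fderiv ℝ (fun y => F y j) x (EuclideanSpace.single j 1) := by
    intro j x
    have h1 := ((EuclideanSpace.proj j : EuclideanSpace ℝ (Fin N) →L[ℝ] ℝ).hasFDerivAt.comp x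
      (hF.differentiable one_ne_zero x).hasFDerivAt).fderiv
    have h2 : (fun y => F y j) = (EuclideanSpace.proj j : EuclideanSpace ℝ (Fin N) →L[ℝ] ℝ) ∘ F :=
      rfl
    rw [h2, h1]; rfl
  have hFj : ∀ j : Fin N, ContDiff ℝ 1 fun y => F y j := fun j =>
    (EuclideanSpace.proj j : EuclideanSpace ℝ (Fin N) →L[ℝ] ℝ).contDiff.comp hF
  have hsj : ∀ j : Fin N, HasCompactSupport fun y => F y j := fun j =>
    hs.comp_left (g := fun v : EuclideanSpace ℝ (Fin N) => v j) rfl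
  have hdi : ∀ j : Fin N,
      Integrable fun x => fderiv ℝ (fun y => F y j) x (EuclideanSpace.single j 1) := fun j =>
    (((hFj j).continuous_fderiv one_ne_zero).clm_apply
      continuous_const).integrable_of_hasCompactSupport ((hsj j).fderiv_apply (𝕜 := ℝ) _)
  simp only [divergence, hcomp]
  rw [integral_finsetSum _ fun j _ => hdi j]
  refine Finset.sum_eq_zero fun j _ => ?_
  have := integral_mul_fderiv_eq_neg_fderiv_mul_of_integrable (𝕜 := ℝ) (μ := volume)
    (f := fun _ : EuclideanSpace ℝ (Fin N) => (1 : ℝ)) (g := fun y => F y j)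
    (v := EuclideanSpace.single j 1) (by simp) (by simpa using hdi j)
    (by simpa using (hFj j).continuous.integrable_of_hasCompactSupport (hsj j))
    (fun _ _ => differentiableAt_const _)
    (fun x _ => ((hFj j).differentiable one_ne_zero) x)
  simpa using this

/-! ### The divergence theorem for tangential fields in a boundary chart -/

theorem exists_abs_deriv_smoothTransition_le :
    ∃ C, 0 ≤ C ∧ ∀ s, |deriv Real.smoothTransition s| ≤ C := by
  have hc : Continuous (deriv Real.smoothTransition) :=
    Real.smoothTransition.contDiff.continuous_deriv (n := 1) le_rfl
  obtain ⟨C, hC⟩ := (isCompact_Icc (a := (0 : ℝ)) (b := 1)).exists_bound_of_continuousOn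
    hc.continuousOn
  refine ⟨C, (norm_nonneg _).trans (hC 0 (by simp)), fun s => ?_⟩
  by_cases hs : s ∈ Set.Icc (0 : ℝ) 1
  · exact hC s hs
  have : deriv Real.smoothTransition s = 0 := by
    rcases lt_or_ge s 0 with h | h
    · have : Real.smoothTransition =ᶠ[𝓝 s] fun _ => 0 := by
        filter_upwards [Iio_mem_nhds h] with x hx
          using Real.smoothTransition.zero_of_nonpos (le_of_lt hx)
      rw [this.deriv_eq]; simp
    · have h1 : 1 < s := by by_contra h2; exact hs ⟨h, not_lt.1 h2⟩
      have : Real.smoothTransition =ᶠ[𝓝 s] fun _ => 1 := by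
        filter_upwards [Ioi_mem_nhds h1] with x hx
          using Real.smoothTransition.one_of_one_le (le_of_lt hx)
      rw [this.deriv_eq]; simp
  rw [this, abs_zero]
  exact (norm_nonneg _).trans (hC 0 (by simp))

open Metric in
/-- The divergence theorem for a field tangential to the boundary and supported in a boundary chart
`Ω = {ρ < 0}`. The cutoff `χ(ρ / δ)` makes the support compact in `Ω`; its gradient is `O(1 / δ)`,
is supported in a layer of volume `O(δ)`, and is multiplied by `F · ∇ρ`, which tends to zero at the
boundary. -/
theorem integral_divergence_eq_zero_of_tsupport_subset_ball
    {Ω : Set (EuclideanSpace ℝ (Fin N))} (hΩ : IsOpen Ω)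
    {F : EuclideanSpace ℝ (Fin N) → EuclideanSpace ℝ (Fin N)}
    (hFc : ContinuousOn F (closure Ω)) (hF : ContDiffOn ℝ 1 F Ω)
    (hdiv : IntegrableOn (divergence F) Ω)
    {ρ : EuclideanSpace ℝ (Fin N) → ℝ} {p e : EuclideanSpace ℝ (Fin N)} {r c : ℝ}
    (hr : 0 < r) (hc : 0 < c) (he : ‖e‖ ≤ 1) (hρ : ContDiffOn ℝ 1 ρ (ball p r))
    (hd : ∀ x ∈ ball p r, c ≤ fderiv ℝ ρ x e)
    (hmem : ∀ x ∈ ball p r, x ∈ Ω ↔ ρ x < 0) (hsupp : tsupport F ⊆ ball p r)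
    (hflux : ∀ x ∈ ball p r, x ∈ frontier Ω → fderiv ℝ ρ x (F x) = 0) :
    ∫ x in Ω, divergence F x = 0 := by
  set B := ball p r with hB
  set K := tsupport F with hK
  have hKc : IsCompact K :=
    (isCompact_closedBall p r).of_isClosed_subset (isClosed_tsupport F)
      (hsupp.trans ball_subset_closedBall)
  set U := Ω ∩ B with hU
  have hUo : IsOpen U := hΩ.inter isOpen_ball
  have hρd : ∀ x ∈ B, DifferentiableAt ℝ ρ x := fun x hx =>
    (hρ.differentiableOn one_ne_zero).differentiableAt (isOpen_ball.mem_nhds hx)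
  have hρc : ContinuousOn ρ B := hρ.continuousOn
  have hfρ : ContinuousOn (fderiv ℝ ρ) B := hρ.continuousOn_fderiv_of_isOpen isOpen_ball le_rfl
  have hFd : ∀ x ∈ U, DifferentiableAt ℝ F x := fun x hx =>
    (hF.differentiableOn one_ne_zero).differentiableAt (hΩ.mem_nhds hx.1)
  obtain ⟨C, hC⟩ := exists_volume_layer_le hr hc he hρd hd
  obtain ⟨D, hD0, hD⟩ := exists_abs_deriv_smoothTransition_le
  -- `χ = 1` on `(-∞, -2]` and `χ = 0` on `[-1, ∞)`.
  set χ : ℝ → ℝ := fun s => Real.smoothTransition (-s - 1) with hχ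
  have hχ1 : ContDiff ℝ 1 χ :=
    Real.smoothTransition.contDiff.comp ((contDiff_id.neg).sub contDiff_const)
  have hχd : ∀ s, HasDerivAt χ (deriv χ s) s := fun s =>
    (hχ1.differentiable one_ne_zero s).hasDerivAt
  have hχD : ∀ s, |deriv χ s| ≤ D := by
    intro s
    have h1 : HasDerivAt (fun s : ℝ => -s - 1) (-1) s := ((hasDerivAt_id s).neg).sub_const 1
    have h2 := ((Real.smoothTransition.contDiff (n := 1)).differentiable one_ne_zero
      (-s - 1)).hasDerivAt.comp s h1
    have h3 : deriv χ s = deriv Real.smoothTransition (-s - 1) * -1 := h2.deriv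
    rw [h3, abs_mul]; simpa using hD (-s - 1)
  have hχ_in : ∀ s, s < -2 → χ s = 1 := fun s hs =>
    Real.smoothTransition.one_of_one_le (by linarith)
  have hχ_out : ∀ s, -1 ≤ s → χ s = 0 := fun s hs =>
    Real.smoothTransition.zero_of_nonpos (by linarith)
  have hχd0 : ∀ s, s ∉ Set.Icc (-2 : ℝ) (-1) → deriv χ s = 0 := by
    intro s hs
    rcases lt_or_ge s (-2) with h | h
    · have : χ =ᶠ[𝓝 s] fun _ => 1 := by
        filter_upwards [Iio_mem_nhds h] with x hx using hχ_in x hx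
      rw [this.deriv_eq]; simp
    · have h1 : -1 < s := by by_contra h2; exact hs ⟨h, not_lt.1 h2⟩
      have : χ =ᶠ[𝓝 s] fun _ => 0 := by
        filter_upwards [Ioi_mem_nhds h1] with x hx using hχ_out x (le_of_lt hx)
      rw [this.deriv_eq]; simp
  set δ : ℕ → ℝ := fun n => 1 / ((n : ℝ) + 1) with hδ
  have hδ0 : ∀ n, 0 < δ n := fun n => by positivity
  have hδt : Tendsto δ atTop (𝓝 0) := tendsto_one_div_add_atTop_nhds_zero_nat
  set η : ℕ → EuclideanSpace ℝ (Fin N) → ℝ := fun n x => χ (ρ x / δ n) with hη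
  have hη1 : ∀ n, ContDiffOn ℝ 1 (η n) B := fun n =>
    hχ1.comp_contDiffOn (hρ.div_const (δ n))
  have hηd : ∀ n, ∀ x ∈ B, DifferentiableAt ℝ (η n) x := fun n x hx =>
    ((hη1 n).differentiableOn one_ne_zero).differentiableAt (isOpen_ball.mem_nhds hx)
  have hηf : ∀ n, ∀ x ∈ B, ∀ v, fderiv ℝ (η n) x v
      = deriv χ (ρ x / δ n) * (fderiv ℝ ρ x v / δ n) := by
    intro n x hx v
    have h1 : HasFDerivAt (fun y => ρ y / δ n) ((δ n)⁻¹ • fderiv ℝ ρ x) x := by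
      simpa [div_eq_mul_inv, mul_comm] using (hρd x hx).hasFDerivAt.const_mul (δ n)⁻¹
    have h2 := (hχd (ρ x / δ n)).comp_hasFDerivAt x h1
    have h3 : fderiv ℝ (η n) x = deriv χ (ρ x / δ n) • (δ n)⁻¹ • fderiv ℝ ρ x := h2.fderiv
    rw [h3]; simp [div_eq_inv_mul]
  set H : ℕ → EuclideanSpace ℝ (Fin N) → EuclideanSpace ℝ (Fin N) :=
    fun n => Ω.indicator fun x => η n x • F x with hH
  set A : ℕ → Set (EuclideanSpace ℝ (Fin N)) := fun n => K ∩ ρ ⁻¹' Set.Iic (-δ n) with hA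
  have hAc : ∀ n, IsCompact (A n) := fun n => by
    have : IsClosed (A n) := (hρc.mono hsupp).preimage_isClosed_of_isClosed
      (isClosed_tsupport F) isClosed_Iic
    exact hKc.of_isClosed_subset this Set.inter_subset_left
  have hAU : ∀ n, A n ⊆ U := fun n x hx =>
    ⟨(hmem x (hsupp hx.1)).2 (lt_of_le_of_lt hx.2 (by linarith [hδ0 n])), hsupp hx.1⟩
  have hHA : ∀ n x, x ∉ A n → H n x = 0 := by
    intro n x hx
    by_cases hxΩ : x ∈ Ω
    · simp only [hH, Set.indicator_of_mem hxΩ]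
      by_cases hxK : x ∈ K
      · have h1 : -δ n < ρ x := by by_contra h; exact hx ⟨hxK, not_lt.1 h⟩
        have : η n x = 0 := hχ_out _ (by
          rw [le_div_iff₀ (hδ0 n)]; linarith)
        rw [this, zero_smul]
      · rw [image_eq_zero_of_notMem_tsupport hxK, smul_zero]
    · simp only [hH, Set.indicator_of_notMem hxΩ]
  have hHU : ∀ n, ∀ x ∈ U, H n =ᶠ[𝓝 x] fun y => η n y • F y := fun n x hx => by
    filter_upwards [hUo.mem_nhds hx] with y hy
    simp only [hH, Set.indicator_of_mem hy.1]
  have hH1 : ∀ n, ContDiff ℝ 1 (H n) := by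
    intro n
    rw [contDiff_iff_contDiffAt]
    intro x
    by_cases hx : x ∈ A n
    · have hxU := hAU n hx
      refine ContDiffAt.congr_of_eventuallyEq ?_ (hHU n x hxU)
      exact (((hη1 n).contDiffAt (isOpen_ball.mem_nhds hxU.2))).smul
        (hF.contDiffAt (hΩ.mem_nhds hxU.1))
    · refine (contDiffAt_const (c := 0)).congr_of_eventuallyEq ?_
      filter_upwards [(hAc n).isClosed.isOpen_compl.mem_nhds hx] with y hy using hHA n y hy
  have hHs : ∀ n, HasCompactSupport (H n) := fun n =>
    HasCompactSupport.intro (hAc n) fun x hx => hHA n x hx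
  have hH0 : ∀ n, ∀ x, x ∉ U → divergence (H n) x = 0 := by
    intro n x hx
    refine divergence_eq_zero_of_notMem_tsupport fun h => hx (hAU n ?_)
    exact closure_minimal (fun y hy => by by_contra h'; exact hy (hHA n y h'))
      (hAc n).isClosed h
  have hdivH : ∀ n, ∀ x ∈ U, divergence (H n) x
      = η n x * divergence F x + fderiv ℝ (η n) x (F x) := fun n x hx => by
    rw [divergence_congr (hHU n x hx), divergence_smul (hηd n x hx.2) (hFd x hx)]
  have hHint : ∀ n, ∫ x in U, divergence (H n) x = 0 := fun n => by
    rw [setIntegral_eq_integral_of_forall_compl_eq_zero fun x hx => hH0 n x hx]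
    exact integral_divergence_of_hasCompactSupport (hH1 n) (hHs n)
  have hdivU : IntegrableOn (divergence F) U := hdiv.mono_set Set.inter_subset_left
  have hηm : ∀ n, AEStronglyMeasurable (η n) (volume.restrict U) := fun n =>
    (((hη1 n).continuousOn).mono Set.inter_subset_right).aestronglyMeasurable hUo.measurableSet
  have hη01 : ∀ n x, ‖η n x‖ ≤ 1 := fun n x => by
    rw [Real.norm_of_nonneg (Real.smoothTransition.nonneg _)]
    exact Real.smoothTransition.le_one _
  have hi1 : ∀ n, IntegrableOn (fun x => η n x * divergence F x) U := fun n =>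
    Integrable.bdd_mul hdivU (hηm n) (Eventually.of_forall fun x => hη01 n x)
  have hi2 : ∀ n, IntegrableOn (fun x => fderiv ℝ (η n) x (F x)) U := fun n => by
    have h1 := (integrable_divergence_of_hasCompactSupport (hH1 n) (hHs n)).integrableOn (s := U)
    refine (h1.sub (hi1 n)).congr ?_
    filter_upwards [ae_restrict_mem hUo.measurableSet] with x hx
    simp only [Pi.sub_apply, hdivH n x hx]; ring
  have hsum : ∀ n, (∫ x in U, η n x * divergence F x)
      + ∫ x in U, fderiv ℝ (η n) x (F x) = 0 := fun n => by
    rw [← integral_add (hi1 n) (hi2 n), ← hHint n]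
    exact setIntegral_congr_fun hUo.measurableSet fun x hx => (hdivH n x hx).symm
  have hl1 : Tendsto (fun n => ∫ x in U, η n x * divergence F x) atTop
      (𝓝 (∫ x in U, divergence F x)) := by
    refine tendsto_integral_of_dominated_convergence (fun x => ‖divergence F x‖)
      (fun n => (hi1 n).aestronglyMeasurable) hdivU.norm
      (fun n => Eventually.of_forall fun x => ?_) ?_
    · rw [norm_mul]
      exact mul_le_of_le_one_left (norm_nonneg _) (hη01 n x)
    · filter_upwards [ae_restrict_mem hUo.measurableSet] with x hx
      have hρx : ρ x < 0 := (hmem x hx.2).1 hx.1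
      refine tendsto_const_nhds.congr' ?_
      have : ∀ᶠ n in atTop, δ n < -ρ x / 2 := hδt.eventually (Iio_mem_nhds (by linarith))
      filter_upwards [this] with n hn
      have : η n x = 1 := hχ_in _ (by rw [div_lt_iff₀ (hδ0 n)]; linarith)
      rw [this, one_mul]
  have hl2 : Tendsto (fun n => ∫ x in U, fderiv ℝ (η n) x (F x)) atTop (𝓝 0) := by
    rw [Metric.tendsto_atTop]
    intro ε hε
    -- The error is at most `C δ · D ε' / δ = C D ε'`.
    set ε' := ε / (2 * (D * |C| + 1)) with hε'
    have hε'0 : 0 < ε' := by positivity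
    set S := K ∩ closure Ω with hS
    have hSc : IsCompact S := hKc.inter_right isClosed_closure
    have hSB : S ⊆ B := Set.inter_subset_left.trans hsupp
    have hfl : ContinuousOn (fun x => fderiv ℝ ρ x (F x)) S :=
      (hfρ.mono hSB).clm_apply (hFc.mono Set.inter_subset_right)
    set Q := S ∩ (fun x => |fderiv ℝ ρ x (F x)|) ⁻¹' Set.Ici ε' with hQ
    have hQc : IsCompact Q :=
      hSc.of_isClosed_subset (hfl.abs.preimage_isClosed_of_isClosed hSc.isClosed isClosed_Ici)
        Set.inter_subset_left
    have hQρ : ∀ x ∈ Q, ρ x ≠ 0 := by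
      intro x hx h0
      have hxB := hSB hx.1
      have hxΩ : x ∉ Ω := fun h => by
        have := (hmem x hxB).1 h
        linarith
      have hfr : x ∈ frontier Ω := by
        rw [hΩ.frontier_eq]; exact ⟨hx.1.2, hxΩ⟩
      have h1 : ε' ≤ |fderiv ℝ ρ x (F x)| := hx.2
      rw [hflux x hxB hfr, abs_zero] at h1
      linarith
    -- The flux is below `ε'` in the layers close to the boundary.
    obtain ⟨m, hm0, hm⟩ : ∃ m, 0 < m ∧ ∀ x ∈ Q, m ≤ |ρ x| := by
      rcases Q.eq_empty_or_nonempty with h | h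
      · exact ⟨1, one_pos, by simp [h]⟩
      · obtain ⟨x₀, hx₀, hmin⟩ := hQc.exists_isMinOn h
          ((hρc.mono (Set.inter_subset_left.trans hSB)).abs)
        exact ⟨|ρ x₀|, abs_pos.2 (hQρ x₀ hx₀), fun x hx => hmin hx⟩
    have hev : ∀ᶠ n in atTop, δ n < m / 2 := hδt.eventually (Iio_mem_nhds (by linarith))
    obtain ⟨n₀, hn₀⟩ := eventually_atTop.1 hev
    refine ⟨n₀, fun n hn => ?_⟩
    have hnm := hn₀ n hn
    set L := {x | x ∈ ball p r ∧ ρ x ∈ Set.Icc (-(2 * δ n)) (-δ n)} with hL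
    have hLm : MeasurableSet L := by
      have : L = B \ (B ∩ ρ ⁻¹' (Set.Icc (-(2 * δ n)) (-δ n))ᶜ) := by
        ext x
        simp only [hL, Set.mem_ofPred_eq, Set.mem_sdiff, Set.mem_inter_iff, Set.mem_preimage,
          Set.mem_compl_iff]
        tauto
      rw [this]
      exact measurableSet_ball.diff
        (hρc.isOpen_inter_preimage isOpen_ball isClosed_Icc.isOpen_compl).measurableSet
    have hbd : ∀ x ∈ U, ‖fderiv ℝ (η n) x (F x)‖ ≤ L.indicator (fun _ => D * ε' / δ n) x := by
      intro x hx
      rw [hηf n x hx.2]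
      by_cases hxL : x ∈ L
      · rw [Set.indicator_of_mem hxL, norm_mul, norm_div, Real.norm_of_nonneg (hδ0 n).le,
          ← mul_div_assoc]
        have hle : |fderiv ℝ ρ x (F x)| ≤ ε' := by
          by_cases hxK : x ∈ K
          · by_contra hcon
            have hxQ : x ∈ Q := ⟨⟨hxK, subset_closure hx.1⟩, (not_le.1 hcon).le⟩
            have h1 := hm x hxQ
            rw [abs_of_neg ((hmem x hx.2).1 hx.1)] at h1
            linarith [hxL.2.1]
          · rw [image_eq_zero_of_notMem_tsupport hxK, map_zero, abs_zero]; exact hε'0.le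
        gcongr
        · exact hχD _
        · exact hle
      · have : ρ x / δ n ∉ Set.Icc (-2 : ℝ) (-1) := fun h => hxL ⟨hx.2, by
          have h1 := h.1
          have h2 := h.2
          rw [le_div_iff₀ (hδ0 n)] at h1
          rw [div_le_iff₀ (hδ0 n)] at h2
          constructor <;> linarith⟩
        rw [hχd0 _ this, zero_mul, norm_zero, Set.indicator_of_notMem hxL]
    have hLfin : volume L ≠ ∞ :=
      ((measure_mono fun x (hx : x ∈ L) => hx.1).trans_lt measure_ball_lt_top).ne
    have hLi : Integrable (L.indicator fun _ => D * ε' / δ n) :=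
      (integrable_indicator_iff hLm).2 (integrableOn_const (C := D * ε' / δ n) hLfin)
    rw [dist_zero_right]
    calc ‖∫ x in U, fderiv ℝ (η n) x (F x)‖
        ≤ ∫ x in U, ‖fderiv ℝ (η n) x (F x)‖ := norm_integral_le_integral_norm _
      _ ≤ ∫ x in U, L.indicator (fun _ => D * ε' / δ n) x :=
          setIntegral_mono_on (hi2 n).norm hLi.integrableOn hUo.measurableSet hbd
      _ ≤ ∫ x, L.indicator (fun _ => D * ε' / δ n) x :=
          setIntegral_le_integral hLi (Eventually.of_forall fun x =>
            Set.indicator_nonneg (fun _ _ => by have := hδ0 n; positivity) x)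
      _ = volume.real L * (D * ε' / δ n) := by
          rw [integral_indicator_const _ hLm, smul_eq_mul]
      _ ≤ C * δ n * (D * ε' / δ n) := by
          have := hδ0 n
          gcongr
          exact hC _ (hδ0 n)
      _ = C * D * ε' := by have := (hδ0 n).ne'; field_simp
      _ ≤ |C| * D * ε' := by gcongr; exact le_abs_self C
      _ < ε := by
          rw [hε', mul_div_assoc', div_lt_iff₀ (by positivity)]
          nlinarith [abs_nonneg C, mul_nonneg hD0 (abs_nonneg C)]
  have hU0 : ∫ x in U, divergence F x = 0 := by
    have h1 := hl1.add hl2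
    simp only [hsum, add_zero] at h1
    exact (tendsto_nhds_unique h1 tendsto_const_nhds)
  rw [← hU0]
  refine setIntegral_eq_of_subset_of_forall_sdiff_eq_zero hΩ.measurableSet
    Set.inter_subset_left fun x hx => ?_
  exact divergence_eq_zero_of_notMem_tsupport fun h => hx.2 ⟨hx.1, hsupp h⟩

/-! ### The divergence theorem and Green's formula on bounded `C¹` domains -/

open Metric in
/-- Around a boundary point, a defining function is defining at all boundary points of a ball, and
grows at a uniform rate in the direction of its gradient at the centre. -/
theorem IsLocalDefiningFunction.exists_ball {Ω : Set (EuclideanSpace ℝ (Fin N))} (hΩ : IsOpen Ω)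
    {p : EuclideanSpace ℝ (Fin N)} {ρ : EuclideanSpace ℝ (Fin N) → ℝ}
    (h : IsLocalDefiningFunction Ω p ρ) :
    ∃ r > 0, ∃ c > 0, ∃ e : EuclideanSpace ℝ (Fin N), ‖e‖ ≤ 1 ∧ ContDiffOn ℝ 1 ρ (ball p r) ∧
      (∀ x ∈ ball p r, c ≤ fderiv ℝ ρ x e) ∧ (∀ x ∈ ball p r, x ∈ Ω ↔ ρ x < 0) ∧
      ∀ x ∈ ball p r, x ∈ frontier Ω → IsLocalDefiningFunction Ω x ρ := by
  have hg := h.gradient_ne_zero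
  set e := ‖gradient ρ p‖⁻¹ • gradient ρ p with he
  have hn : 0 < ‖gradient ρ p‖ := norm_pos_iff.2 hg
  have hpe : fderiv ℝ ρ p e = ‖gradient ρ p‖ := by
    have : fderiv ℝ ρ p e = inner ℝ (gradient ρ p) e := by
      simp [gradient]
    rw [this, he, inner_smul_right, real_inner_self_eq_norm_sq]
    field_simp
  obtain ⟨u, hu, hρu⟩ := h.contDiffAt.contDiffOn (m := 1) le_rfl (by simp)
  have hcont : ContinuousAt (fun x => fderiv ℝ ρ x e) p :=
    (h.contDiffAt.fderiv_right (m := 0) (by norm_num)).continuousAt.clm_apply continuousAt_const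
  have hev : ∀ᶠ x in 𝓝 p, ‖gradient ρ p‖ / 2 < fderiv ℝ ρ x e :=
    hcont.eventually (Ioi_mem_nhds (by
      simp only [hpe]; linarith))
  obtain ⟨r, hr, hball⟩ := Metric.eventually_nhds_iff_ball.1 (hev.and (h.mem_iff.and hu))
  have hcd : ContDiffOn ℝ 1 ρ (ball p r) := hρu.mono fun x hx => (hball x hx).2.2
  refine ⟨r, hr, ‖gradient ρ p‖ / 2, by positivity, e, ?_, hcd, fun x hx => (hball x hx).1.le,
    fun x hx => (hball x hx).2.1, fun x hx hxf => ?_⟩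
  · rw [he, norm_smul, norm_inv, norm_norm, inv_mul_cancel₀ hn.ne']
  · have hca : ContDiffAt ℝ 1 ρ x := hcd.contDiffAt (isOpen_ball.mem_nhds hx)
    refine ⟨hca, ?_, ?_, ?_⟩
    · rw [hΩ.frontier_eq] at hxf
      refine le_antisymm ?_ (not_lt.1 fun h' => hxf.2 ((hball x hx).2.1.2 h'))
      by_contra! hpos
      have h1 : ∀ᶠ y in 𝓝 x, 0 < ρ y := hca.continuousAt.eventually (Ioi_mem_nhds hpos)
      obtain ⟨y, ⟨hy1, hy2⟩, hy3⟩ := mem_closure_iff_nhds.1 hxf.1 _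
        (h1.and (isOpen_ball.mem_nhds hx))
      have := (hball y hy2).2.1.1 hy3
      linarith
    · intro h0
      have h1 := (hball x hx).1
      have : fderiv ℝ ρ x e = inner ℝ (gradient ρ x) e := by simp [gradient]
      rw [this, h0, inner_zero_left] at h1
      linarith
    · filter_upwards [isOpen_ball.mem_nhds hx] with y hy using (hball y hy).2.1

open Metric Manifold in
/-- The divergence theorem on a bounded `C¹` domain for fields that are tangential at the
boundary. Only integrability of the divergence is required up to the boundary. -/
theorem IsBoundedC1Domain.integral_divergence_eq_zero {Ω : Set (EuclideanSpace ℝ (Fin N))}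
    (hD : IsBoundedC1Domain Ω) {F : EuclideanSpace ℝ (Fin N) → EuclideanSpace ℝ (Fin N)}
    (hFc : ContinuousOn F (closure Ω)) (hF : ContDiffOn ℝ 1 F Ω)
    (hdiv : IntegrableOn (divergence F) Ω)
    (hflux : ∀ p ∈ frontier Ω, ∀ ρ, IsLocalDefiningFunction Ω p ρ → fderiv ℝ ρ p (F p) = 0) :
    ∫ x in Ω, divergence F x = 0 := by
  have hΩ := hD.isOpen
  have hcl : IsCompact (closure Ω) := hD.isBounded.isCompact_closure
  choose! ρ hρ using hD.boundary
  choose! r hr c hc e he hρ1 hρd hmem hdef using fun p hp => (hρ p hp).exists_ball hΩ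
  obtain ⟨t, htf⟩ := (hcl.of_isClosed_subset isClosed_frontier
    frontier_subset_closure).elim_nhds_subcover' (fun p _ => ball p (r p))
    (fun p hp => ball_mem_nhds p (hr p hp))
  -- `none` stands for the interior of the domain, `some q` for the chart at the boundary point `q`.
  set V : Option t → Set (EuclideanSpace ℝ (Fin N)) := fun i =>
    i.elim Ω fun q => ball (q : frontier Ω) (r (q : frontier Ω)) with hV
  have hVo : ∀ i, IsOpen (V i) := by
    rintro (_ | q)
    · exact hΩ
    · exact isOpen_ball
  have hVc : closure Ω ⊆ ⋃ i, V i := by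
    intro x hx
    by_cases hxΩ : x ∈ Ω
    · exact Set.mem_iUnion.2 ⟨none, hxΩ⟩
    · have hxf : x ∈ frontier Ω := by rw [hΩ.frontier_eq]; exact ⟨hx, hxΩ⟩
      have := htf hxf
      simp only [Set.mem_iUnion] at this
      obtain ⟨q, hq, hxq⟩ := this
      exact Set.mem_iUnion.2 ⟨some ⟨q, hq⟩, hxq⟩
  obtain ⟨f, hf⟩ := SmoothPartitionOfUnity.exists_isSubordinate
    𝓘(ℝ, EuclideanSpace ℝ (Fin N)) isClosed_closure V hVo hVc
  have hf1 : ∀ i, ContDiff ℝ 1 (f i) := fun i =>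
    ((f i).contMDiff.contDiff).of_le (by exact_mod_cast le_top)
  have hfd : ∀ i x, DifferentiableAt ℝ (f i) x := fun i x =>
    (hf1 i).differentiable one_ne_zero x
  have hFd : ∀ x ∈ Ω, DifferentiableAt ℝ F x := fun x hx =>
    (hF.differentiableOn one_ne_zero).differentiableAt (hΩ.mem_nhds hx)
  have hdivf : ∀ i, ∀ x ∈ Ω, divergence (fun y => f i y • F y) x
      = f i x * divergence F x + fderiv ℝ (f i) x (F x) := fun i x hx =>
    divergence_smul (hfd i x) (hFd x hx)
  have hsum : ∀ x ∈ Ω, ∑ i, f i x = 1 := fun x hx => by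
    rw [← finsum_eq_sum_of_fintype]
    exact f.sum_eq_one (subset_closure hx)
  have hFb : ∃ C, ∀ x ∈ closure Ω, ‖F x‖ ≤ C := hcl.exists_bound_of_continuousOn hFc
  have hint : ∀ i, IntegrableOn (divergence fun y => f i y • F y) Ω := by
    intro i
    have h1 : IntegrableOn (fun x => f i x * divergence F x) Ω :=
      Integrable.bdd_mul hdiv ((hf1 i).continuous.aestronglyMeasurable)
        (c := 1) (Eventually.of_forall fun x => by
          rw [Real.norm_of_nonneg (f.nonneg i x)]; exact f.le_one i x)
    have h2 : IntegrableOn (fun x => fderiv ℝ (f i) x (F x)) Ω := by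
      have : ContinuousOn (fun x => fderiv ℝ (f i) x (F x)) (closure Ω) :=
        ((hf1 i).continuous_fderiv one_ne_zero).continuousOn.clm_apply hFc
      exact (this.integrableOn_compact hcl).mono_set subset_closure
    exact (h1.add h2).congr ((ae_restrict_mem hΩ.measurableSet).mono fun x hx =>
      (hdivf i x hx).symm)
  have hsplit : ∀ x ∈ Ω, divergence F x = ∑ i, divergence (fun y => f i y • F y) x := by
    intro x hx
    simp only [hdivf _ x hx, Finset.sum_add_distrib, ← Finset.sum_mul, hsum x hx, one_mul]
    -- The gradients of the partition of unity add up to zero.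
    have h0 : ∑ i, fderiv ℝ (f i) x = 0 := by
      have h1 : HasFDerivAt (fun y => ∑ i, f i y) (∑ i, fderiv ℝ (f i) x) x :=
        HasFDerivAt.fun_sum fun i _ => (hfd i x).hasFDerivAt
      refine h1.unique ((hasFDerivAt_const (1 : ℝ) x).congr_of_eventuallyEq ?_)
      filter_upwards [hΩ.mem_nhds hx] with y hy using hsum y hy
    rw [← _root_.sum_apply, h0]; simp
  rw [setIntegral_congr_fun hΩ.measurableSet hsplit, integral_finsetSum _ fun i _ => hint i]
  refine Finset.sum_eq_zero fun i _ => ?_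
  have hsub := hf i
  have hts : tsupport (fun y => f i y • F y) ⊆ tsupport (f i) :=
    closure_mono fun x hx h => hx (by simp only [h, zero_smul])
  rcases i with _ | q
  · have hsub' : tsupport (f none) ⊆ Ω := hsub
    have hK : HasCompactSupport fun y => f none y • F y :=
      hcl.of_isClosed_subset (isClosed_tsupport _)
        (hts.trans (hsub'.trans subset_closure))
    have h1 : ContDiff ℝ 1 fun y => f none y • F y := by
      rw [contDiff_iff_contDiffAt]
      intro x
      by_cases hx : x ∈ Ω
      · exact (hf1 none).contDiffAt.smul (hF.contDiffAt (hΩ.mem_nhds hx))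
      · have : x ∉ tsupport fun y => f none y • F y := fun h => hx (hsub' (hts h))
        exact (contDiffAt_const (c := 0)).congr_of_eventuallyEq
          (notMem_tsupport_iff_eventuallyEq.1 this)
    rw [setIntegral_eq_integral_of_forall_compl_eq_zero fun x hx =>
      divergence_eq_zero_of_notMem_tsupport fun h => hx (hsub' (hts h))]
    exact integral_divergence_of_hasCompactSupport h1 hK
  · have hq : ((q : frontier Ω) : EuclideanSpace ℝ (Fin N)) ∈ frontier Ω := (q : frontier Ω).2
    refine integral_divergence_eq_zero_of_tsupport_subset_ball hΩ
      ((hf1 _).continuous.continuousOn.smul hFc) ((hf1 _).contDiffOn.smul hF) (hint _)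
      (hr _ hq) (hc _ hq) (he _ hq) (hρ1 _ hq) (hρd _ hq) (hmem _ hq) (hts.trans hsub) ?_
    intro x hx hxf
    rw [map_smul, hflux x hxf _ (hdef _ hq x hx hxf), smul_zero]

/-- Green's formula for a function `u` with vanishing normal derivative: the field `g ∇u` is
tangential at the boundary, and its divergence is `g Δu + ∇g · ∇u`. -/
theorem IsBoundedC1Domain.integral_mul_laplacian {Ω : Set (EuclideanSpace ℝ (Fin N))}
    (hD : IsBoundedC1Domain Ω) {u g : EuclideanSpace ℝ (Fin N) → ℝ}
    (hu : ContDiffOn ℝ 2 u Ω) (hu' : ContinuousOn (fderivWithin ℝ u (closure Ω)) (closure Ω))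
    (hneu : ∀ p ∈ frontier Ω, ∀ n, IsOuterUnitNormal Ω p n →
      fderivWithin ℝ u (closure Ω) p n = 0)
    (hΔ : IntegrableOn (Laplacian.laplacian u) Ω)
    (hg : ContDiffOn ℝ 1 g Ω) (hgc : ContinuousOn g (closure Ω))
    (hint : IntegrableOn (fun x => ∑ j, fderiv ℝ g x (EuclideanSpace.single j 1)
      * fderiv ℝ u x (EuclideanSpace.single j 1)) Ω) :
    ∫ x in Ω, g x * Laplacian.laplacian u x
      = -∫ x in Ω, ∑ j, fderiv ℝ g x (EuclideanSpace.single j 1)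
          * fderiv ℝ u x (EuclideanSpace.single j 1) := by
  have hΩ := hD.isOpen
  have hcl : IsCompact (closure Ω) := hD.isBounded.isCompact_closure
  -- The gradient of `u`, extended continuously to the boundary.
  set G : EuclideanSpace ℝ (Fin N) → EuclideanSpace ℝ (Fin N) := fun x =>
    (InnerProductSpace.toDual ℝ _).symm (fderivWithin ℝ u (closure Ω) x) with hG
  have hGinner : ∀ x v, inner ℝ (G x) v = fderivWithin ℝ u (closure Ω) x v := fun x v => by
    simp [hG]
  have hfw : ∀ x ∈ Ω, fderivWithin ℝ u (closure Ω) x = fderiv ℝ u x := fun x hx =>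
    fderivWithin_of_mem_nhds (mem_of_superset (hΩ.mem_nhds hx) subset_closure)
  have hGj : ∀ x ∈ Ω, ∀ j, G x j = fderiv ℝ u x (EuclideanSpace.single j 1) := by
    intro x hx j
    rw [← hfw x hx, ← hGinner]
    simp [PiLp.inner_apply]
  have hGc : ContinuousOn G (closure Ω) :=
    (InnerProductSpace.toDual ℝ _).symm.continuous.comp_continuousOn hu'
  have hfd1 : ContDiffOn ℝ 1 (fderiv ℝ u) Ω := hu.fderiv_of_isOpen hΩ (by norm_num)
  have hG1 : ContDiffOn ℝ 1 G Ω := by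
    have h1 : ContDiffOn ℝ 1 (fun x => (InnerProductSpace.toDual ℝ
        (EuclideanSpace ℝ (Fin N))).symm (fderiv ℝ u x)) Ω :=
      ((InnerProductSpace.toDual ℝ (EuclideanSpace ℝ (Fin N))).symm.contDiff).comp_contDiffOn hfd1
    exact h1.congr fun x hx => by simp only [hG, hfw x hx]
  have hGdiv : ∀ x ∈ Ω, divergence G x = Laplacian.laplacian u x := by
    intro x hx
    have hd2 : DifferentiableAt ℝ (fderiv ℝ u) x :=
      (hfd1.differentiableOn one_ne_zero).differentiableAt (hΩ.mem_nhds hx)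
    have hGd : DifferentiableAt ℝ G x :=
      (hG1.differentiableOn one_ne_zero).differentiableAt (hΩ.mem_nhds hx)
    rw [InnerProductSpace.laplacian_eq_iteratedFDeriv_orthonormalBasis u
      (EuclideanSpace.basisFun (Fin N) ℝ), divergence]
    refine Finset.sum_congr rfl fun j _ => ?_
    rw [iteratedFDeriv_two_apply]
    simp only [EuclideanSpace.basisFun_apply, Matrix.cons_val_zero, Matrix.cons_val_one]
    have h1 : HasFDerivAt (fun y => G y j)
        ((EuclideanSpace.proj j : EuclideanSpace ℝ (Fin N) →L[ℝ] ℝ) ∘L fderiv ℝ G x) x :=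
      (EuclideanSpace.proj j : EuclideanSpace ℝ (Fin N) →L[ℝ] ℝ).hasFDerivAt.comp x
        hGd.hasFDerivAt
    have h2 : HasFDerivAt (fun y => fderiv ℝ u y (EuclideanSpace.single j 1))
        ((fderiv ℝ (fderiv ℝ u) x).flip (EuclideanSpace.single j 1)) x := by
      simpa using hd2.hasFDerivAt.clm_apply (hasFDerivAt_const (EuclideanSpace.single j (1 : ℝ)) x)
    have h3 := h1.unique (h2.congr_of_eventuallyEq (by
      filter_upwards [hΩ.mem_nhds hx] with y hy using hGj y hy j))
    have h4 := congrArg (fun A : EuclideanSpace ℝ (Fin N) →L[ℝ] ℝ =>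
      A (EuclideanSpace.single j 1)) h3
    simpa using h4
  have hgd : ∀ x ∈ Ω, DifferentiableAt ℝ g x := fun x hx =>
    (hg.differentiableOn one_ne_zero).differentiableAt (hΩ.mem_nhds hx)
  have hdiv : ∀ x ∈ Ω, divergence (fun y => g y • G y) x = g x * Laplacian.laplacian u x
      + ∑ j, fderiv ℝ g x (EuclideanSpace.single j 1)
          * fderiv ℝ u x (EuclideanSpace.single j 1) := by
    intro x hx
    rw [divergence_smul (hgd x hx)
      ((hG1.differentiableOn one_ne_zero).differentiableAt (hΩ.mem_nhds hx)), hGdiv x hx,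
      ← sum_apply_single_mul]
    simp only [hGj x hx]
  obtain ⟨C, hC⟩ := hcl.exists_bound_of_continuousOn hgc
  have hi1 : IntegrableOn (fun x => g x * Laplacian.laplacian u x) Ω :=
    Integrable.bdd_mul hΔ ((hgc.mono subset_closure).aestronglyMeasurable hΩ.measurableSet)
      ((ae_restrict_mem hΩ.measurableSet).mono fun x hx => hC x (subset_closure hx))
  have h0 : ∫ x in Ω, divergence (fun y => g y • G y) x = 0 := by
    refine hD.integral_divergence_eq_zero (hgc.smul hGc) (hg.smul hG1)
      ((hi1.add hint).congr ((ae_restrict_mem hΩ.measurableSet).mono fun x hx =>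
        (hdiv x hx).symm)) ?_
    intro p hp ρ hρ
    have h1 := hneu p hp _ ⟨ρ, hρ, rfl⟩
    have h2 : fderiv ℝ ρ p (G p) = inner ℝ (gradient ρ p) (G p) := by simp [gradient]
    -- The outer normal is the normalized gradient of `ρ`, so the normal derivative of `u` vanishes
    -- exactly when `∇u` is tangential.
    rw [map_smul, smul_eq_mul, mul_eq_zero, inv_eq_zero, norm_eq_zero] at h1
    rw [map_smul, h2, real_inner_comm, hGinner, h1.resolve_left hρ.gradient_ne_zero, smul_zero]
  rw [setIntegral_congr_fun hΩ.measurableSet hdiv, integral_add hi1 hint] at h0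
  linarith

end Divergence

/-! ### The entropy and the dissipation of the reaction -/

theorem hasDerivAt_entropyFun {s : ℝ} (hs : s ≠ 0) : HasDerivAt entropyFun (Real.log s) s := by
  have h := ((Real.hasDerivAt_mul_log hs).sub (hasDerivAt_id s)).add_const (1 : ℝ)
  rw [add_sub_cancel_right] at h
  exact h

theorem continuous_entropyFun : Continuous entropyFun :=
  (Real.continuous_mul_log.sub continuous_id).add continuous_const

/-- The graph of the entropy lies above its tangents. -/
theorem entropyFun_tangent_le {a b : ℝ} (ha : 0 < a) (hb : 0 < b) :
    entropyFun a + Real.log a * (b - a) ≤ entropyFun b := by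
  have h1 := Real.log_le_sub_one_of_pos (div_pos ha hb)
  rw [Real.log_div ha.ne' hb.ne'] at h1
  have h2 := mul_le_mul_of_nonneg_left h1 hb.le
  have h3 : b * (a / b - 1) = a - b := by field_simp
  rw [h3] at h2
  simp only [entropyFun]
  nlinarith

theorem entropyFun_nonneg {s : ℝ} (hs : 0 ≤ s) : 0 ≤ entropyFun s := by
  rcases hs.eq_or_lt with rfl | h
  · simp [entropyFun]
  · have := entropyFun_tangent_le one_pos h
    simpa [entropyFun] using this

theorem isC1ConvexOn_entropyFun {ε : ℝ} (hε : 0 < ε) (M : ℝ) :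
    IsC1ConvexOn 0 M (fun s => entropyFun (s + ε)) (fun s => Real.log (s + ε)) where
  hasDerivAt s hs :=
    (hasDerivAt_entropyFun (by linarith [hs.1] : s + ε ≠ 0)).comp_add_const s ε
  continuousOn := by
    refine ContinuousOn.log (by fun_prop) fun s hs => ?_
    linarith [hs.1]
  tangent_le a ha b hb := by
    have := entropyFun_tangent_le (a := a + ε) (b := b + ε) (by linarith [ha.1])
      (by linarith [hb.1])
    simpa using this

/-- The logarithm is unbounded only at zero, so the shift by `ε` bounds it on `[0, M]`. -/
theorem abs_log_add_le {c ε M : ℝ} (hc : 0 ≤ c) (hcM : c ≤ M) (hε : 0 < ε) (hε1 : ε ≤ 1) :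
    |Real.log (c + ε)| ≤ |Real.log ε| + |Real.log (M + 1)| := by
  have h1 : Real.log ε ≤ Real.log (c + ε) := Real.log_le_log hε (by linarith)
  have h2 : Real.log (c + ε) ≤ Real.log (M + 1) := Real.log_le_log (by linarith) (by linarith)
  rw [abs_le]
  constructor
  · linarith [neg_abs_le (Real.log ε), abs_nonneg (Real.log (M + 1))]
  · linarith [le_abs_self (Real.log (M + 1)), abs_nonneg (Real.log ε)]

theorem abs_pow_mul_pow_add_sub_le {x y ε M : ℝ} (hx : 0 ≤ x) (hxM : x ≤ M) (hy : 0 ≤ y)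
    (hyM : y ≤ M) (hε : 0 < ε) (hε1 : ε ≤ 1) (a b : ℕ) :
    |(x + ε) ^ a * (y + ε) ^ b - x ^ a * y ^ b|
      ≤ ε * (a * (M + 1) ^ (a - 1) * (M + 1) ^ b + (M + 1) ^ a * (b * (M + 1) ^ (b - 1))) := by
  have hpow : ∀ {z : ℝ}, 0 ≤ z → z ≤ M → ∀ n : ℕ,
      |(z + ε) ^ n - z ^ n| ≤ ε * n * (M + 1) ^ (n - 1) := by
    intro z hz hzM n
    refine (abs_pow_sub_pow_le (z + ε) z n).trans ?_
    rw [add_sub_cancel_left, abs_of_pos hε]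
    gcongr
    rw [abs_of_nonneg (by linarith), abs_of_nonneg hz]
    exact max_le (by linarith) (by linarith)
  have e : (x + ε) ^ a * (y + ε) ^ b - x ^ a * y ^ b
      = ((x + ε) ^ a - x ^ a) * (y + ε) ^ b + x ^ a * ((y + ε) ^ b - y ^ b) := by ring
  have hM : 0 ≤ M := hx.trans hxM
  rw [e]
  refine (abs_add_le _ _).trans ?_
  rw [abs_mul, abs_mul, abs_of_nonneg (pow_nonneg hx a),
    abs_of_nonneg (pow_nonneg (by linarith : 0 ≤ y + ε) b)]
  calc |(x + ε) ^ a - x ^ a| * (y + ε) ^ b + x ^ a * |(y + ε) ^ b - y ^ b|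
      ≤ (ε * a * (M + 1) ^ (a - 1)) * (M + 1) ^ b
        + (M + 1) ^ a * (ε * b * (M + 1) ^ (b - 1)) := by
        gcongr
        · exact hpow hx hxM a
        · linarith
        · exact hpow hy hyM b
    _ = _ := by ring

/-- Entropy dissipation of the reaction term, up to an error that vanishes with the shift `ε` of
the logarithm. Without the shift the left-hand side is `(B - A) (log A - log B) ≤ 0` up to the rate
constant, where `A` and `B` are the two monomials of the mass action law. -/
theorem exists_reaction_dissipation_bound {ν : ℝ} (hν : 0 < ν) (a : Fin 4 → ℕ) {M : ℝ}
    (hM : 0 ≤ M) :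
    ∃ E : ℝ → ℝ, Tendsto E (𝓝[>] 0) (𝓝 0) ∧ ∀ ε, 0 < ε → ε ≤ 1 → 0 ≤ E ε ∧
      ∀ c : Fin 4 → ℝ, (∀ i, c i ∈ Set.Icc 0 M) →
        ∑ i, Real.log (c i + ε) * (reactionSign i * a i * reactionRate ν ν a c) ≤ E ε := by
  set L : ℕ → ℕ → ℝ := fun m n =>
    m * (M + 1) ^ (m - 1) * (M + 1) ^ n + (M + 1) ^ m * (n * (M + 1) ^ (n - 1)) with hL
  have hL0 : ∀ m n, 0 ≤ L m n := fun m n => by positivity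
  set S : ℝ := ∑ i, (a i : ℝ) with hS
  have hS0 : 0 ≤ S := by positivity
  set E : ℝ → ℝ := fun ε => ν * (L (a 0) (a 1) + L (a 2) (a 3)) * S
    * (|ε * Real.log ε| + |ε| * |Real.log (M + 1)|) with hE
  refine ⟨E, ?_, fun ε hε hε1 => ⟨?_, fun c hc => ?_⟩⟩
  · have hcont : Continuous E := by
      have := Real.continuous_mul_log
      simp only [hE]; fun_prop
    have := hcont.tendsto 0
    simp only [hE, zero_mul, abs_zero, add_zero, mul_zero] at this
    exact this.mono_left nhdsWithin_le_nhds
  · have := hL0 (a 0) (a 1)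
    have := hL0 (a 2) (a 3)
    simp only [hE]; positivity
  set A := c 0 ^ a 0 * c 1 ^ a 1
  set B := c 2 ^ a 2 * c 3 ^ a 3
  set A' := (c 0 + ε) ^ a 0 * (c 1 + ε) ^ a 1
  set B' := (c 2 + ε) ^ a 2 * (c 3 + ε) ^ a 3
  have hpos : ∀ i, 0 < c i + ε := fun i => by linarith [(hc i).1]
  have hA' : 0 < A' := mul_pos (pow_pos (hpos 0) _) (pow_pos (hpos 1) _)
  have hB' : 0 < B' := mul_pos (pow_pos (hpos 2) _) (pow_pos (hpos 3) _)
  have hlogA : Real.log A' = a 0 * Real.log (c 0 + ε) + a 1 * Real.log (c 1 + ε) := by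
    rw [Real.log_mul (pow_pos (hpos 0) _).ne' (pow_pos (hpos 1) _).ne', Real.log_pow, Real.log_pow]
  have hlogB : Real.log B' = a 2 * Real.log (c 2 + ε) + a 3 * Real.log (c 3 + ε) := by
    rw [Real.log_mul (pow_pos (hpos 2) _).ne' (pow_pos (hpos 3) _).ne', Real.log_pow, Real.log_pow]
  -- The monomials of the rate are not shifted; replacing them by shifted ones costs `O(ε)`, against
  -- a factor `O(|log ε|)`.
  have e1 : ∑ i, Real.log (c i + ε) * (reactionSign i * a i * reactionRate ν ν a c)
      = ν * (B' - A') * (Real.log A' - Real.log B')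
        + ν * ((A' - A) - (B' - B)) * (Real.log A' - Real.log B') := by
    rw [hlogA, hlogB]
    simp only [Fin.sum_univ_four, reactionSign, reactionRate, Matrix.cons_val]
    ring
  have h1 : (B' - A') * (Real.log A' - Real.log B') ≤ 0 := by
    rcases le_total A' B' with h | h
    · have := Real.log_le_log hA' h
      nlinarith
    · have := Real.log_le_log hB' h
      nlinarith
  have hlog : |Real.log A' - Real.log B'| ≤ S * (|Real.log ε| + |Real.log (M + 1)|) := by
    set Y := |Real.log ε| + |Real.log (M + 1)| with hY
    have hb : ∀ i, |a i * Real.log (c i + ε)| ≤ a i * Y := fun i => by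
      rw [abs_mul, Nat.abs_cast]
      gcongr
      exact abs_log_add_le (hc i).1 (hc i).2 hε hε1
    rw [hlogA, hlogB, hS, Fin.sum_univ_four]
    have b0 := abs_le.1 (hb 0)
    have b1 := abs_le.1 (hb 1)
    have b2 := abs_le.1 (hb 2)
    have b3 := abs_le.1 (hb 3)
    rw [abs_le]
    constructor <;> nlinarith
  have hAA : |A' - A| ≤ ε * L (a 0) (a 1) :=
    abs_pow_mul_pow_add_sub_le (hc 0).1 (hc 0).2 (hc 1).1 (hc 1).2 hε hε1 _ _
  have hBB : |B' - B| ≤ ε * L (a 2) (a 3) :=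
    abs_pow_mul_pow_add_sub_le (hc 2).1 (hc 2).2 (hc 3).1 (hc 3).2 hε hε1 _ _
  have h2 : ((A' - A) - (B' - B)) * (Real.log A' - Real.log B')
      ≤ ε * (L (a 0) (a 1) + L (a 2) (a 3)) * (S * (|Real.log ε| + |Real.log (M + 1)|)) := by
    refine (le_abs_self _).trans ?_
    rw [abs_mul]
    refine mul_le_mul ((abs_sub _ _).trans (by rw [mul_add]; exact add_le_add hAA hBB)) hlog
      (abs_nonneg _) ?_
    have := hL0 (a 0) (a 1)
    have := hL0 (a 2) (a 3)
    positivity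
  have e2 : E ε = ν * (ε * (L (a 0) (a 1) + L (a 2) (a 3))
      * (S * (|Real.log ε| + |Real.log (M + 1)|))) := by
    simp only [hE]
    rw [abs_mul, abs_of_pos hε]; ring
  rw [e1, e2]
  nlinarith

/-! ### Truncation of the kernels to a bounded time interval -/

theorem lineConv_indicator {k v : ℝ → ℝ} {T t : ℝ} (ht : t ∈ Set.Ioo 0 T) :
    lineConv ((Set.Ioo 0 T).indicator k) ((Set.Ioo 0 T).indicator v) t = timeConv k v t := by
  have h0 : ∀ w : ℝ → ℝ, ∀ s, s ≤ 0 → (Set.Ioo 0 T).indicator w s = 0 := fun w s hs =>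
    Set.indicator_of_notMem (fun h => by linarith [h.1]) _
  rw [lineConv_eq_setIntegral t (h0 k) (h0 v), timeConv,
    intervalIntegral.integral_of_le ht.1.le, integral_Ioc_eq_integral_Ioo]
  refine setIntegral_congr_fun measurableSet_Ioo fun τ hτ => ?_
  have h1 : t - τ ∈ Set.Ioo 0 T := ⟨by linarith [hτ.2], by linarith [hτ.1, ht.2]⟩
  have h2 : τ ∈ Set.Ioo 0 T := ⟨hτ.1, hτ.2.trans ht.2⟩
  simp only [Set.indicator_of_mem h1, Set.indicator_of_mem h2]

theorem MeasureTheory.LocallyIntegrableOn.integrableOn_Ioo_zero {k : ℝ → ℝ}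
    (hk : LocallyIntegrableOn k (Set.Ici 0)) (T : ℝ) : IntegrableOn k (Set.Ioo 0 T) :=
  (hk.integrableOn_compact_subset (Set.Icc_subset_Ici_self : Set.Icc 0 T ⊆ _) isCompact_Icc).mono_set
    Set.Ioo_subset_Icc_self

theorem IsPCPair.isConjugatePair {k l : ℝ → ℝ} (h : IsPCPair k l) (T : ℝ) :
    IsConjugatePair T ((Set.Ioo 0 T).indicator k) ((Set.Ioo 0 T).indicator l) where
  integrable_left := (integrable_indicator_iff measurableSet_Ioo).2
    (h.locallyIntegrable_left.integrableOn_Ioo_zero T)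
  integrable_right := (integrable_indicator_iff measurableSet_Ioo).2
    (h.locallyIntegrable_right.integrableOn_Ioo_zero T)
  left_causal s hs := Set.indicator_of_notMem (fun h => by linarith [h.1]) _
  right_causal s hs := Set.indicator_of_notMem (fun h => by linarith [h.1]) _
  nonneg s := Set.indicator_nonneg (fun t ht => h.nonneg t ht.1) s
  antitone := by
    intro s hs t ht hst
    by_cases h' : t ∈ Set.Ioo 0 T
    · rw [Set.indicator_of_mem h', Set.indicator_of_mem (show s ∈ Set.Ioo 0 T from
        ⟨hs, hst.trans_lt h'.2⟩)]
      exact h.antitone hs ht hst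
    · rw [Set.indicator_of_notMem h']
      exact Set.indicator_nonneg (fun t ht => h.nonneg t ht.1) s
  conv_eq_one := by
    filter_upwards [(ae_restrict_iff' measurableSet_Ioi).1 h.conv_eq_one] with t h1 ht
    rw [lineConv_indicator ht, h1 ht.1]

/-- The pointwise equation `(k * w)' = f` in integrated form; `k * w` vanishes at time zero because
`w` is bounded. -/
theorem timeConv_eq_integral {k w f : ℝ → ℝ} {T B : ℝ} (hk : IntegrableOn k (Set.Ioo 0 T))
    (hw : ∀ t ∈ Set.Ioo 0 T, |w t| ≤ B) (hf : IntegrableOn f (Set.Ioo 0 T))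
    (hder : ∀ t ∈ Set.Ioo 0 T, HasDerivAt (timeConv k w) (f t) t) {t : ℝ}
    (ht : t ∈ Set.Ioo 0 T) : timeConv k w t = ∫ τ in (0 : ℝ)..t, f τ := by
  set K := (Set.Ioo 0 T).indicator k with hK
  have hKi : Integrable K := (integrable_indicator_iff measurableSet_Ioo).2 hk
  have hbound : ∀ s ∈ Set.Ioo 0 T, |timeConv k w s| ≤ B * ∫ τ in (0 : ℝ)..s, ‖K τ‖ := by
    intro s hs
    have e : ∫ τ in (0 : ℝ)..s, ‖K τ‖ = ∫ τ in (0 : ℝ)..s, ‖K (s - τ)‖ := by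
      rw [intervalIntegral.integral_comp_sub_left (fun τ => ‖K τ‖) s]; simp
    rw [e, ← intervalIntegral.integral_const_mul, timeConv, ← Real.norm_eq_abs,
      intervalIntegral.integral_of_le hs.1.le, intervalIntegral.integral_of_le hs.1.le,
      integral_Ioc_eq_integral_Ioo, integral_Ioc_eq_integral_Ioo]
    refine (norm_integral_le_integral_norm _).trans ?_
    refine integral_mono_of_nonneg (Eventually.of_forall fun _ => norm_nonneg _)
      (((hKi.comp_sub_left s).norm.const_mul B).integrableOn) ?_
    filter_upwards [ae_restrict_mem measurableSet_Ioo] with τ hτ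
    have h1 : s - τ ∈ Set.Ioo 0 T := ⟨by linarith [hτ.2], by linarith [hτ.1, hs.2]⟩
    rw [norm_mul, hK, Set.indicator_of_mem h1, mul_comm]
    exact mul_le_mul_of_nonneg_right (hw τ ⟨hτ.1, hτ.2.trans hs.2⟩) (norm_nonneg _)
  have h0 : Tendsto (timeConv k w) (𝓝[>] 0) (𝓝 0) := by
    have hc : Continuous fun s => B * ∫ τ in (0 : ℝ)..s, ‖K τ‖ :=
      continuous_const.mul (intervalIntegral.continuous_primitive
        (fun _ _ => hKi.norm.intervalIntegrable) 0)
    have h1 : Tendsto (fun s => B * ∫ τ in (0 : ℝ)..s, ‖K τ‖) (𝓝[>] 0) (𝓝 0) := by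
      have := hc.tendsto 0
      simp only [intervalIntegral.integral_same, mul_zero] at this
      exact this.mono_left nhdsWithin_le_nhds
    refine squeeze_zero_norm' ?_ h1
    filter_upwards [Ioo_mem_nhdsGT (ht.1.trans ht.2)] with s hs using hbound s hs
  have h2 := intervalIntegral.integral_eq_sub_of_hasDerivAt_of_tendsto ht.1
    (fun s hs => hder s ⟨hs.1, hs.2.trans ht.2⟩)
    ((intervalIntegrable_iff_integrableOn_Ioo_of_le ht.1.le).2
      (hf.mono_set (Set.Ioo_subset_Ioo_right ht.2.le))) h0
    ((hder t ht).continuousAt.tendsto.mono_left nhdsWithin_le_nhds)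
  rw [h2, sub_zero]

/-! ### Green's formula for entropies at two different times -/

section Green

variable {N : ℕ} {ι : Type*} [Fintype ι]

/-- The weighted shifted entropy `∑ᵢ dᵢ φ(vᵢ + ε)` of a vector of concentrations. -/
noncomputable def weightedEntropy (d : ι → ℝ) (ε : ℝ) (v : ι → EuclideanSpace ℝ (Fin N) → ℝ)
    (x : EuclideanSpace ℝ (Fin N)) : ℝ :=
  ∑ i, d i * entropyFun (v i x + ε)

/-- The `k`-th partial derivative of `weightedEntropy`, extended continuously to the closure of
`Ω`. -/
noncomputable def weightedEntropyPartial (Ω : Set (EuclideanSpace ℝ (Fin N))) (d : ι → ℝ) (ε : ℝ)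
    (v : ι → EuclideanSpace ℝ (Fin N) → ℝ) (k : Fin N) (x : EuclideanSpace ℝ (Fin N)) : ℝ :=
  ∑ i, d i * (Real.log (v i x + ε)
    * fderivWithin ℝ (v i) (closure Ω) x (EuclideanSpace.single k 1))

theorem fderiv_weightedEntropy {Ω : Set (EuclideanSpace ℝ (Fin N))} (hΩ : IsOpen Ω) {d : ι → ℝ}
    {ε : ℝ} (hε : 0 < ε) {v : ι → EuclideanSpace ℝ (Fin N) → ℝ}
    (hv : ∀ i, ContDiffOn ℝ 1 (v i) Ω) (hv0 : ∀ i, ∀ x ∈ Ω, 0 ≤ v i x)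
    {x : EuclideanSpace ℝ (Fin N)} (hx : x ∈ Ω) (k : Fin N) :
    fderiv ℝ (weightedEntropy d ε v) x (EuclideanSpace.single k 1)
      = weightedEntropyPartial Ω d ε v k x := by
  have h1 : HasFDerivAt (weightedEntropy d ε v)
      (∑ i, d i • Real.log (v i x + ε) • fderiv ℝ (v i) x) x := by
    refine HasFDerivAt.fun_sum fun i _ => HasFDerivAt.const_mul ?_ (d i)
    have hvd : HasFDerivAt (v i) (fderiv ℝ (v i) x) x :=
      (((hv i).differentiableOn one_ne_zero).differentiableAt (hΩ.mem_nhds hx)).hasFDerivAt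
    exact (hasDerivAt_entropyFun (by linarith [hv0 i x hx])).comp_hasFDerivAt x (hvd.add_const ε)
  have h2 : ∀ i, fderivWithin ℝ (v i) (closure Ω) x = fderiv ℝ (v i) x := fun i =>
    fderivWithin_of_mem_nhds (mem_of_superset (hΩ.mem_nhds hx) subset_closure)
  rw [h1.fderiv]
  simp [weightedEntropyPartial, _root_.sum_apply, h2]

/-- Green's formula tested with entropy variables: the diffusion terms are bounded by the product of
the gradients of the weighted entropies of `v` and `u`, which are the concentrations at two
different times. Since `∇ log u = ∇u / u`, the remaining term is `-∫ w ∑ᵢ dᵢ |∇uᵢ|² / (uᵢ + ε)`,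
where `w` is the weighted entropy of `v`; it is nonpositive because `w ≥ 0`. -/
theorem IsBoundedC1Domain.integral_weightedEntropy_mul_laplacian_le
    {Ω : Set (EuclideanSpace ℝ (Fin N))} (hD : IsBoundedC1Domain Ω) {d : ι → ℝ}
    (hd : ∀ i, 0 ≤ d i) {ε : ℝ} (hε : 0 < ε) {u v : ι → EuclideanSpace ℝ (Fin N) → ℝ}
    (hv : ∀ i, ContDiffOn ℝ 1 (v i) Ω) (hvc : ∀ i, ContinuousOn (v i) (closure Ω))
    (hv' : ∀ i, ContinuousOn (fderivWithin ℝ (v i) (closure Ω)) (closure Ω))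
    (hv0 : ∀ i, ∀ x ∈ closure Ω, 0 ≤ v i x)
    (hu : ∀ i, ContDiffOn ℝ 2 (u i) Ω) (huc : ∀ i, ContinuousOn (u i) (closure Ω))
    (hu' : ∀ i, ContinuousOn (fderivWithin ℝ (u i) (closure Ω)) (closure Ω))
    (hu0 : ∀ i, ∀ x ∈ closure Ω, 0 ≤ u i x)
    (hneu : ∀ i, ∀ p ∈ frontier Ω, ∀ n, IsOuterUnitNormal Ω p n →
      fderivWithin ℝ (u i) (closure Ω) p n = 0)
    (hΔ : ∀ i, IntegrableOn (Laplacian.laplacian (u i)) Ω) :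
    ∫ x in Ω, weightedEntropy d ε v x
        * ∑ i, Real.log (u i x + ε) * (d i * Laplacian.laplacian (u i) x)
      ≤ -∫ x in Ω, ∑ k, weightedEntropyPartial Ω d ε v k x
          * weightedEntropyPartial Ω d ε u k x := by
  have hΩ := hD.isOpen
  have hcl : IsCompact (closure Ω) := hD.isBounded.isCompact_closure
  set w := weightedEntropy d ε v with hw
  set W := weightedEntropyPartial Ω d ε v with hW
  set U : ι → Fin N → EuclideanSpace ℝ (Fin N) → ℝ := fun i k x =>
    fderivWithin ℝ (u i) (closure Ω) x (EuclideanSpace.single k 1) with hU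
  have hfw : ∀ f : EuclideanSpace ℝ (Fin N) → ℝ, ∀ x ∈ Ω,
      fderivWithin ℝ f (closure Ω) x = fderiv ℝ f x := fun f x hx =>
    fderivWithin_of_mem_nhds (mem_of_superset (hΩ.mem_nhds hx) subset_closure)
  have hlogc : ∀ f : EuclideanSpace ℝ (Fin N) → ℝ, ContinuousOn f (closure Ω) →
      (∀ x ∈ closure Ω, 0 ≤ f x) → ContinuousOn (fun x => Real.log (f x + ε)) (closure Ω) :=
    fun f hf hf0 => (hf.add continuousOn_const).log fun x hx =>
      (add_pos_of_nonneg_of_pos (hf0 x hx) hε).ne'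
  have hwc : ContinuousOn w (closure Ω) := by
    simp only [hw]
    unfold weightedEntropy
    exact continuousOn_finsetSum _ fun i _ => continuousOn_const.mul
      (continuous_entropyFun.comp_continuousOn ((hvc i).add continuousOn_const))
  have hWc : ∀ k, ContinuousOn (W k) (closure Ω) := fun k => by
    simp only [hW]
    unfold weightedEntropyPartial
    exact continuousOn_finsetSum _ fun i _ => continuousOn_const.mul
      ((hlogc _ (hvc i) (hv0 i)).mul ((hv' i).clm_apply continuousOn_const))
  have hUc : ∀ i k, ContinuousOn (U i k) (closure Ω) := fun i k =>
    (hu' i).clm_apply continuousOn_const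
  have hwpos : ∀ x ∈ Ω, 0 ≤ w x := fun x hx => Finset.sum_nonneg fun i _ =>
    mul_nonneg (hd i) (entropyFun_nonneg (by linarith [hv0 i x (subset_closure hx)]))
  have hw1 : ContDiffOn ℝ 1 w Ω := by
    have h1 : ∀ s : ℝ, 0 < s → ContDiffAt ℝ 1 entropyFun s := fun s hs =>
      ((contDiffAt_id.mul (Real.contDiffAt_log.2 hs.ne')).sub contDiffAt_id).add contDiffAt_const
    simp only [hw]
    unfold weightedEntropy
    refine ContDiffOn.sum fun i _ => contDiffOn_const.mul fun x hx => ?_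
    exact (h1 _ (by linarith [hv0 i x (subset_closure hx)])).comp_contDiffWithinAt x
      ((hv i x hx).add contDiffWithinAt_const)
  -- `∇(w log(uᵢ + ε)) · ∇uᵢ`, extended to the boundary.
  set Q : ι → EuclideanSpace ℝ (Fin N) → ℝ := fun i x =>
    ∑ k, (Real.log (u i x + ε) * W k x + w x * (u i x + ε)⁻¹ * U i k x) * U i k x with hQ
  have hQc : ∀ i, ContinuousOn (Q i) (closure Ω) := fun i =>
    continuousOn_finsetSum _ fun k _ =>
      (((hlogc _ (huc i) (hu0 i)).mul (hWc k)).add ((hwc.mul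
        (((huc i).add continuousOn_const).inv₀ fun x hx =>
          (add_pos_of_nonneg_of_pos (hu0 i x hx) hε).ne')).mul (hUc i k))).mul (hUc i k)
  have hint : ∀ f : EuclideanSpace ℝ (Fin N) → ℝ, ContinuousOn f (closure Ω) →
      IntegrableOn f Ω := fun f hf => (hf.integrableOn_compact hcl).mono_set subset_closure
  have hpart : ∀ i, ∀ x ∈ Ω, ∑ k,
      fderiv ℝ (fun y => w y * Real.log (u i y + ε)) x (EuclideanSpace.single k 1)
        * fderiv ℝ (u i) x (EuclideanSpace.single k 1) = Q i x := by
    intro i x hx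
    have hux : u i x + ε ≠ 0 := by linarith [hu0 i x (subset_closure hx)]
    have hud : HasFDerivAt (u i) (fderiv ℝ (u i) x) x :=
      (((hu i).differentiableOn two_ne_zero).differentiableAt (hΩ.mem_nhds hx)).hasFDerivAt
    have hwd : HasFDerivAt w (fderiv ℝ w x) x :=
      ((hw1.differentiableOn one_ne_zero).differentiableAt (hΩ.mem_nhds hx)).hasFDerivAt
    have h1 := hwd.fun_mul ((hud.add_const ε).log hux)
    refine Finset.sum_congr rfl fun k _ => ?_
    rw [h1.fderiv]
    have h2 : fderiv ℝ w x (EuclideanSpace.single k 1) = W k x :=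
      fderiv_weightedEntropy hΩ hε hv (fun i x hx => hv0 i x (subset_closure hx)) hx k
    simp only [_root_.add_apply, _root_.smul_apply, h2, smul_eq_mul, hU, hfw _ x hx]
    ring
  have hgreen : ∀ i, ∫ x in Ω, (w x * Real.log (u i x + ε)) * Laplacian.laplacian (u i) x
      = -∫ x in Ω, Q i x := by
    intro i
    have hg1 : ContDiffOn ℝ 1 (fun x => w x * Real.log (u i x + ε)) Ω :=
      hw1.mul ((((hu i).of_le one_le_two).add contDiffOn_const).log fun x hx => by
        linarith [hu0 i x (subset_closure hx)])
    rw [hD.integral_mul_laplacian (hu i) (hu' i) (hneu i) (hΔ i) hg1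
      (hwc.mul (hlogc _ (huc i) (hu0 i)))
      ((hint _ (hQc i)).congr ((ae_restrict_mem hΩ.measurableSet).mono fun x hx =>
        (hpart i x hx).symm)), setIntegral_congr_fun hΩ.measurableSet (hpart i)]
  have hi : ∀ i, IntegrableOn
      (fun x => (w x * Real.log (u i x + ε)) * Laplacian.laplacian (u i) x) Ω := by
    intro i
    have hgc := hwc.mul (hlogc _ (huc i) (hu0 i))
    obtain ⟨C, hC⟩ := hcl.exists_bound_of_continuousOn hgc
    exact Integrable.bdd_mul (hΔ i)
      ((hgc.mono subset_closure).aestronglyMeasurable hΩ.measurableSet)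
      ((ae_restrict_mem hΩ.measurableSet).mono fun x hx => hC x (subset_closure hx))
  have e1 : ∫ x in Ω, w x * ∑ i, Real.log (u i x + ε) * (d i * Laplacian.laplacian (u i) x)
      = -∫ x in Ω, ∑ i, d i * Q i x := by
    rw [integral_finsetSum _ fun i _ => ((hint _ (hQc i)).const_mul (d i)), ← Finset.sum_neg_distrib]
    simp only [integral_const_mul, ← mul_neg, ← hgreen]
    simp only [← integral_const_mul]
    rw [← integral_finsetSum _ fun i _ => ((hi i).const_mul (d i))]
    congr 1; ext x
    rw [Finset.mul_sum]
    exact Finset.sum_congr rfl fun i _ => by ring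
  rw [e1]
  refine neg_le_neg (setIntegral_mono_on ?_ ?_ hΩ.measurableSet ?_)
  · refine hint _ (continuousOn_finsetSum _ fun k _ => (hWc k).mul ?_)
    unfold weightedEntropyPartial
    exact continuousOn_finsetSum _ fun i _ => continuousOn_const.mul
      ((hlogc _ (huc i) (hu0 i)).mul (hUc i k))
  · exact hint _ (continuousOn_finsetSum _ fun i _ => continuousOn_const.mul (hQc i))
  · intro x hx
    have e2 : ∑ i, d i * Q i x = ∑ k, W k x * weightedEntropyPartial Ω d ε u k x
        + ∑ i, ∑ k, d i * (w x * (u i x + ε)⁻¹ * U i k x ^ 2) := by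
      simp only [hQ, weightedEntropyPartial, Finset.mul_sum]
      rw [Finset.sum_comm (s := (Finset.univ : Finset (Fin N))), ← Finset.sum_add_distrib]
      refine Finset.sum_congr rfl fun i _ => ?_
      rw [← Finset.sum_add_distrib]
      exact Finset.sum_congr rfl fun k _ => by ring
    rw [e2]
    refine le_add_of_nonneg_right (Finset.sum_nonneg fun i _ => Finset.sum_nonneg fun k _ => ?_)
    have h1 : 0 ≤ (u i x + ε)⁻¹ := inv_nonneg.2 (by linarith [hu0 i x (subset_closure hx)])
    exact mul_nonneg (hd i) (mul_nonneg (mul_nonneg (hwpos x hx) h1) (sq_nonneg _))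

end Green

/-! ### Convolution in time of functions on space-time -/

section SpaceTimeConvolution

variable {X : Type*} [MeasurableSpace X] {μ : Measure X} [IsFiniteMeasure μ]

/-- The change of variables `((t, τ), x) ↦ (t - τ, (τ, x))` preserves the measure. -/
theorem measurePreserving_sub_prodAssoc (μ : Measure X) [SFinite μ] :
    MeasurePreserving (fun q : (ℝ × ℝ) × X => (q.1.1 - q.1.2, (q.1.2, q.2)))
      (((volume : Measure ℝ).prod (volume : Measure ℝ)).prod μ)
      ((volume : Measure ℝ).prod ((volume : Measure ℝ).prod μ)) :=
  (measurePreserving_prodAssoc volume volume μ).comp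
    ((measurePreserving_sub_prod (volume : Measure ℝ) (volume : Measure ℝ)).prod
      (MeasurePreserving.id μ))

theorem integrable_sub_mul {ℓ : ℝ → ℝ} (hℓ : Integrable ℓ) {H : ℝ × X → ℝ}
    (hH : Integrable H (volume.prod μ)) :
    Integrable (fun q : (ℝ × ℝ) × X => ℓ (q.1.1 - q.1.2) * H (q.1.2, q.2))
      (((volume : Measure ℝ).prod (volume : Measure ℝ)).prod μ) :=
  (measurePreserving_sub_prodAssoc μ).integrable_comp_of_integrable (hℓ.mul_prod hH)

theorem integrable_sub_mul' {ℓ : ℝ → ℝ} (hℓ : Integrable ℓ) {H : ℝ × X → ℝ}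
    (hH : Integrable H (volume.prod μ)) :
    Integrable (fun q : (ℝ × ℝ) × X => ℓ (q.1.1 - q.1.2) * H (q.1.1, q.2))
      (((volume : Measure ℝ).prod (volume : Measure ℝ)).prod μ) := by
  have h := (integrable_sub_mul (μ := μ) hℓ.comp_neg hH)
  have h2 : MeasurePreserving (fun q : (ℝ × ℝ) × X => (q.1.swap, q.2))
      (((volume : Measure ℝ).prod (volume : Measure ℝ)).prod μ)
      (((volume : Measure ℝ).prod (volume : Measure ℝ)).prod μ) :=
    Measure.measurePreserving_swap.prod (MeasurePreserving.id μ)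
  have h3 := h2.integrable_comp_of_integrable h
  refine h3.congr (ae_of_all _ fun q => ?_)
  simp

theorem aestronglyMeasurable_comp_fst_left {W : ℝ × X → ℝ}
    (hW : AEStronglyMeasurable W (volume.prod μ)) :
    AEStronglyMeasurable (fun q : (ℝ × ℝ) × X => W (q.1.1, q.2))
      (((volume : Measure ℝ).prod (volume : Measure ℝ)).prod μ) :=
  hW.comp_quasiMeasurePreserving
    (QuasiMeasurePreserving.prodMap Measure.quasiMeasurePreserving_fst
      (Measure.QuasiMeasurePreserving.id μ))

theorem aestronglyMeasurable_comp_snd_left {W : ℝ × X → ℝ}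
    (hW : AEStronglyMeasurable W (volume.prod μ)) :
    AEStronglyMeasurable (fun q : (ℝ × ℝ) × X => W (q.1.2, q.2))
      (((volume : Measure ℝ).prod (volume : Measure ℝ)).prod μ) :=
  hW.comp_quasiMeasurePreserving
    (QuasiMeasurePreserving.prodMap Measure.quasiMeasurePreserving_snd
      (Measure.QuasiMeasurePreserving.id μ))

theorem aestronglyMeasurable_sub_left {ℓ : ℝ → ℝ} (hℓ : Integrable ℓ) :
    AEStronglyMeasurable (fun q : (ℝ × ℝ) × X => ℓ (q.1.1 - q.1.2))
      (((volume : Measure ℝ).prod (volume : Measure ℝ)).prod μ) :=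
  (hℓ.aestronglyMeasurable.comp_quasiMeasurePreserving
    (Measure.quasiMeasurePreserving_fst (μ := (volume : Measure ℝ))
      (ν := (volume : Measure ℝ).prod μ))).comp_measurePreserving
    (measurePreserving_sub_prodAssoc μ)

theorem integrable_sub_mul_bdd_mul {ℓ : ℝ → ℝ} (hℓ : Integrable ℓ) {W H : ℝ × X → ℝ} {C : ℝ}
    (hW : AEStronglyMeasurable W (volume.prod μ)) (hWC : ∀ᵐ x ∂μ, ∀ t, |W (t, x)| ≤ C)
    (hH : Integrable H (volume.prod μ)) :
    Integrable (fun q : (ℝ × ℝ) × X => ℓ (q.1.1 - q.1.2) * (W (q.1.1, q.2) * H (q.1.2, q.2)))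
      (((volume : Measure ℝ).prod (volume : Measure ℝ)).prod μ) := by
  refine ((integrable_sub_mul hℓ hH).bdd_mul (c := C) (aestronglyMeasurable_comp_fst_left hW)
    ?_).congr (ae_of_all _ fun q => ?_)
  · filter_upwards [Measure.quasiMeasurePreserving_snd.ae hWC] with q hq using hq _
  · ring

/-- For square integrable `P`, the quadratic form density of a convolution kernel is integrable, by
`2 |P(t) P(τ)| ≤ P(t)² + P(τ)²`. -/
theorem integrable_sub_mul_of_sq {ℓ : ℝ → ℝ} (hℓ : Integrable ℓ) {P : ℝ × X → ℝ}
    (hP : AEStronglyMeasurable P (volume.prod μ))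
    (hP2 : Integrable (fun p => P p ^ 2) (volume.prod μ)) :
    Integrable (fun q : (ℝ × ℝ) × X => ℓ (q.1.1 - q.1.2) * (P (q.1.1, q.2) * P (q.1.2, q.2)))
      (((volume : Measure ℝ).prod (volume : Measure ℝ)).prod μ) := by
  refine ((integrable_sub_mul hℓ hP2).norm.add (integrable_sub_mul' hℓ hP2).norm).mono'
    ((aestronglyMeasurable_sub_left hℓ).mul ((aestronglyMeasurable_comp_fst_left hP).mul
      (aestronglyMeasurable_comp_snd_left hP))) (ae_of_all _ fun q => ?_)
  simp only [Pi.add_apply, norm_mul, Real.norm_eq_abs, abs_pow, ← mul_add]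
  refine mul_le_mul_of_nonneg_left ?_ (abs_nonneg _)
  nlinarith [sq_nonneg (|P (q.1.1, q.2)| - |P (q.1.2, q.2)|), sq_nonneg (|P (q.1.1, q.2)|),
    sq_nonneg (|P (q.1.2, q.2)|)]

/-- If `D ≤ ℓ * H` in time for almost every `x`, if `W ≥ 0`, and if for fixed times `t, τ` the
pairing of `W(t)` with `H(τ)` is at most `-∑ₖ ⟨Pₖ(t), Pₖ(τ)⟩ + K`, then the positivity of the
quadratic form of `ℓ` removes the `Pₖ`: the pairing of `W` with `D` is at most a multiple of `K`
that depends on `ℓ` and `T` only. -/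
theorem IsConjugatePair.integral_mul_le {T : ℝ} {κ ℓ : ℝ → ℝ} (hℓ : IsConjugatePair T κ ℓ)
    {ι : Type*} [Fintype ι] {W H D : ℝ × X → ℝ} {P : ι → ℝ × X → ℝ} {C K : ℝ}
    (hW : AEStronglyMeasurable W (volume.prod μ)) (hWC : ∀ᵐ x ∂μ, ∀ t, |W (t, x)| ≤ C)
    (hW0 : ∀ᵐ x ∂μ, ∀ t, 0 ≤ W (t, x))
    (hWT : ∀ t ∉ Set.Ioo 0 T, ∀ x, W (t, x) = 0)
    (hH : Integrable H (volume.prod μ)) (hHT : ∀ t ∉ Set.Ioo 0 T, ∀ x, H (t, x) = 0)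
    (hP : ∀ i, AEStronglyMeasurable (P i) (volume.prod μ))
    (hP2 : ∀ i, Integrable (fun p => P i p ^ 2) (volume.prod μ))
    (hPT : ∀ i, ∀ t ∉ Set.Ioo 0 T, ∀ x, P i (t, x) = 0)
    (hWH : ∀ᵐ τ : ℝ, τ ∈ Set.Ioo 0 T → ∀ t ∈ Set.Ioo 0 T,
      ∫ x, W (t, x) * H (τ, x) ∂μ ≤ -∫ x, ∑ i, P i (t, x) * P i (τ, x) ∂μ + K)
    (hWD : Integrable (fun p => W p * D p) (volume.prod μ))
    (hD : ∀ᵐ x ∂μ, ∀ᵐ t : ℝ, t ∈ Set.Ioo 0 T → D (t, x) ≤ lineConv ℓ (fun τ => H (τ, x)) t) :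
    ∫ p, W p * D p ∂(volume.prod μ)
      ≤ K * ∫ p : ℝ × ℝ, ℓ (p.1 - p.2) * ((Set.Ioo 0 T).indicator 1 p.1
        * (Set.Ioo 0 T).indicator 1 p.2) ∂(volume.prod volume) := by
  have iWH := integrable_sub_mul_bdd_mul hℓ.integrable_right hW hWC hH
  have iP := fun i => integrable_sub_mul_of_sq hℓ.integrable_right (hP i) (hP2 i)
  have iPs := integrable_finsetSum Finset.univ fun i _ => iP i
  have i1 : Integrable (fun p : ℝ × ℝ => ℓ (p.1 - p.2) * ((Set.Ioo 0 T).indicator 1 p.1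
        * (Set.Ioo 0 T).indicator 1 p.2)) (volume.prod volume) := by
    have h1 : Integrable ((Set.Ioo 0 T).indicator (1 : ℝ → ℝ)) :=
      (integrable_indicator_iff measurableSet_Ioo).2 (integrable_const (1 : ℝ))
    refine ((integrable_prod_lineConv hℓ.integrable_right h1).bdd_mul (c := 1)
      (f := fun p : ℝ × ℝ => (Set.Ioo 0 T).indicator 1 p.1) ?_ ?_).congr
        (ae_of_all _ fun q => by ring)
    · exact h1.aestronglyMeasurable.comp_quasiMeasurePreserving Measure.quasiMeasurePreserving_fst
    · refine ae_of_all _ fun q => (norm_indicator_le_norm_self _ _).trans ?_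
      simp
  have i2 : Integrable (fun p : ℝ × ℝ => -∫ x, ∑ i, ℓ (p.1 - p.2) *
      (P i (p.1, x) * P i (p.2, x)) ∂μ) (volume.prod volume) := iPs.integral_prod_left.neg
  have s1 : ∫ p, W p * D p ∂(volume.prod μ)
      ≤ ∫ q, ℓ (q.1.1 - q.1.2) * (W (q.1.1, q.2) * H (q.1.2, q.2)) ∂((volume.prod volume).prod μ) := by
    rw [integral_prod_symm _ hWD, integral_prod_symm _ iWH]
    refine integral_mono_ae hWD.integral_prod_right iWH.integral_prod_right ?_
    filter_upwards [hD, hW0, iWH.prod_left_ae, hWD.prod_left_ae] with x hx h0 hi hd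
    rw [integral_prod _ hi]
    refine integral_mono_ae hd hi.integral_prod_left ?_
    filter_upwards [hx] with t ht
    have e : ∫ τ, ℓ (t - τ) * (W (t, x) * H (τ, x))
        = W (t, x) * lineConv ℓ (fun τ => H (τ, x)) t := by
      rw [lineConv, ← integral_const_mul]
      congr 1; ext τ; ring
    simp only [e]
    by_cases hT : t ∈ Set.Ioo 0 T
    · exact mul_le_mul_of_nonneg_left (ht hT) (h0 t)
    · simp [hWT t hT x]
  have s2 : 0 ≤ ∫ q, ∑ i, ℓ (q.1.1 - q.1.2) * (P i (q.1.1, q.2) * P i (q.1.2, q.2))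
      ∂((volume.prod volume).prod μ) := by
    rw [integral_finsetSum _ fun i _ => iP i]
    refine Finset.sum_nonneg fun i _ => ?_
    rw [integral_prod_symm _ (iP i)]
    refine integral_nonneg_of_ae ?_
    filter_upwards [(iP i).prod_left_ae, (hP i).prodMk_right] with x hx hm
    exact hℓ.integral_prod_nonneg (g := fun t => P i (t, x)) hm (fun t ht => hPT i t ht x) hx
  have hsub : ∀ᵐ p : ℝ × ℝ ∂(volume.prod volume), p.1 - p.2 < T → 0 ≤ ℓ (p.1 - p.2) := by
    exact (quasiMeasurePreserving_sub volume volume).ae hℓ.right_nonneg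
  have hWH' : ∀ᵐ p : ℝ × ℝ ∂(volume.prod volume), p.2 ∈ Set.Ioo 0 T → ∀ t ∈ Set.Ioo 0 T,
      ∫ x, W (t, x) * H (p.2, x) ∂μ ≤ -∫ x, ∑ i, P i (t, x) * P i (p.2, x) ∂μ + K :=
    Measure.quasiMeasurePreserving_snd.ae hWH
  have s3 : ∫ q, ℓ (q.1.1 - q.1.2) * (W (q.1.1, q.2) * H (q.1.2, q.2)) ∂((volume.prod volume).prod μ)
      ≤ -(∫ q, ∑ i, ℓ (q.1.1 - q.1.2) * (P i (q.1.1, q.2) * P i (q.1.2, q.2))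
        ∂((volume.prod volume).prod μ)) + K * ∫ p : ℝ × ℝ, ℓ (p.1 - p.2) *
          ((Set.Ioo 0 T).indicator 1 p.1 * (Set.Ioo 0 T).indicator 1 p.2)
          ∂(volume.prod volume) := by
    rw [integral_prod _ iWH, integral_prod _ iPs, ← integral_const_mul, ← integral_neg,
      ← integral_add i2 (i1.const_mul K)]
    refine integral_mono_ae iWH.integral_prod_left
      (i2.add (i1.const_mul K)) ?_
    filter_upwards [hsub, hWH'] with p hp hq
    simp only [← Finset.mul_sum, integral_const_mul]
    by_cases h1 : p.1 ∈ Set.Ioo 0 T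
    · by_cases h2 : p.2 ∈ Set.Ioo 0 T
      · have := mul_le_mul_of_nonneg_left (hq h2 p.1 h1) (hp (by linarith [h1.2, h2.1]))
        simp only [h1, h2, Set.indicator_of_mem, Pi.one_apply]
        linarith
      · simp [h2, hHT p.2 h2, hPT _ p.2 h2]
    · simp [h1, hWT p.1 h1, hPT _ p.1 h1]
  linarith

end SpaceTimeConvolution

/-! ### Functions on the space-time cylinder -/

section TimeCut

variable {X : Type*}

/-- The function `F(t, x)`, set to zero outside the time interval `(0, T)`. -/
noncomputable def timeCut (T : ℝ) (F : ℝ × X → ℝ) : ℝ × X → ℝ :=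
  (Prod.fst ⁻¹' Set.Ioo 0 T).indicator F

theorem timeCut_of_mem {T : ℝ} (F : ℝ × X → ℝ) {t : ℝ} (ht : t ∈ Set.Ioo 0 T) (x : X) :
    timeCut T F (t, x) = F (t, x) :=
  Set.indicator_of_mem (s := Prod.fst ⁻¹' Set.Ioo 0 T) ht F

theorem timeCut_of_notMem {T : ℝ} (F : ℝ × X → ℝ) {t : ℝ} (ht : t ∉ Set.Ioo 0 T) (x : X) :
    timeCut T F (t, x) = 0 :=
  Set.indicator_of_notMem (s := Prod.fst ⁻¹' Set.Ioo 0 T) ht F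

variable {N : ℕ} {T : ℝ} {Ω : Set (EuclideanSpace ℝ (Fin N))}

theorem volume_restrict_spaceTimeCylinder (T : ℝ) (Ω : Set (EuclideanSpace ℝ (Fin N))) :
    volume.restrict (spaceTimeCylinder T Ω)
      = ((volume : Measure ℝ).prod (volume.restrict Ω)).restrict (Prod.fst ⁻¹' Set.Ioo 0 T) := by
  rw [← Set.prod_univ, ← Measure.prod_restrict, Measure.restrict_univ, Measure.prod_restrict]
  rfl

theorem measurableSet_fst_preimage_Ioo (T : ℝ) :
    MeasurableSet (Prod.fst ⁻¹' Set.Ioo 0 T : Set (ℝ × EuclideanSpace ℝ (Fin N))) :=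
  measurable_fst measurableSet_Ioo

theorem integrable_timeCut_iff {F : ℝ × EuclideanSpace ℝ (Fin N) → ℝ} :
    Integrable (timeCut T F) (volume.prod (volume.restrict Ω))
      ↔ IntegrableOn F (spaceTimeCylinder T Ω) := by
  rw [timeCut, integrable_indicator_iff (measurableSet_fst_preimage_Ioo T), IntegrableOn,
    IntegrableOn, volume_restrict_spaceTimeCylinder]

theorem aestronglyMeasurable_timeCut {F : ℝ × EuclideanSpace ℝ (Fin N) → ℝ}
    (hF : AEStronglyMeasurable F (volume.restrict (spaceTimeCylinder T Ω))) :
    AEStronglyMeasurable (timeCut T F) (volume.prod (volume.restrict Ω)) := by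
  rw [volume_restrict_spaceTimeCylinder] at hF
  exact (aestronglyMeasurable_indicator_iff (measurableSet_fst_preimage_Ioo T)).2 hF

theorem aestronglyMeasurable_spaceTimeCylinder {Y : Type*} [TopologicalSpace Y]
    [TopologicalSpace.PseudoMetrizableSpace Y] [SecondCountableTopology Y]
    (hΩ : IsOpen Ω) {F : ℝ × EuclideanSpace ℝ (Fin N) → Y}
    (hF : ContinuousOn F (Set.Ioc 0 T ×ˢ closure Ω)) :
    AEStronglyMeasurable F (volume.restrict (spaceTimeCylinder T Ω)) :=
  (hF.mono (Set.prod_mono Set.Ioo_subset_Ioc_self subset_closure)).aestronglyMeasurable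
    (measurableSet_Ioo.prod hΩ.measurableSet)

end TimeCut

/-! ### The entropy inequality in time -/

/-- The time-pointwise entropy inequality for a scalar equation `(k * (u - u₀))' = f`. -/
theorem IsPCPair.entropyFun_sub_le_conv {k l : ℝ → ℝ} (h : IsPCPair k l) {T M ε u₀ : ℝ}
    (hε : 0 < ε) {u f : ℝ → ℝ} (hu₀ : u₀ ∈ Set.Icc 0 M) (hu : ContinuousOn u (Set.Ioo 0 T))
    (huM : ∀ t ∈ Set.Ioo 0 T, u t ∈ Set.Icc 0 M) (hf : IntegrableOn f (Set.Ioo 0 T))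
    (hder : ∀ t ∈ Set.Ioo 0 T, HasDerivAt (timeConv k fun τ => u τ - u₀) (f t) t) :
    ∀ᵐ t, t ∈ Set.Ioo 0 T → entropyFun (u t + ε) - entropyFun (u₀ + ε)
      ≤ lineConv ((Set.Ioo 0 T).indicator l)
        ((Set.Ioo 0 T).indicator fun τ => Real.log (u τ + ε) * f τ) t := by
  set w := (Set.Ioo 0 T).indicator fun τ => u τ - u₀ with hw
  have hwb : ∀ t ∈ Set.Ioo 0 T, |u t - u₀| ≤ M := fun t ht => by
    have := huM t ht
    rw [abs_le]; constructor <;> linarith [this.1, this.2, hu₀.1, hu₀.2]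
  have hwi : Integrable w := by
    refine (integrable_indicator_iff measurableSet_Ioo).2 (IntegrableOn.of_bound
      (by simp) ((hu.sub continuousOn_const).aestronglyMeasurable measurableSet_Ioo) M ?_)
    exact (ae_restrict_mem measurableSet_Ioo).mono fun t ht => hwb t ht
  have key := (h.isConjugatePair T).comp_sub_le_conv (isC1ConvexOn_entropyFun hε M) (u₀ := u₀)
    (w := w) (f := (Set.Ioo 0 T).indicator f) hwi
    (fun τ hτ => Set.indicator_of_notMem (fun h => by linarith [h.1]) _)
    (fun τ => by
      by_cases hτ : τ ∈ Set.Ioo 0 T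
      · simpa [hw, hτ] using huM τ hτ
      · simpa [hw, hτ] using hu₀)
    ((integrable_indicator_iff measurableSet_Ioo).2 hf)
    (fun τ hτ => Set.indicator_of_notMem (fun h => by linarith [h.1]) _)
    (ae_of_all _ fun t ht => by
      rw [hw, lineConv_indicator ht, timeConv_eq_integral
        (h.locallyIntegrable_left.integrableOn_Ioo_zero T) hwb hf hder ht,
        intervalIntegral.integral_of_le ht.1.le, intervalIntegral.integral_of_le ht.1.le,
        integral_Ioc_eq_integral_Ioo, integral_Ioc_eq_integral_Ioo]
      refine setIntegral_congr_fun measurableSet_Ioo fun τ hτ => ?_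
      rw [Set.indicator_of_mem (show τ ∈ Set.Ioo 0 T from ⟨hτ.1, hτ.2.trans ht.2⟩)])
  filter_upwards [key] with t h1 ht
  have h2 := h1 ht
  have e : (fun τ => Real.log (u₀ + w τ + ε) * (Set.Ioo 0 T).indicator f τ)
      = (Set.Ioo 0 T).indicator fun τ => Real.log (u τ + ε) * f τ := by
    ext τ
    by_cases hτ : τ ∈ Set.Ioo 0 T <;> simp [hw, hτ]
  simp only [e] at h2
  simpa [hw, ht] using h2

section Solution

variable {N : ℕ} {T : ℝ} {Ω : Set (EuclideanSpace ℝ (Fin N))} {k l : ℝ → ℝ} {d : Fin 4 → ℝ}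
  {ν : ℝ} {a : Fin 4 → ℕ} {c₀ : Fin 4 → EuclideanSpace ℝ (Fin N) → ℝ}
  {c : Fin 4 → ℝ → EuclideanSpace ℝ (Fin N) → ℝ}

/-- A common range `[0, M]` for the concentrations, up to the boundary, and the initial data. -/
theorem IsSmoothSolution.exists_bound (hS : IsSmoothSolution T Ω k d ν ν a c₀ c)
    (hc₀ : ∀ i, MemLp (c₀ i) ∞ (volume.restrict Ω))
    (hc₀pos : ∀ i, ∀ᵐ x ∂(volume.restrict Ω), 0 < c₀ i x)
    (hpos : ∀ i, ∀ t ∈ Set.Ioo 0 T, ∀ x ∈ Ω, 0 < c i t x) :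
    ∃ M : ℝ, 0 ≤ M ∧ (∀ i, ∀ t ∈ Set.Ioo 0 T, ∀ x ∈ closure Ω, c i t x ∈ Set.Icc 0 M) ∧
      ∀ i, ∀ᵐ x ∂(volume.restrict Ω), c₀ i x ∈ Set.Icc 0 M := by
  choose B hB using fun i => (hS.smooth i).bounded
  set B₀ : Fin 4 → ℝ := fun i => (eLpNorm (c₀ i) ∞ (volume.restrict Ω)).toReal with hB₀
  have hle : ∀ i, max |B i| (B₀ i) ≤ ∑ j, max |B j| (B₀ j) := fun i =>
    Finset.single_le_sum (f := fun j => max |B j| (B₀ j))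
      (fun j _ => le_max_of_le_left (abs_nonneg _)) (Finset.mem_univ i)
  refine ⟨∑ i, max |B i| (B₀ i),
    Finset.sum_nonneg fun j _ => le_max_of_le_left (abs_nonneg _), ?_, ?_⟩
  · intro i t ht x hx
    have ht' := Set.Ioo_subset_Ioc_self ht
    constructor
    · have hcont := ((hS.smooth i).contDiffOn_closure t ht').continuousOn
      have := mem_closure_iff_nhdsWithin_neBot.1 hx
      exact ge_of_tendsto ((hcont x hx).mono subset_closure)
        (eventually_mem_nhdsWithin.mono fun y hy => (hpos i t ht y hy).le)
    · exact (le_abs_self _).trans (((hB i t ht' x hx).trans (le_abs_self _)).trans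
        ((le_max_left _ _).trans (hle i)))
  · intro i
    filter_upwards [hc₀pos i, ae_le_eLpNormEssSup (f := c₀ i) (μ := volume.restrict Ω)]
      with x h1 h2
    refine ⟨h1.le, le_trans ?_ ((le_max_right _ _).trans (hle i))⟩
    have h3 : ENNReal.toReal ‖c₀ i x‖ₑ ≤ B₀ i := by
      refine ENNReal.toReal_mono (hc₀ i).2.ne ?_
      rwa [eLpNorm_exponent_top]
    rw [toReal_enorm] at h3
    exact (le_abs_self _).trans h3

/-- The right-hand side `dᵢ Δ cᵢ ± aᵢ r(c)` of the `i`-th equation. -/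
noncomputable def reactionDiffusion (d : Fin 4 → ℝ) (ν : ℝ) (a : Fin 4 → ℕ)
    (c : Fin 4 → ℝ → EuclideanSpace ℝ (Fin N) → ℝ) (i : Fin 4)
    (p : ℝ × EuclideanSpace ℝ (Fin N)) : ℝ :=
  d i * Laplacian.laplacian (c i p.1) p.2
    + reactionSign i * a i * reactionRate ν ν a (fun j => c j p.1 p.2)

theorem IsBoundedC1Domain.isFiniteMeasure (hD : IsBoundedC1Domain Ω) :
    IsFiniteMeasure (volume.restrict Ω) :=
  ⟨by rw [Measure.restrict_apply_univ]; exact hD.isBounded.measure_lt_top⟩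

theorem volume_spaceTimeCylinder_lt_top (hD : IsBoundedC1Domain Ω) (T : ℝ) :
    volume (spaceTimeCylinder T Ω) < ∞ := by
  rw [spaceTimeCylinder, Measure.volume_eq_prod, Measure.prod_prod]
  exact ENNReal.mul_lt_top (by simp) hD.isBounded.measure_lt_top

theorem IsSmoothSolution.integrableOn_reactionDiffusion (hD : IsBoundedC1Domain Ω)
    (hS : IsSmoothSolution T Ω k d ν ν a c₀ c) {M : ℝ}
    (hcM : ∀ i, ∀ t ∈ Set.Ioo 0 T, ∀ x ∈ closure Ω, c i t x ∈ Set.Icc 0 M) (i : Fin 4) :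
    IntegrableOn (reactionDiffusion d ν a c i) (spaceTimeCylinder T Ω) := by
  have hc : Continuous fun v : Fin 4 → ℝ => reactionSign i * a i * reactionRate ν ν a v := by
    unfold reactionRate; fun_prop
  refine ((hS.smooth i).integrable_laplacian.const_mul (d i)).add ?_
  obtain ⟨B, hB⟩ := (isCompact_univ_pi fun _ : Fin 4 => isCompact_Icc (a := (0 : ℝ))
    (b := M)).exists_bound_of_continuousOn hc.continuousOn
  refine IntegrableOn.of_bound (volume_spaceTimeCylinder_lt_top hD T)
    (aestronglyMeasurable_spaceTimeCylinder hD.isOpen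
      (hc.comp_continuousOn (continuousOn_pi.2 fun j => (hS.smooth j).continuousOn))) B ?_
  refine (ae_restrict_mem (measurableSet_Ioo.prod hD.isOpen.measurableSet)).mono fun p hp => ?_
  exact hB _ (Set.mem_univ_pi.2 fun j => hcM j p.1 hp.1 p.2 (subset_closure hp.2))

theorem aestronglyMeasurable_log_add (hΩ : IsOpen Ω) {f : ℝ → EuclideanSpace ℝ (Fin N) → ℝ}
    (hf : IsSufficientlySmooth T Ω f) (ε : ℝ) :
    AEStronglyMeasurable (fun p : ℝ × EuclideanSpace ℝ (Fin N) => Real.log (f p.1 p.2 + ε))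
      (volume.restrict (spaceTimeCylinder T Ω)) :=
  (Real.measurable_log.comp_aemeasurable ((aestronglyMeasurable_spaceTimeCylinder hΩ
    hf.continuousOn).aemeasurable.add_const ε)).aestronglyMeasurable

theorem IsSmoothSolution.integrableOn_log_mul_reactionDiffusion (hD : IsBoundedC1Domain Ω)
    (hS : IsSmoothSolution T Ω k d ν ν a c₀ c) {M ε : ℝ} (hε : 0 < ε) (hε1 : ε ≤ 1)
    (hcM : ∀ i, ∀ t ∈ Set.Ioo 0 T, ∀ x ∈ closure Ω, c i t x ∈ Set.Icc 0 M) (i : Fin 4) :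
    IntegrableOn (fun p => Real.log (c i p.1 p.2 + ε) * reactionDiffusion d ν a c i p)
      (spaceTimeCylinder T Ω) := by
  have hmeas := measurableSet_Ioo.prod hD.isOpen.measurableSet (s := Set.Ioo (0 : ℝ) T)
  refine (hS.integrableOn_reactionDiffusion hD hcM i).bdd_mul
    (c := |Real.log ε| + |Real.log (M + 1)|) ?_ ?_
  · exact aestronglyMeasurable_log_add hD.isOpen (hS.smooth i) ε
  · refine (ae_restrict_mem hmeas).mono fun p hp => ?_
    have := hcM i p.1 hp.1 p.2 (subset_closure hp.2)
    exact abs_log_add_le this.1 this.2 hε hε1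

/-- The entropy inequality in time, at almost every point of `Ω`. -/
theorem IsSmoothSolution.sum_entropyFun_sub_le_conv (hD : IsBoundedC1Domain Ω)
    (hk : IsPCPair k l) (hS : IsSmoothSolution T Ω k d ν ν a c₀ c) {M ε : ℝ} (hε : 0 < ε)
    (hε1 : ε ≤ 1) (hcM : ∀ i, ∀ t ∈ Set.Ioo 0 T, ∀ x ∈ closure Ω, c i t x ∈ Set.Icc 0 M)
    (hc₀M : ∀ i, ∀ᵐ x ∂(volume.restrict Ω), c₀ i x ∈ Set.Icc 0 M) :
    ∀ᵐ x ∂(volume.restrict Ω), ∀ᵐ t : ℝ, t ∈ Set.Ioo 0 T →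
      ∑ i, (entropyFun (c i t x + ε) - entropyFun (c₀ i x + ε))
        ≤ lineConv ((Set.Ioo 0 T).indicator l) (fun τ => timeCut T (fun p =>
          ∑ i, Real.log (c i p.1 p.2 + ε) * reactionDiffusion d ν a c i p) (τ, x)) t := by
  have := hD.isFiniteMeasure
  have i1 : ∀ᵐ x ∂(volume.restrict Ω), ∀ i,
      IntegrableOn (fun t => reactionDiffusion d ν a c i (t, x)) (Set.Ioo 0 T) := by
    refine ae_all_iff.2 fun i => ?_
    filter_upwards [(integrable_timeCut_iff.2
      (hS.integrableOn_reactionDiffusion hD hcM i)).prod_left_ae] with x hx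
    exact (integrable_indicator_iff measurableSet_Ioo).1 hx
  have i2 : ∀ᵐ x ∂(volume.restrict Ω), ∀ i, Integrable ((Set.Ioo 0 T).indicator fun t =>
      Real.log (c i t x + ε) * reactionDiffusion d ν a c i (t, x)) := by
    refine ae_all_iff.2 fun i => ?_
    filter_upwards [(integrable_timeCut_iff.2
      (hS.integrableOn_log_mul_reactionDiffusion hD hε hε1 hcM i)).prod_left_ae] with x hx
    exact hx
  filter_upwards [i1, i2, ae_all_iff.2 hS.equation, ae_all_iff.2 hc₀M,
    ae_restrict_mem hD.isOpen.measurableSet] with x h1 h2 h3 h4 hx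
  have h5 : ∀ᵐ t : ℝ, ∀ i, t ∈ Set.Ioo 0 T →
      entropyFun (c i t x + ε) - entropyFun (c₀ i x + ε)
        ≤ lineConv ((Set.Ioo 0 T).indicator l) ((Set.Ioo 0 T).indicator fun τ =>
          Real.log (c i τ x + ε) * reactionDiffusion d ν a c i (τ, x)) t := by
    refine ae_all_iff.2 fun i => hk.entropyFun_sub_le_conv hε (h4 i) ?_
      (fun t ht => hcM i t ht x (subset_closure hx)) (h1 i) (h3 i)
    exact (hS.smooth i).continuousOn.comp (by fun_prop : Continuous fun t : ℝ => (t, x)).continuousOn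
      fun t ht => ⟨Set.Ioo_subset_Ioc_self ht, subset_closure hx⟩
  have h6 : ∀ᵐ t : ℝ, ∀ i, Integrable fun τ => (Set.Ioo 0 T).indicator l (t - τ) *
      (Set.Ioo 0 T).indicator (fun τ =>
        Real.log (c i τ x + ε) * reactionDiffusion d ν a c i (τ, x)) τ :=
    ae_all_iff.2 fun i => ae_integrable_lineConv (hk.isConjugatePair T).integrable_right (h2 i)
  filter_upwards [h5, h6] with t h7 h8 ht
  refine (Finset.sum_le_sum fun i _ => h7 i ht).trans_eq ?_
  simp only [lineConv]
  rw [← integral_finsetSum _ fun i _ => h8 i]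
  congr 1; ext τ
  rw [← Finset.mul_sum]
  by_cases hτ : τ ∈ Set.Ioo 0 T <;> simp [timeCut, hτ]

/-! ### The entropy inequality on the cylinder -/

theorem weightedEntropy_mem_Icc (hd : ∀ i, 0 ≤ d i) {M B ε : ℝ} (hε : 0 ≤ ε) (hε1 : ε ≤ 1)
    (hB : ∀ s ∈ Set.Icc 0 (M + 1), entropyFun s ≤ B)
    {v : Fin 4 → EuclideanSpace ℝ (Fin N) → ℝ} {x : EuclideanSpace ℝ (Fin N)}
    (hv : ∀ i, v i x ∈ Set.Icc 0 M) : weightedEntropy d ε v x ∈ Set.Icc 0 ((∑ i, d i) * B) := by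
  constructor
  · exact Finset.sum_nonneg fun i _ => mul_nonneg (hd i) (entropyFun_nonneg
      (add_nonneg (hv i).1 hε))
  · rw [Finset.sum_mul]
    exact Finset.sum_le_sum fun i _ => mul_le_mul_of_nonneg_left
      (hB _ ⟨add_nonneg (hv i).1 hε, add_le_add (hv i).2 hε1⟩) (hd i)

/-- The product of the weighted entropy with the entropy increment, for the shift `ε`. -/
noncomputable def entropyIncrementDensity (d : Fin 4 → ℝ)
    (c₀ : Fin 4 → EuclideanSpace ℝ (Fin N) → ℝ)
    (c : Fin 4 → ℝ → EuclideanSpace ℝ (Fin N) → ℝ) (ε : ℝ)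
    (p : ℝ × EuclideanSpace ℝ (Fin N)) : ℝ :=
  weightedEntropy d ε (fun i => c i p.1) p.2
    * ∑ i, (entropyFun (c i p.1 p.2 + ε) - entropyFun (c₀ i p.2 + ε))

theorem quasiMeasurePreserving_snd_spaceTimeCylinder (T : ℝ)
    (Ω : Set (EuclideanSpace ℝ (Fin N))) :
    Measure.QuasiMeasurePreserving Prod.snd (volume.restrict (spaceTimeCylinder T Ω))
      (volume.restrict Ω) := by
  rw [spaceTimeCylinder, Measure.volume_eq_prod, ← Measure.prod_restrict]
  exact Measure.quasiMeasurePreserving_snd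

theorem aestronglyMeasurable_weightedEntropy (hΩ : IsOpen Ω)
    (hc : ∀ i, IsSufficientlySmooth T Ω (c i)) (d : Fin 4 → ℝ) (ε : ℝ) :
    AEStronglyMeasurable (fun p : ℝ × EuclideanSpace ℝ (Fin N) =>
      weightedEntropy d ε (fun i => c i p.1) p.2) (volume.restrict (spaceTimeCylinder T Ω)) :=
  aestronglyMeasurable_spaceTimeCylinder hΩ (continuousOn_finsetSum _ fun i _ =>
    continuousOn_const.mul (continuous_entropyFun.comp_continuousOn
      ((hc i).continuousOn.add continuousOn_const)))

theorem aestronglyMeasurable_entropyIncrementDensity (hΩ : IsOpen Ω)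
    (hc : ∀ i, IsSufficientlySmooth T Ω (c i))
    (hc₀ : ∀ i, AEStronglyMeasurable (c₀ i) (volume.restrict Ω)) (d : Fin 4 → ℝ) (ε : ℝ) :
    AEStronglyMeasurable (entropyIncrementDensity d c₀ c ε)
      (volume.restrict (spaceTimeCylinder T Ω)) := by
  refine (aestronglyMeasurable_weightedEntropy hΩ hc d ε).mul
    (Finset.aestronglyMeasurable_fun_sum _ fun i _ => ?_)
  refine AEStronglyMeasurable.sub ?_ ?_
  · exact aestronglyMeasurable_spaceTimeCylinder hΩ (continuous_entropyFun.comp_continuousOn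
      ((hc i).continuousOn.add continuousOn_const))
  · exact continuous_entropyFun.comp_aestronglyMeasurable
      (((hc₀ i).comp_quasiMeasurePreserving (quasiMeasurePreserving_snd_spaceTimeCylinder T Ω)).add
        aestronglyMeasurable_const)

theorem norm_entropyIncrementDensity_le (hΩ : IsOpen Ω) (hd : ∀ i, 0 ≤ d i) {M B ε : ℝ}
    (hε : 0 ≤ ε) (hε1 : ε ≤ 1) (hB : ∀ s ∈ Set.Icc 0 (M + 1), entropyFun s ≤ B)
    (hcM : ∀ i, ∀ t ∈ Set.Ioo 0 T, ∀ x ∈ closure Ω, c i t x ∈ Set.Icc 0 M)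
    (hc₀M : ∀ i, ∀ᵐ x ∂(volume.restrict Ω), c₀ i x ∈ Set.Icc 0 M) :
    ∀ᵐ p ∂(volume.restrict (spaceTimeCylinder T Ω)),
      ‖entropyIncrementDensity d c₀ c ε p‖ ≤ (∑ i, d i) * B * ∑ _i : Fin 4, B := by
  filter_upwards [ae_restrict_mem (measurableSet_Ioo.prod hΩ.measurableSet),
    (quasiMeasurePreserving_snd_spaceTimeCylinder T Ω).ae (ae_all_iff.2 hc₀M)] with p hp h0
  have h1 : ∀ i, c i p.1 p.2 ∈ Set.Icc 0 M := fun i => hcM i p.1 hp.1 p.2 (subset_closure hp.2)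
  have h2 := weightedEntropy_mem_Icc hd hε hε1 hB (v := fun i => c i p.1) (x := p.2) h1
  have h3 : ∀ s ∈ Set.Icc 0 M, entropyFun (s + ε) ∈ Set.Icc 0 B := fun s hs =>
    ⟨entropyFun_nonneg (add_nonneg hs.1 hε), hB _ ⟨add_nonneg hs.1 hε, add_le_add hs.2 hε1⟩⟩
  rw [entropyIncrementDensity, norm_mul]
  refine mul_le_mul ?_ ?_ (norm_nonneg _) (h2.1.trans h2.2)
  · rw [Real.norm_of_nonneg h2.1]; exact h2.2
  · refine (norm_sum_le _ _).trans (Finset.sum_le_sum fun i _ => ?_)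
    have h4 := h3 _ (h1 i)
    have h5 := h3 _ (h0 i)
    rw [Real.norm_eq_abs, abs_le]
    constructor <;> linarith [h4.1, h4.2, h5.1, h5.2]

theorem memLp_weightedEntropyPartial (hΩ : IsOpen Ω) (hc : ∀ i, IsSufficientlySmooth T Ω (c i))
    (d : Fin 4 → ℝ) {M ε : ℝ} (hε : 0 < ε) (hε1 : ε ≤ 1)
    (hcM : ∀ i, ∀ t ∈ Set.Ioo 0 T, ∀ x ∈ closure Ω, c i t x ∈ Set.Icc 0 M) (j : Fin N) :
    MemLp (fun p : ℝ × EuclideanSpace ℝ (Fin N) =>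
      weightedEntropyPartial Ω d ε (fun i => c i p.1) j p.2) 2
        (volume.restrict (spaceTimeCylinder T Ω)) := by
  refine memLp_finsetSum _ fun i _ => MemLp.const_mul ?_ (d i)
  refine (hc i).memLp_deriv.of_le_mul (c := |Real.log ε| + |Real.log (M + 1)|)
    ((aestronglyMeasurable_log_add hΩ (hc i) ε).mul (aestronglyMeasurable_spaceTimeCylinder hΩ
      ((hc i).continuousOn_deriv.clm_apply continuousOn_const))) ?_
  filter_upwards [ae_restrict_mem (measurableSet_Ioo.prod hΩ.measurableSet)] with p hp
  have h1 := hcM i p.1 hp.1 p.2 (subset_closure hp.2)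
  rw [fderivWithin_of_mem_nhds (mem_of_superset (hΩ.mem_nhds hp.2) subset_closure), norm_mul]
  refine mul_le_mul (abs_log_add_le h1.1 h1.2 hε hε1) ?_ (norm_nonneg _) (by positivity)
  simpa using (fderiv ℝ (c i p.1) p.2).le_opNorm (EuclideanSpace.single j (1 : ℝ))

/-- The pairing of the weighted entropy at time `t` with the entropy production at time `τ`:
diffusion contributes minus the product of the gradients, and the reaction at most an error. The
Laplacian is integrable over `Ω` only for almost every `τ`. -/
theorem IsSmoothSolution.integral_weightedEntropy_mul_le (hD : IsBoundedC1Domain Ω)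
    (hd : ∀ i, 0 ≤ d i) (hS : IsSmoothSolution T Ω k d ν ν a c₀ c) {M B E ε : ℝ} (hε : 0 < ε)
    (hε1 : ε ≤ 1) (hcM : ∀ i, ∀ t ∈ Set.Ioo 0 T, ∀ x ∈ closure Ω, c i t x ∈ Set.Icc 0 M)
    (hB : ∀ s ∈ Set.Icc 0 (M + 1), entropyFun s ≤ B) (hE0 : 0 ≤ E)
    (hE : ∀ v : Fin 4 → ℝ, (∀ i, v i ∈ Set.Icc 0 M) →
      ∑ i, Real.log (v i + ε) * (reactionSign i * a i * reactionRate ν ν a v) ≤ E) :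
    ∀ᵐ τ : ℝ, τ ∈ Set.Ioo 0 T → ∀ t ∈ Set.Ioo 0 T,
      ∫ x in Ω, weightedEntropy d ε (fun i => c i t) x
          * ∑ i, Real.log (c i τ x + ε) * reactionDiffusion d ν a c i (τ, x)
        ≤ -(∫ x in Ω, ∑ j, weightedEntropyPartial Ω d ε (fun i => c i t) j x
            * weightedEntropyPartial Ω d ε (fun i => c i τ) j x)
          + (∑ i, d i) * B * E * (volume.restrict Ω).real Set.univ := by
  have := hD.isFiniteMeasure
  have hΔ : ∀ᵐ τ : ℝ, ∀ i, τ ∈ Set.Ioo 0 T →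
      IntegrableOn (Laplacian.laplacian (c i τ)) Ω := by
    refine ae_all_iff.2 fun i => ?_
    filter_upwards [(integrable_timeCut_iff.2 (hS.smooth i).integrable_laplacian).prod_right_ae]
      with τ h1 hτ
    simp only [timeCut_of_mem _ hτ] at h1
    exact h1
  filter_upwards [hΔ] with τ h1 hτ t ht
  have ht' := Set.Ioo_subset_Ioc_self ht
  have hτ' := Set.Ioo_subset_Ioc_self hτ
  have hslice : ∀ s ∈ Set.Ioc 0 T, ∀ i,
      ContinuousOn (fderivWithin ℝ (c i s) (closure Ω)) (closure Ω) := fun s hs i =>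
    (hS.smooth i).continuousOn_deriv.comp (Continuous.prodMk_right s).continuousOn
      fun x hx => ⟨hs, hx⟩
  have hc : ∀ s ∈ Set.Ioc 0 T, ∀ i, ContinuousOn (c i s) (closure Ω) := fun s hs i =>
    ((hS.smooth i).contDiffOn_closure s hs).continuousOn
  have hgreen := hD.integral_weightedEntropy_mul_laplacian_le hd hε
    (v := fun i => c i t) (u := fun i => c i τ)
    (fun i => ((hS.smooth i).contDiffOn_closure t ht').mono subset_closure) (hc t ht')
    (hslice t ht') (fun i x hx => (hcM i t ht x hx).1)
    (fun i => (hS.smooth i).contDiffOn τ hτ') (hc τ hτ')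
    (hslice τ hτ') (fun i x hx => (hcM i τ hτ x hx).1)
    (fun i => hS.neumann i τ hτ) (fun i => h1 i hτ)
  set w := weightedEntropy d ε (fun i => c i t) with hw
  set R : EuclideanSpace ℝ (Fin N) → ℝ := fun x => ∑ i, Real.log (c i τ x + ε)
    * (reactionSign i * a i * reactionRate ν ν a fun j => c j τ x) with hR
  have hlog : ∀ i, ContinuousOn (fun x => Real.log (c i τ x + ε)) (closure Ω) := fun i =>
    ((hc τ hτ' i).add continuousOn_const).log fun x hx =>
      (add_pos_of_nonneg_of_pos (hcM i τ hτ x hx).1 hε).ne'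
  have hwc : ContinuousOn w (closure Ω) := continuousOn_finsetSum _ fun i _ =>
    continuousOn_const.mul (continuous_entropyFun.comp_continuousOn
      ((hc t ht' i).add continuousOn_const))
  have hRc : ContinuousOn R (closure Ω) := by
    refine continuousOn_finsetSum _ fun i _ => (hlog i).mul ?_
    have h2 : Continuous fun v : Fin 4 → ℝ => reactionSign i * a i * reactionRate ν ν a v := by
      unfold reactionRate; fun_prop
    exact h2.comp_continuousOn (continuousOn_pi.2 fun j => hc τ hτ' j)
  have hcl : IsCompact (closure Ω) := hD.isBounded.isCompact_closure
  have iR : IntegrableOn (fun x => w x * R x) Ω :=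
    ((hwc.mul hRc).integrableOn_compact hcl).mono_set subset_closure
  have iL : IntegrableOn (fun x => w x * ∑ i, Real.log (c i τ x + ε)
      * (d i * Laplacian.laplacian (c i τ) x)) Ω := by
    simp only [Finset.mul_sum]
    refine integrable_finsetSum _ fun i _ => ?_
    obtain ⟨C, hC⟩ := hcl.exists_bound_of_continuousOn (hwc.mul (hlog i))
    refine (((h1 i hτ).const_mul (d i)).bdd_mul
      (((hwc.mul (hlog i)).mono subset_closure).aestronglyMeasurable hD.isOpen.measurableSet)
      ((ae_restrict_mem hD.isOpen.measurableSet).mono fun x hx =>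
        hC x (subset_closure hx))).congr (ae_of_all _ fun x => ?_)
    simp only [Pi.mul_apply]
    ring
  have e : ∫ x in Ω, w x * ∑ i, Real.log (c i τ x + ε) * reactionDiffusion d ν a c i (τ, x)
      = (∫ x in Ω, w x * ∑ i, Real.log (c i τ x + ε) * (d i * Laplacian.laplacian (c i τ) x))
        + ∫ x in Ω, w x * R x := by
    rw [← integral_add iL iR]
    refine integral_congr_ae (ae_of_all _ fun x => ?_)
    simp only [reactionDiffusion, hR, mul_add, Finset.sum_add_distrib]
  have hRle : ∫ x in Ω, w x * R x ≤ (∑ i, d i) * B * E * (volume.restrict Ω).real Set.univ := by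
    calc ∫ x in Ω, w x * R x ≤ ∫ _x in Ω, (∑ i, d i) * B * E := by
          refine setIntegral_mono_on iR (integrable_const _) hD.isOpen.measurableSet fun x hx => ?_
          have h2 := weightedEntropy_mem_Icc hd hε.le hε1 hB (v := fun i => c i t) (x := x)
            fun i => hcM i t ht x (subset_closure hx)
          have h3 := hE (fun i => c i τ x) fun i => hcM i τ hτ x (subset_closure hx)
          calc w x * R x ≤ w x * E := mul_le_mul_of_nonneg_left h3 h2.1
            _ ≤ (∑ i, d i) * B * E := mul_le_mul_of_nonneg_right h2.2 hE0
      _ = _ := by rw [integral_const, smul_eq_mul, mul_comm]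
  rw [e]
  linarith

/-- The entropy inequality for the shift `ε`, with an error that vanishes as `ε → 0`. -/
theorem IsSmoothSolution.exists_integral_entropyIncrementDensity_le (hD : IsBoundedC1Domain Ω)
    (hk : IsPCPair k l) (hν : 0 < ν) (hd : ∀ i, 0 ≤ d i)
    (hc₀ : ∀ i, AEStronglyMeasurable (c₀ i) (volume.restrict Ω))
    (hS : IsSmoothSolution T Ω k d ν ν a c₀ c) {M : ℝ} (hM : 0 ≤ M)
    (hcM : ∀ i, ∀ t ∈ Set.Ioo 0 T, ∀ x ∈ closure Ω, c i t x ∈ Set.Icc 0 M)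
    (hc₀M : ∀ i, ∀ᵐ x ∂(volume.restrict Ω), c₀ i x ∈ Set.Icc 0 M) :
    ∃ E : ℝ → ℝ, Tendsto E (𝓝[>] 0) (𝓝 0) ∧ ∀ ε, 0 < ε → ε ≤ 1 →
      ∫ p in spaceTimeCylinder T Ω, entropyIncrementDensity d c₀ c ε p ≤ E ε := by
  have := hD.isFiniteMeasure
  obtain ⟨B, hB⟩ := (isCompact_Icc (a := (0 : ℝ)) (b := M + 1)).exists_bound_of_continuousOn
    continuous_entropyFun.continuousOn
  replace hB : ∀ s ∈ Set.Icc 0 (M + 1), entropyFun s ≤ B := fun s hs =>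
    (le_abs_self _).trans (hB s hs)
  obtain ⟨E, hE0, hE⟩ := exists_reaction_dissipation_bound hν a hM
  set L := ∫ p : ℝ × ℝ, (Set.Ioo 0 T).indicator l (p.1 - p.2) *
    ((Set.Ioo 0 T).indicator 1 p.1 * (Set.Ioo 0 T).indicator 1 p.2) ∂(volume.prod volume) with hL
  refine ⟨fun ε => (∑ i, d i) * B * E ε * (volume.restrict Ω).real Set.univ * L, ?_, ?_⟩
  · have := ((hE0.const_mul ((∑ i, d i) * B)).mul_const
      ((volume.restrict Ω).real Set.univ)).mul_const L
    simpa using this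
  intro ε hε hε1
  obtain ⟨hEnn, hEle⟩ := hE ε hε hε1
  have hmem : ∀ᵐ x ∂(volume.restrict Ω), x ∈ Ω := ae_restrict_mem hD.isOpen.measurableSet
  set W := timeCut T fun p : ℝ × EuclideanSpace ℝ (Fin N) =>
    weightedEntropy d ε (fun i => c i p.1) p.2 with hW
  have hWI : ∀ᵐ x ∂(volume.restrict Ω), ∀ t, W (t, x) ∈ Set.Icc 0 ((∑ i, d i) * B) := by
    filter_upwards [hmem] with x hx t
    have hB0 : 0 ≤ B := (entropyFun_nonneg le_rfl).trans (hB 0 ⟨le_rfl, by linarith⟩)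
    by_cases ht : t ∈ Set.Ioo 0 T
    · rw [hW, timeCut_of_mem _ ht]
      exact weightedEntropy_mem_Icc hd hε.le hε1 hB fun i => hcM i t ht x (subset_closure hx)
    · rw [hW, timeCut_of_notMem _ ht]
      exact ⟨le_rfl, mul_nonneg (Finset.sum_nonneg fun i _ => hd i) hB0⟩
  set Dl : ℝ × EuclideanSpace ℝ (Fin N) → ℝ := fun p =>
    ∑ i, (entropyFun (c i p.1 p.2 + ε) - entropyFun (c₀ i p.2 + ε)) with hDl
  have hWD : (fun p => W p * Dl p) = timeCut T (entropyIncrementDensity d c₀ c ε) := by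
    ext ⟨t, x⟩
    by_cases ht : t ∈ Set.Ioo 0 T
    · simp only [hW, timeCut_of_mem _ ht]; rfl
    · simp only [hW, timeCut_of_notMem _ ht, zero_mul]
  have iWD : IntegrableOn (entropyIncrementDensity d c₀ c ε) (spaceTimeCylinder T Ω) :=
    IntegrableOn.of_bound (volume_spaceTimeCylinder_lt_top hD T)
      (aestronglyMeasurable_entropyIncrementDensity hD.isOpen hS.smooth hc₀ d ε) _
      (norm_entropyIncrementDensity_le hD.isOpen hd hε.le hε1 hB hcM hc₀M)
  have eWD : ∫ p, W p * Dl p ∂(volume.prod (volume.restrict Ω))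
      = ∫ p in spaceTimeCylinder T Ω, entropyIncrementDensity d c₀ c ε p := by
    rw [hWD, timeCut, integral_indicator (measurableSet_fst_preimage_Ioo T),
      volume_restrict_spaceTimeCylinder]
  rw [← eWD]
  refine (hk.isConjugatePair T).integral_mul_le (μ := volume.restrict Ω)
    (C := (∑ i, d i) * B)
    (H := timeCut T fun p => ∑ i, Real.log (c i p.1 p.2 + ε) * reactionDiffusion d ν a c i p)
    (P := fun j => timeCut T fun p => weightedEntropyPartial Ω d ε (fun i => c i p.1) j p.2)
    ?_ ?_ ?_ ?_ ?_ ?_ ?_ ?_ ?_ ?_ ?_ ?_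
  · exact aestronglyMeasurable_timeCut
      (aestronglyMeasurable_weightedEntropy hD.isOpen hS.smooth d ε)
  · exact hWI.mono fun x hx t => by rw [abs_of_nonneg (hx t).1]; exact (hx t).2
  · exact hWI.mono fun x hx t => (hx t).1
  · exact fun t ht x => timeCut_of_notMem _ ht x
  · exact integrable_timeCut_iff.2 (integrable_finsetSum _ fun i _ =>
      hS.integrableOn_log_mul_reactionDiffusion hD hε hε1 hcM i)
  · exact fun t ht x => timeCut_of_notMem _ ht x
  · exact fun j => aestronglyMeasurable_timeCut
      (memLp_weightedEntropyPartial hD.isOpen hS.smooth d hε hε1 hcM j).1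
  · intro j
    have h := integrable_timeCut_iff.2
      (memLp_weightedEntropyPartial hD.isOpen hS.smooth d hε hε1 hcM j).integrable_sq
    refine h.congr (ae_of_all _ fun p => ?_)
    by_cases hp : p.1 ∈ Set.Ioo 0 T
    · simp only [timeCut_of_mem _ hp]
    · simp [timeCut_of_notMem _ hp]
  · exact fun j t ht x => timeCut_of_notMem _ ht x
  · filter_upwards [hS.integral_weightedEntropy_mul_le hD hd hε hε1 hcM hB hEnn hEle]
      with τ h hτ t ht
    simpa only [hW, timeCut_of_mem _ hτ, timeCut_of_mem _ ht] using h hτ t ht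
  · rw [hWD]
    exact integrable_timeCut_iff.2 iWD
  · exact hS.sum_entropyFun_sub_le_conv hD hk hε hε1 hcM hc₀M

/-- The limit `ε → 0` in the entropy inequality, by dominated convergence: the entropy itself is
continuous up to zero, only its derivative is not. -/
theorem IsSmoothSolution.integral_entropyIncrementDensity_nonpos (hD : IsBoundedC1Domain Ω)
    (hk : IsPCPair k l) (hν : 0 < ν) (hd : ∀ i, 0 ≤ d i)
    (hc₀ : ∀ i, AEStronglyMeasurable (c₀ i) (volume.restrict Ω))
    (hS : IsSmoothSolution T Ω k d ν ν a c₀ c) {M : ℝ} (hM : 0 ≤ M)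
    (hcM : ∀ i, ∀ t ∈ Set.Ioo 0 T, ∀ x ∈ closure Ω, c i t x ∈ Set.Icc 0 M)
    (hc₀M : ∀ i, ∀ᵐ x ∂(volume.restrict Ω), c₀ i x ∈ Set.Icc 0 M) :
    ∫ p in spaceTimeCylinder T Ω, entropyIncrementDensity d c₀ c 0 p ≤ 0 := by
  obtain ⟨B, hB⟩ := (isCompact_Icc (a := (0 : ℝ)) (b := M + 1)).exists_bound_of_continuousOn
    continuous_entropyFun.continuousOn
  replace hB : ∀ s ∈ Set.Icc 0 (M + 1), entropyFun s ≤ B := fun s hs =>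
    (le_abs_self _).trans (hB s hs)
  obtain ⟨E, hE0, hE⟩ :=
    hS.exists_integral_entropyIncrementDensity_le hD hk hν hd hc₀ hM hcM hc₀M
  have hev : ∀ᶠ ε : ℝ in 𝓝[>] 0, ε ∈ Set.Ioo 0 1 := Ioo_mem_nhdsGT one_pos
  refine le_of_tendsto_of_tendsto
    (tendsto_integral_filter_of_dominated_convergence
      (fun _ => (∑ i, d i) * B * ∑ _i : Fin 4, B)
      (Eventually.of_forall fun ε =>
        aestronglyMeasurable_entropyIncrementDensity hD.isOpen hS.smooth hc₀ d ε)
      (hev.mono fun ε hε =>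
        norm_entropyIncrementDensity_le hD.isOpen hd hε.1.le hε.2.le hB hcM hc₀M)
      ?_ ?_) hE0 (hev.mono fun ε hε => hE ε hε.1 hε.2.le)
  · exact integrableOn_const (volume_spaceTimeCylinder_lt_top hD T).ne
  · refine ae_of_all _ fun p => ?_
    have h1 : Continuous fun ε => entropyIncrementDensity d c₀ c ε p := by
      have := continuous_entropyFun
      unfold entropyIncrementDensity weightedEntropy
      fun_prop
    exact (h1.tendsto 0).mono_left nhdsWithin_le_nhds

end Solution

/-! ### From the entropy inequality to the norm estimate -/

theorem eLpNorm_two_eq_ofReal_sqrt {α : Type*} [MeasurableSpace α] {μ : Measure α} {f : α → ℝ}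
    (hf : MemLp f 2 μ) : eLpNorm f 2 μ = ENNReal.ofReal √(∫ x, f x ^ 2 ∂μ) := by
  rw [hf.eLpNorm_eq_integral_rpow_norm two_ne_zero (by simp), Real.sqrt_eq_rpow]
  simp

/-- Young's inequality for the entropies: here `z` and `z₀` stand for the entropy variables and
their initial values, and `m ≤ dᵢ ≤ D`. Once the integral of the right-hand side is known to be
nonpositive, the square of the total entropy is controlled by that of its initial value. -/
theorem sq_sum_le_of_weights {ι : Type*} [Fintype ι] {d z z₀ : ι → ℝ} {m D : ℝ} (hm : 0 < m)
    (hmd : ∀ i, m ≤ d i) (hdD : ∀ i, d i ≤ D) (hz : ∀ i, 0 ≤ z i) (hz₀ : ∀ i, 0 ≤ z₀ i) :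
    (∑ i, z i) ^ 2 - (D / m) ^ 2 * (∑ i, z₀ i) ^ 2
      ≤ 2 / m * ((∑ i, d i * z i) * ∑ i, (z i - z₀ i)) := by
  have h1 : m * ∑ i, z i ≤ ∑ i, d i * z i := by
    rw [Finset.mul_sum]
    exact Finset.sum_le_sum fun i _ => mul_le_mul_of_nonneg_right (hmd i) (hz i)
  have h2 : ∑ i, d i * z i ≤ D * ∑ i, z i := by
    rw [Finset.mul_sum]
    exact Finset.sum_le_sum fun i _ => mul_le_mul_of_nonneg_right (hdD i) (hz i)
  rw [Finset.sum_sub_distrib]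
  have hZ : 0 ≤ ∑ i, z i := Finset.sum_nonneg fun i _ => hz i
  have hZ₀ : 0 ≤ ∑ i, z₀ i := Finset.sum_nonneg fun i _ => hz₀ i
  generalize ∑ i, z i = Z at *
  generalize ∑ i, z₀ i = Z₀ at *
  generalize ∑ i, d i * z i = S at *
  have h3 : m * Z * Z - D * Z * Z₀ ≤ S * (Z - Z₀) := by
    nlinarith [mul_le_mul_of_nonneg_right h1 hZ, mul_le_mul_of_nonneg_right h2 hZ₀]
  have h4 : 2 / m * (m * Z * Z - D * Z * Z₀) ≤ 2 / m * (S * (Z - Z₀)) :=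
    mul_le_mul_of_nonneg_left h3 (by positivity)
  have h5 : 2 / m * (m * Z * Z - D * Z * Z₀) = 2 * Z ^ 2 - 2 * Z * (D / m * Z₀) := by
    field_simp
  nlinarith [sq_nonneg (Z - D / m * Z₀)]

theorem integral_spaceTimeCylinder_comp_snd {N : ℕ} {T : ℝ} (hT : 0 ≤ T)
    {Ω : Set (EuclideanSpace ℝ (Fin N))} (f : EuclideanSpace ℝ (Fin N) → ℝ) :
    ∫ p in spaceTimeCylinder T Ω, f p.2 = T * ∫ x in Ω, f x := by
  have h := setIntegral_prod_mul (μ := (volume : Measure ℝ)) (ν := volume)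
    (fun _ : ℝ => (1 : ℝ)) f (Set.Ioo 0 T) Ω
  simp only [one_mul] at h
  rw [spaceTimeCylinder, Measure.volume_eq_prod, h]
  simp [hT]

section Solution

variable {N : ℕ} {T : ℝ} {Ω : Set (EuclideanSpace ℝ (Fin N))} {k l : ℝ → ℝ} {d : Fin 4 → ℝ}
  {ν : ℝ} {a : Fin 4 → ℕ} {c₀ : Fin 4 → EuclideanSpace ℝ (Fin N) → ℝ}
  {c : Fin 4 → ℝ → EuclideanSpace ℝ (Fin N) → ℝ}

/-- The norm estimate for the total entropy, with a constant depending on the ratio of the diffusion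
coefficients and the length of the time interval. -/
theorem IsSmoothSolution.eLpNorm_sum_entropyFun_le (hT : 0 < T) (hD : IsBoundedC1Domain Ω)
    (hk : IsPCPair k l) (hν : 0 < ν) {m D : ℝ} (hm : 0 < m) (hmd : ∀ i, m ≤ d i)
    (hdD : ∀ i, d i ≤ D) (hc₀ : ∀ i, AEStronglyMeasurable (c₀ i) (volume.restrict Ω))
    (hS : IsSmoothSolution T Ω k d ν ν a c₀ c) {M : ℝ} (hM : 0 ≤ M)
    (hcM : ∀ i, ∀ t ∈ Set.Ioo 0 T, ∀ x ∈ closure Ω, c i t x ∈ Set.Icc 0 M)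
    (hc₀M : ∀ i, ∀ᵐ x ∂(volume.restrict Ω), c₀ i x ∈ Set.Icc 0 M) :
    eLpNorm (fun p : ℝ × EuclideanSpace ℝ (Fin N) => ∑ i, entropyFun (c i p.1 p.2)) 2
        (volume.restrict (spaceTimeCylinder T Ω))
      ≤ ENNReal.ofReal (D / m * √T)
        * eLpNorm (fun x => ∑ i, entropyFun (c₀ i x)) 2 (volume.restrict Ω) := by
  have := hD.isFiniteMeasure
  have hd : ∀ i, 0 ≤ d i := fun i => hm.le.trans (hmd i)
  have hDm : 0 ≤ D / m := div_nonneg ((hd 0).trans (hdD 0)) hm.le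
  have hfin : IsFiniteMeasure (volume.restrict (spaceTimeCylinder T Ω)) :=
    ⟨by rw [Measure.restrict_apply_univ]; exact volume_spaceTimeCylinder_lt_top hD T⟩
  obtain ⟨B, hB⟩ := (isCompact_Icc (a := (0 : ℝ)) (b := M)).exists_bound_of_continuousOn
    continuous_entropyFun.continuousOn
  have hcyl : ∀ᵐ p ∂(volume.restrict (spaceTimeCylinder T Ω)), ∀ i, c i p.1 p.2 ∈ Set.Icc 0 M :=
    (ae_restrict_mem (measurableSet_Ioo.prod hD.isOpen.measurableSet)).mono fun p hp i =>
      hcM i p.1 hp.1 p.2 (subset_closure hp.2)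
  have hZ : MemLp (fun p : ℝ × EuclideanSpace ℝ (Fin N) => ∑ i, entropyFun (c i p.1 p.2)) 2
      (volume.restrict (spaceTimeCylinder T Ω)) := by
    refine memLp_finsetSum _ fun i _ => MemLp.of_bound (aestronglyMeasurable_spaceTimeCylinder
      hD.isOpen (continuous_entropyFun.comp_continuousOn (hS.smooth i).continuousOn)) B ?_
    exact hcyl.mono fun p hp => hB _ (hp i)
  have hZ₀ : MemLp (fun x => ∑ i, entropyFun (c₀ i x)) 2 (volume.restrict Ω) := by
    refine memLp_finsetSum _ fun i _ => MemLp.of_bound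
      (continuous_entropyFun.comp_aestronglyMeasurable (hc₀ i)) B ?_
    exact (hc₀M i).mono fun x hx => hB _ hx
  have iZ₀ : Integrable (fun p : ℝ × EuclideanSpace ℝ (Fin N) =>
      (∑ i, entropyFun (c₀ i p.2)) ^ 2) (volume.restrict (spaceTimeCylinder T Ω)) := by
    have := hZ₀.integrable_sq.comp_snd (volume.restrict (Set.Ioo 0 T))
    rwa [Measure.prod_restrict] at this
  have hsq : ∫ p in spaceTimeCylinder T Ω, (∑ i, entropyFun (c i p.1 p.2)) ^ 2
      ≤ (D / m) ^ 2 * T * ∫ x in Ω, (∑ i, entropyFun (c₀ i x)) ^ 2 := by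
    have h1 : ∫ p in spaceTimeCylinder T Ω, ((∑ i, entropyFun (c i p.1 p.2)) ^ 2
        - (D / m) ^ 2 * (∑ i, entropyFun (c₀ i p.2)) ^ 2)
          ≤ ∫ p in spaceTimeCylinder T Ω, 2 / m * entropyIncrementDensity d c₀ c 0 p := by
      refine integral_mono_ae (hZ.integrable_sq.sub (iZ₀.const_mul _)) ?_ ?_
      · obtain ⟨B', hB'⟩ := (isCompact_Icc (a := (0 : ℝ)) (b := M + 1)).exists_bound_of_continuousOn
          continuous_entropyFun.continuousOn
        exact Integrable.const_mul (IntegrableOn.of_bound (volume_spaceTimeCylinder_lt_top hD T)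
          (aestronglyMeasurable_entropyIncrementDensity hD.isOpen hS.smooth hc₀ d 0) _
          (norm_entropyIncrementDensity_le hD.isOpen hd le_rfl zero_le_one
            (fun s hs => (le_abs_self _).trans (hB' s hs)) hcM hc₀M)) _
      · filter_upwards [hcyl, (quasiMeasurePreserving_snd_spaceTimeCylinder T Ω).ae
          (ae_all_iff.2 hc₀M)] with p h2 h3
        have := sq_sum_le_of_weights hm hmd hdD (z := fun i => entropyFun (c i p.1 p.2))
          (z₀ := fun i => entropyFun (c₀ i p.2)) (fun i => entropyFun_nonneg (h2 i).1)
          fun i => entropyFun_nonneg (h3 i).1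
        simpa [entropyIncrementDensity, weightedEntropy] using this
    have h2 := hS.integral_entropyIncrementDensity_nonpos hD hk hν hd hc₀ hM hcM hc₀M
    rw [integral_sub hZ.integrable_sq (iZ₀.const_mul _), integral_const_mul, integral_const_mul,
      integral_spaceTimeCylinder_comp_snd hT.le
        (fun x => (∑ i, entropyFun (c₀ i x)) ^ 2)] at h1
    have h3 := mul_nonpos_of_nonneg_of_nonpos (by positivity : 0 ≤ 2 / m) h2
    linarith
  rw [eLpNorm_two_eq_ofReal_sqrt hZ, eLpNorm_two_eq_ofReal_sqrt hZ₀,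
    ← ENNReal.ofReal_mul (by positivity)]
  refine ENNReal.ofReal_le_ofReal ((Real.sqrt_le_sqrt hsq).trans_eq ?_)
  rw [Real.sqrt_mul (by positivity), Real.sqrt_mul (sq_nonneg _), Real.sqrt_sq hDm]

end Solution

theorem mainTheorem8
    (T : ℝ) (hT : 0 < T) (Λ : ℝ) (d : Fin 4 → ℝ) (hd : ∀ i, 0 < d i) :
    ∃ C : ℝ≥0,
      ∀ (N : ℕ) (Ω : Set (EuclideanSpace ℝ (Fin N))) (k l : ℝ → ℝ) (νf νb : ℝ)
        (a : Fin 4 → ℕ) (c₀ : Fin 4 → EuclideanSpace ℝ (Fin N) → ℝ)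
        (c : Fin 4 → ℝ → EuclideanSpace ℝ (Fin N) → ℝ),
        IsBoundedC1Domain Ω →
        IsPCPair k l →
        (∫ t in Set.Ioo 0 T, |l t|) = Λ →
        0 < νf → νf = νb →
        (∀ i, 0 < a i) →
        (∀ i, MemLp (c₀ i) ∞ (volume.restrict Ω)) →
        (∀ i, ∀ᵐ x ∂(volume.restrict Ω), 0 < c₀ i x) →
        IsSmoothSolution T Ω k d νf νb a c₀ c →
        (∀ i, ∀ t ∈ Set.Ioo 0 T, ∀ x ∈ Ω, 0 < c i t x) →
        ∑ i, eLpNorm (fun p : ℝ × EuclideanSpace ℝ (Fin N) => entropyFun (c i p.1 p.2)) 2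
            (volume.restrict (spaceTimeCylinder T Ω))
          ≤ C * ∑ i, eLpNorm (fun x => entropyFun (c₀ i x)) 2 (volume.restrict Ω) := by
  obtain ⟨i₀, -, hmin⟩ := Finset.exists_min_image Finset.univ d Finset.univ_nonempty
  obtain ⟨i₁, -, hmax⟩ := Finset.exists_max_image Finset.univ d Finset.univ_nonempty
  -- The factor `4` compares the sum of the norms with the norm of the sum.
  refine ⟨4 * (d i₁ / d i₀ * √T).toNNReal, ?_⟩
  intro N Ω k l νf νb a c₀ c hD hk _ hν hνeq _ hc₀ hc₀pos hS hpos
  subst hνeq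
  obtain ⟨M, hM, hcM, hc₀M⟩ := hS.exists_bound hc₀ hc₀pos hpos
  have key := hS.eLpNorm_sum_entropyFun_le hT hD hk hν (hd i₀)
    (fun i => hmin i (Finset.mem_univ i)) (fun i => hmax i (Finset.mem_univ i))
    (fun i => (hc₀ i).1) hM hcM hc₀M
  have hle : ∀ i, eLpNorm (fun p : ℝ × EuclideanSpace ℝ (Fin N) => entropyFun (c i p.1 p.2)) 2
      (volume.restrict (spaceTimeCylinder T Ω))
        ≤ eLpNorm (fun p : ℝ × EuclideanSpace ℝ (Fin N) => ∑ j, entropyFun (c j p.1 p.2)) 2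
          (volume.restrict (spaceTimeCylinder T Ω)) := fun i => by
    refine eLpNorm_mono_ae_real ?_
    filter_upwards [ae_restrict_mem (measurableSet_Ioo.prod hD.isOpen.measurableSet)] with p hp
    have h0 : ∀ j, 0 ≤ entropyFun (c j p.1 p.2) := fun j =>
      entropyFun_nonneg (hpos j p.1 hp.1 p.2 hp.2).le
    rw [Real.norm_of_nonneg (h0 i)]
    exact Finset.single_le_sum (f := fun j => entropyFun (c j p.1 p.2)) (fun j _ => h0 j)
      (Finset.mem_univ i)
  have hsum : eLpNorm (fun x => ∑ i, entropyFun (c₀ i x)) 2 (volume.restrict Ω)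
      ≤ ∑ i, eLpNorm (fun x => entropyFun (c₀ i x)) 2 (volume.restrict Ω) := by
    have h := eLpNorm_sum_le (μ := volume.restrict Ω) (p := 2) (s := Finset.univ)
      (f := fun i x => entropyFun (c₀ i x))
      (fun i _ => continuous_entropyFun.comp_aestronglyMeasurable (hc₀ i).1) (by norm_num)
    convert h using 2
    ext x; simp
  calc _ ≤ ∑ _i : Fin 4, eLpNorm (fun p : ℝ × EuclideanSpace ℝ (Fin N) =>
        ∑ j, entropyFun (c j p.1 p.2)) 2 (volume.restrict (spaceTimeCylinder T Ω)) :=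
        Finset.sum_le_sum fun i _ => hle i
    _ = 4 * eLpNorm (fun p : ℝ × EuclideanSpace ℝ (Fin N) =>
        ∑ j, entropyFun (c j p.1 p.2)) 2 (volume.restrict (spaceTimeCylinder T Ω)) := by simp
    _ ≤ 4 * (ENNReal.ofReal (d i₁ / d i₀ * √T)
        * ∑ i, eLpNorm (fun x => entropyFun (c₀ i x)) 2 (volume.restrict Ω)) := by
        gcongr
        exact key.trans (by gcongr)
    _ = _ := by rw [ENNReal.coe_mul, ← mul_assoc]; rfl
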